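/- \textbf{Definitions.} Let $1\le d<n$ be integers, let $C\ge 1$ and $c_0\in(0,\tfrac12]$, and let $B_r(x)$ denote the open ball in $\mathbb R^n$ (Euclidean distance). A closed set $E\subset\mathbb R^n$ with $\operatorname{diam}(E)>0$ belongs to $\mathrm{Reg}_d(C)$ if $$C^{-1}r^d\le \mathcal H^d(B_r(x)\cap E)\le C r^d\qquad\text{for all }x\in E,\ r\in(0,2\operatorname{diam}(E)),$$ and then $\mu:=\mathcal H^d\lfloor_E$. Put $\mathbb J:=\mathbb Z$ if $E$ is unbounded, and $\mathbb J:=\{j\in\mathbb Z: j\ge m\}$ if $E$ is bounded, where $2^{-m}\le\operatorname{diam}(E)<2^{-m+1}$. A \emph{dyadic system} on $E$ (with constant $c_0$) is a collection $\Delta=\bigcup_{j\in\mathbb J}\Delta_j$, where each $\Delta_j$ is a family of pairwise disjoint Borel subsets $Q\subset E$ (\emph{cubes}) such that: (1) $E=\bigcup_{Q\in\Delta_j}Q$ for each $j\in\mathbb J$; (2) if $i\le j$, $Q\in\Delta_i$ and $Q'\in\Delta_j$, then $Q'\subset Q$ or $Q\cap Q'=\emptyset$; (3) if $i<j$ are in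 $\mathbb J$ and $Q'\in\Delta_j$, there is a unique $Q\in\Delta_i$ with $Q'\subset Q$; (4) $\operatorname{diam}(Q)\le c_0^{-1}2^{-j}$ for $Q\in\Delta_j$; (5) for every $Q\in\Delta_j$ there is $x_Q\in E$ with $B_{c_02^{-j}}(x_Q)\cap E\subset Q$. For a cube $Q$ let $2Q:=\{x\in E:\operatorname{dist}(x,Q)\le\operatorname{diam}(Q)\}$. For a nonnegative function $h$ on the bounded Borel subsets of $E$ of positive $\mu$-measure, $a\in(0,\infty)$ and $M\ge0$, we write $E\in\mathrm{GLem}(h,a,M)$ if for every dyadic system $\Delta$ on $E$ with constant $c_0$ and every $Q_0\in\Delta$ $$\sum_{Q\in\Delta,\ Q\subset Q_0}h(2Q)^a\,\mu(Q)\le M\,\mu(Q_0).$$ Let $\mathcal V_d$ be the family of $d$-dimensional affine planes in $\mathbb R^n$, and let $\pi_V$ be the orthogonal projection of $\mathbb R^n$ onto $V\in\mathcal V_d$. For $p\in[1,\infty)$ and a bounded Borel set $S\subset E$ with $\mu(S)>0$ set $$\beta_{p,\mathcal V_d}(S):=\inf_{V\in\mathcal V_d}\left(\frac1{\mu(S)}\int_S\left[\frac{\operatorname{dist}(x,V)}{\operatorname{diam}(S)}\right]^p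 d\mu(x)\right)^{1/p},$$ $$\iota_{p,\mathcal V_d}(S):=\inf_{V\in\mathcal V_d}\left(\frac1{\mu(S)^2}\int_S\int_S\left[\frac{\bigl||x-y|-|\pi_V(x)-\pi_V(y)|\bigr|}{\operatorname{diam}(S)}\right]^p d\mu(x)\,d\mu(y)\right)^{1/p}.$$ \textbf{Theorem.} Let $d\ge1$ be an integer, $C\ge1$, $1\le p\le q<\infty$ and $c_0\in(0,\tfrac12]$. There is a constant $\hat C$, depending only on $d$, $C$, $p$, $q$ and on the constant $c_0$ fixed in the definition of dyadic systems, such that for every integer $n>d$, every $E\subset\mathbb R^n$ with $E\in\mathrm{Reg}_d(C)$, and every $M\ge0$: $$E\in\mathrm{GLem}(\beta_{2p,\mathcal V_d},2q,M)\ \Longrightarrow\ E\in\mathrm{GLem}(\iota_{p,\mathcal V_d},q,\hat C M).$$ In particular, if $c_0=c_0(d,C)$ is chosen as a function of $d$ and $C$, then $\hat C$ depends only on $d$, $C$, $p$, $q$. -/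

import Mathlib

open scoped NNReal ENNReal MeasureTheory

noncomputable section

namespace GeometricLemma

section Metric

variable {X : Type*} [MetricSpace X] [MeasurableSpace X] [BorelSpace X]

/-- `E ∈ Reg_s(C)`: `E` is a closed set of positive diameter, and
`C⁻¹ r ^ s ≤ ℋ^s (B_r(x) ∩ E) ≤ C r ^ s` for all `x ∈ E` and `0 < r < 2 diam E`
(every `r > 0` if `E` is unbounded). -/
structure IsRegular (s C : ℝ) (E : Set X) : Prop where
  s_pos : 0 < s
  one_le : 1 ≤ C
  isClosed : IsClosed E
  diam_pos : 0 < Metric.ediam E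
  lower : ∀ x ∈ E, ∀ r : ℝ, 0 < r → ENNReal.ofReal r < 2 * Metric.ediam E →
    ENNReal.ofReal (C⁻¹ * r ^ s) ≤ μH[s] (Metric.ball x r ∩ E)
  upper : ∀ x ∈ E, ∀ r : ℝ, 0 < r → ENNReal.ofReal r < 2 * Metric.ediam E →
    μH[s] (Metric.ball x r ∩ E) ≤ ENNReal.ofReal (C * r ^ s)

/-- The measure `μ = ℋ^s ⌊ E`. -/
def surfaceMeasure (s : ℝ) (E : Set X) : MeasureTheory.Measure X :=
  (μH[s] : MeasureTheory.Measure X).restrict E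

/-- The set `𝕁` of admissible generations of cubes of `E`. If `E` is unbounded, it is all of `ℤ`.
If `E` is bounded and `2⁻ⁿ ≤ diam E < 2⁻ⁿ⁺¹`, then `2⁻ʲ ≤ diam E` holds exactly for `j ≥ n`. -/
def generations (E : Set X) : Set ℤ :=
  {j | Bornology.IsBounded E → (2 : ℝ) ^ (-j) ≤ Metric.diam E}

/-- A system of dyadic cubes on `E` with constant `c₀`: the cubes of generation `j ∈ 𝕁`
form the family `gen j` (the values `gen j` for `j ∉ 𝕁` play no role). -/
structure DyadicSystem (c₀ : ℝ) (E : Set X) where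
  gen : ℤ → Set (Set X)
  measurable : ∀ j ∈ generations E, ∀ Q ∈ gen j, MeasurableSet Q
  subset : ∀ j ∈ generations E, ∀ Q ∈ gen j, Q ⊆ E
  pairwise_disjoint : ∀ j ∈ generations E, ∀ Q ∈ gen j, ∀ Q' ∈ gen j, Q ≠ Q' → Disjoint Q Q'
  cover : ∀ j ∈ generations E, E = ⋃ Q ∈ gen j, Q
  nested : ∀ i ∈ generations E, ∀ j ∈ generations E, i ≤ j →
    ∀ Q ∈ gen i, ∀ Q' ∈ gen j, Q' ⊆ Q ∨ Disjoint Q Q'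
  ancestor : ∀ j ∈ generations E, ∀ Q' ∈ gen j, ∀ i ∈ generations E, i < j →
    ∃! Q, Q ∈ gen i ∧ Q' ⊆ Q
  diam_le : ∀ j ∈ generations E, ∀ Q ∈ gen j,
    Metric.ediam Q ≤ ENNReal.ofReal (c₀⁻¹ * (2 : ℝ) ^ (-j))
  center : ∀ j ∈ generations E, ∀ Q ∈ gen j,
    ∃ x ∈ E, Metric.ball x (c₀ * (2 : ℝ) ^ (-j)) ∩ E ⊆ Q

/-- The collection `Δ = ⋃_{j ∈ 𝕁} Δ_j` of all cubes of the system. -/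
def DyadicSystem.cubes {c₀ : ℝ} {E : Set X} (Δ : DyadicSystem c₀ E) : Set (Set X) :=
  {Q | ∃ j ∈ generations E, Q ∈ Δ.gen j}

/-- The enlarged cube `K Q = {x ∈ E : dist (x, Q) ≤ (K - 1) diam Q}`. -/
def dilate (E : Set X) (K : ℝ) (Q : Set X) : Set X :=
  {x ∈ E | Metric.infDist x Q ≤ (K - 1) * Metric.diam Q}

/-- `E ∈ GLem(h, p, M)` for an `s`-regular set `E`: for every dyadic system `Δ` on `E` (with the
fixed constant `c₀`) and every `Q₀ ∈ Δ`,
`∑_{Q ∈ Δ, Q ⊆ Q₀} h(2Q) ^ p μ(Q) ≤ M μ(Q₀)`, where `μ = ℋ^s ⌊ E`.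
Only the values of `h` at bounded Borel subsets of `E` of positive measure matter. -/
def GLem (c₀ s : ℝ) (E : Set X) (h : Set X → ℝ) (p : ℝ) (M : ℝ≥0) : Prop :=
  ∀ Δ : DyadicSystem c₀ E, ∀ Q₀ ∈ Δ.cubes,
    ∑' Q : {Q : Set X // Q ∈ Δ.cubes ∧ Q ⊆ Q₀},
        ENNReal.ofReal (h (dilate E 2 Q.1) ^ p) * surfaceMeasure s E Q.1
      ≤ (M : ℝ≥0∞) * surfaceMeasure s E Q₀

/-- `β_{p,V}(S)` for a single set `V`, with respect to the measure `μ`. -/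
def betaSingle (μ : MeasureTheory.Measure X) (p : ℝ) (V S : Set X) : ℝ :=
  (1 / μ.real S * ∫ x in S, (Metric.infDist x V / Metric.diam S) ^ p ∂μ) ^ (1 / p)

/-- `ι_{p,V}(S)` for a single projection `π = π_V`, with respect to the measure `μ`. -/
def iotaSingle (μ : MeasureTheory.Measure X) (p : ℝ) (π : X → X) (S : Set X) : ℝ :=
  (1 / μ.real S ^ 2 *
    ∫ y in S, ∫ x in S, (|dist x y - dist (π x) (π y)| / Metric.diam S) ^ p ∂μ ∂μ) ^ (1 / p)

end Metric

/-- `𝒱_d(ℝⁿ)`: the `d`-dimensional affine planes in `ℝⁿ`. -/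
abbrev Planes (d n : ℕ) : Type :=
  {V : AffineSubspace ℝ (EuclideanSpace ℝ (Fin n)) //
    Nonempty V ∧ Module.finrank ℝ V.direction = d}

/-- The orthogonal projection `π_V` of `ℝⁿ` onto the plane `V`. -/
def Planes.proj {d n : ℕ} (V : Planes d n) (x : EuclideanSpace ℝ (Fin n)) :
    EuclideanSpace ℝ (Fin n) :=
  haveI : Nonempty V.1 := V.2.1
  (EuclideanGeometry.orthogonalProjection V.1 x : EuclideanSpace ℝ (Fin n))

/-- `β_{p,𝒱_d}(S)` for a subset `S` of the `d`-regular set `E ⊆ ℝⁿ`. -/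
def beta {n : ℕ} (d : ℕ) (E : Set (EuclideanSpace ℝ (Fin n))) (p : ℝ)
    (S : Set (EuclideanSpace ℝ (Fin n))) : ℝ :=
  ⨅ V : Planes d n, betaSingle (surfaceMeasure (d : ℝ) E) p (V.1 : Set _) S

/-- `ι_{p,𝒱_d}(S)` for a subset `S` of the `d`-regular set `E ⊆ ℝⁿ`. -/
def iota {n : ℕ} (d : ℕ) (E : Set (EuclideanSpace ℝ (Fin n))) (p : ℝ)
    (S : Set (EuclideanSpace ℝ (Fin n))) : ℝ :=
  ⨅ V : Planes d n, iotaSingle (surfaceMeasure (d : ℝ) E) p V.proj S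

end GeometricLemma

end

/-!
Let `x ≠ y` lie in the dilate of a cube `Q`, and follow the cubes containing `x` down to the last
cube `T` whose dilate still contains `y`; then `|x - y|` is comparable to the size of `T`. For a
`d`-plane `V` with linear part `W`, the defect `|x - y| - |π_V x - π_V y|` is at most the square of
the distance from `x - y` to `W`, divided by `|x - y|`. This distance is controlled by the distances
of `x` and `y` to the plane of `T` and by `|x - y|` times the angle between `W` and the direction of
that plane, and the angle is at most the sum of the `β`-numbers along the chain of cubes from `Q`
to `T`. It is this square that turns the exponents `2p, 2q` of `β` into the exponents `p, q` of `ι`.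

Integrating over `x` and `y` and using Jensen's inequality with exponent `q / p`, `ι(2Q)^q μ(Q)` is
bounded by a sum of `β(2T)^{2q} μ(T)` over the cubes `T` near `Q`, with coefficients decaying
geometrically in the difference of generations, because a pair `x, y` with last cube `T` is rare.
Interchanging the sums, and using that boundedly many cubes `Q` of a generation are near a given
`T`, gives the packing condition. If `E` is bounded, the cubes of the first generation are merged
into one, so that the chains can start a bounded number of generations above `Q`.
-/

noncomputable section

namespace GeometricLemma

open MeasureTheory Metric

section InnerProduct

variable {F : Type*} [NormedAddCommGroup F] [InnerProductSpace ℝ F] [FiniteDimensional ℝ F]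

lemma norm_le_norm_orthogonal_add_sum_abs_inner {ι : Type*} [Fintype ι] {W : Submodule ℝ F}
    (b : OrthonormalBasis ι ℝ W) (z : F) :
    ‖z‖ ≤ ‖Wᗮ.starProjection z‖ + ∑ i, |inner ℝ (b i : F) z| := by
  have hsum : W.starProjection z = ∑ i, inner ℝ (b i : F) z • (b i : F) := by
    rw [Submodule.starProjection_apply, b.orthogonalProjectionOnto_apply_eq_sum]
    simp only [Submodule.coe_sum, Submodule.coe_smul]
  have hW : ‖W.starProjection z‖ ≤ ∑ i, |inner ℝ (b i : F) z| := by
    rw [hsum]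
    refine (norm_sum_le _ _).trans_eq (Finset.sum_congr rfl fun i _ => ?_)
    rw [norm_smul, Submodule.norm_coe, b.norm_eq_one, mul_one, Real.norm_eq_abs]
  calc ‖z‖ = ‖W.starProjection z + Wᗮ.starProjection z‖ := by
        rw [Submodule.starProjection_add_starProjection_orthogonal]
    _ ≤ ‖W.starProjection z‖ + ‖Wᗮ.starProjection z‖ := norm_add_le _ _
    _ ≤ _ := by linarith

lemma exists_orthonormalBasis_apply_eq {w : F} (hw : ‖w‖ = 1) :
    ∃ (b : OrthonormalBasis (Fin (Module.finrank ℝ F)) ℝ F) (i : Fin (Module.finrank ℝ F)),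
      b i = w := by
  have hpos : 0 < Module.finrank ℝ F :=
    Module.finrank_pos_iff_exists_ne_zero.2 ⟨w, norm_ne_zero_iff.1 (by simp [hw])⟩
  have hon : Orthonormal ℝ (({⟨0, hpos⟩} : Set (Fin _)).domRestrict fun _ => w) :=
    ⟨fun _ => hw, fun i j hij => (hij (Subsingleton.elim i j)).elim⟩
  obtain ⟨b, hb⟩ := hon.exists_orthonormalBasis_extension_of_card_eq (by simp)
  exact ⟨b, _, hb _ rfl⟩

variable [MeasurableSpace F] {μ : Measure F} {W : Submodule ℝ F}

lemma measure_le_prod_of_abs_inner_le {ι : Type*} [Fintype ι] (b : OrthonormalBasis ι ℝ W)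
    {A : Set F} {s : ℝ} {m : ℝ≥0∞} {N : ι → ℕ} (hs : 0 < s)
    (hball : ∀ x ∈ A, μ (ball x ((Fintype.card ι + 3) * s)) ≤ m)
    (hperp : ∀ x ∈ A, ∀ y ∈ A, ‖Wᗮ.starProjection (x - y)‖ ≤ 2 * s)
    (hin : ∀ x ∈ A, ∀ y ∈ A, ∀ i, |inner ℝ (b i : F) (x - y)| ≤ N i * s) :
    μ A ≤ ((∏ i, (2 * N i + 1) : ℕ) : ℝ≥0∞) * m := by
  classical
  rcases A.eq_empty_or_nonempty with rfl | ⟨x₁, hx₁⟩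
  · simp
  let cell (x : F) (i : ι) : ℤ := ⌊inner ℝ (b i : F) (x - x₁) / s⌋
  let I : Finset (ι → ℤ) := Fintype.piFinset fun i => Finset.Icc (-(N i : ℤ)) (N i)
  have hcover : A ⊆ ⋃ v ∈ I, {x ∈ A | cell x = v} := by
    intro x hx
    simp only [Set.mem_iUnion]
    refine ⟨cell x, Fintype.mem_piFinset.2 fun i => Finset.mem_Icc.2 ?_, hx, rfl⟩
    have hle : |inner ℝ (b i : F) (x - x₁) / s| ≤ N i := by
      rw [abs_div, abs_of_pos hs, div_le_iff₀ hs]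
      exact hin x hx x₁ hx₁ i
    obtain ⟨hlo, hhi⟩ := abs_le.1 hle
    refine ⟨Int.le_floor.2 (by push_cast; exact hlo), ?_⟩
    exact_mod_cast (Int.floor_le _).trans hhi
  have hcell : ∀ v ∈ I, μ {x ∈ A | cell x = v} ≤ m := by
    intro v _
    rcases Set.eq_empty_or_nonempty {x ∈ A | cell x = v} with h | ⟨y, hyA, hyv⟩
    · simp [h]
    refine (measure_mono ?_).trans (hball y hyA)
    rintro x ⟨hxA, hxv⟩
    have hcoord : ∀ i, |inner ℝ (b i : F) (x - y)| ≤ s := by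
      intro i
      have h := Int.abs_sub_lt_one_of_floor_eq_floor (congrFun (hxv.trans hyv.symm) i)
      rw [← sub_div, ← inner_sub_right, sub_sub_sub_cancel_right, abs_div, abs_of_pos hs,
        div_lt_one hs] at h
      exact h.le
    have hsum : ∑ i, |inner ℝ (b i : F) (x - y)| ≤ Fintype.card ι * s := by
      simpa using Finset.sum_le_sum fun i (_ : i ∈ Finset.univ) => hcoord i
    have hnorm := norm_le_norm_orthogonal_add_sum_abs_inner b (x - y)
    rw [mem_ball_iff_norm]
    linarith [hperp x hxA y hyA]
  have hcard : I.card = ∏ i, (2 * N i + 1) := by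
    rw [Fintype.card_piFinset]
    exact Finset.prod_congr rfl fun i _ => by rw [Int.card_Icc]; omega
  calc μ A ≤ μ (⋃ v ∈ I, {x ∈ A | cell x = v}) := measure_mono hcover
    _ ≤ ∑ v ∈ I, μ {x ∈ A | cell x = v} := measure_biUnion_finset_le _ _
    _ ≤ ∑ _v ∈ I, m := Finset.sum_le_sum hcell
    _ = _ := by rw [Finset.sum_const, nsmul_eq_mul, hcard]

/-- The constant of `measure_slab_le`: an upper `d`-regular measure with constant `C` gives a slab
of relative width `η` in a ball of radius `r` at most the mass `slabConst d C * η * r ^ d`. -/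
def slabConst (d : ℕ) (C : ℝ) : ℝ := C * (7 * (d + 3)) ^ d

lemma one_le_slabConst (d : ℕ) {C : ℝ} (hC : 1 ≤ C) : 1 ≤ slabConst d C :=
  one_le_mul_of_one_le_of_one_le hC
    (one_le_pow₀ (by linarith [(Nat.cast_nonneg d : (0 : ℝ) ≤ d)]))

lemma prod_slab_cells_le {d : ℕ} (i₀ : Fin d) {η : ℝ} (hη : 0 < η) (hη1 : η ≤ 1) :
    ((∏ i, (2 * (if i = i₀ then 2 else ⌈2 / η⌉₊) + 1) : ℕ) : ℝ) ≤ 7 * (7 / η) ^ (d - 1) := by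
  have hceil : (2 * ⌈2 / η⌉₊ + 1 : ℝ) ≤ 7 / η := by
    have h1 : (⌈2 / η⌉₊ : ℝ) < 2 / η + 1 := Nat.ceil_lt_add_one (by positivity)
    have h2 : 1 ≤ 1 / η := (one_le_div₀ hη).2 hη1
    have h3 : 7 / η = 2 * (2 / η) + 3 * (1 / η) := by ring
    linarith
  rw [← Finset.mul_prod_erase _ _ (Finset.mem_univ i₀), Finset.prod_congr rfl
    fun i hi => by rw [if_neg (Finset.ne_of_mem_erase hi)], if_pos rfl, Finset.prod_const,
    Finset.card_erase_of_mem (Finset.mem_univ _), Finset.card_univ, Fintype.card_fin]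
  push_cast
  gcongr
  norm_num

lemma measure_slab_le {d : ℕ} (hW : Module.finrank ℝ W = d) {A : Set F} {C η r : ℝ} {w : F}
    (hC : 0 ≤ C) (hη : 0 < η) (hη1 : η ≤ 1) (hr : 0 < r) (hwW : w ∈ W) (hw : ‖w‖ = 1)
    (hup : ∀ x ∈ A, ∀ ρ : ℝ, 0 < ρ → μ (ball x ρ) ≤ ENNReal.ofReal (C * ρ ^ d))
    (hdiam : ∀ x ∈ A, ∀ y ∈ A, ‖x - y‖ ≤ 2 * r)
    (hperp : ∀ x ∈ A, ∀ y ∈ A, ‖Wᗮ.starProjection (x - y)‖ ≤ 2 * (η * r))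
    (hin : ∀ x ∈ A, ∀ y ∈ A, |inner ℝ w (x - y)| ≤ 2 * (η * r)) :
    μ A ≤ ENNReal.ofReal (slabConst d C * η * r ^ d) := by
  subst hW
  obtain ⟨b, i₀, hb⟩ := exists_orthonormalBasis_apply_eq (F := W) (w := ⟨w, hwW⟩) hw
  have hs : 0 < η * r := mul_pos hη hr
  refine (measure_le_prod_of_abs_inner_le b (N := fun i => if i = i₀ then 2 else ⌈2 / η⌉₊) hs
    (fun x hx => hup x hx _ (by positivity)) hperp fun x hx y hy i => ?_).trans ?_
  · split_ifs with hi
    · simpa [hi, hb] using hin x hx y hy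
    · refine (abs_real_inner_le_norm _ _).trans ?_
      rw [Submodule.norm_coe, b.norm_eq_one, one_mul]
      calc ‖x - y‖ ≤ 2 / η * (η * r) := by
            rw [← mul_assoc, div_mul_cancel₀ _ hη.ne']
            exact hdiam x hx y hy
        _ ≤ ⌈2 / η⌉₊ * (η * r) := by gcongr; exact Nat.le_ceil _
  · rw [← ENNReal.ofReal_natCast, ← ENNReal.ofReal_mul (Nat.cast_nonneg _)]
    refine ENNReal.ofReal_le_ofReal ((mul_le_mul_of_nonneg_right
      (prod_slab_cells_le i₀ hη hη1) (by positivity)).trans_eq ?_)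
    obtain ⟨m, hm⟩ := Nat.exists_eq_succ_of_ne_zero i₀.pos.ne'
    simp only [Fintype.card_fin, slabConst, hm, Nat.succ_sub_one, pow_succ, mul_pow, div_pow]
    field_simp

end InnerProduct

section Angle

variable {F : Type*} [NormedAddCommGroup F] [InnerProductSpace ℝ F] [FiniteDimensional ℝ F]
  {U V W : Submodule ℝ F} {A B : ℝ}

/-- The subspace `U` is within angle `A` of the subspace `W`: passing from `W` to `U` increases the
orthogonal component of a vector `u` by at most `A * ‖u‖`. In this form the angles along a chain of
subspaces add up. -/
def AngleLE (U W : Submodule ℝ F) (A : ℝ) : Prop :=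
  ∀ u, ‖Uᗮ.starProjection u‖ ≤ ‖Wᗮ.starProjection u‖ + A * ‖u‖

lemma AngleLE.trans (hUV : AngleLE U V A) (hVW : AngleLE V W B) : AngleLE U W (A + B) := fun u => by
  linarith [hUV u, hVW u, add_mul A B ‖u‖]

lemma AngleLE.mono (h : AngleLE U W A) (hAB : A ≤ B) : AngleLE U W B :=
  fun u => (h u).trans (by gcongr)

lemma angleLE_of_forall_mem (hA : 0 ≤ A) (h : ∀ w ∈ W, ‖Uᗮ.starProjection w‖ ≤ A * ‖w‖) :
    AngleLE U W A := fun u => by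
  calc ‖Uᗮ.starProjection u‖
      = ‖Uᗮ.starProjection (W.starProjection u) + Uᗮ.starProjection (Wᗮ.starProjection u)‖ := by
        rw [← map_add, Submodule.starProjection_add_starProjection_orthogonal]
    _ ≤ ‖Uᗮ.starProjection (W.starProjection u)‖ + ‖Uᗮ.starProjection (Wᗮ.starProjection u)‖ :=
        norm_add_le _ _
    _ ≤ A * ‖u‖ + ‖Wᗮ.starProjection u‖ := by
        gcongr
        · exact (h _ (Submodule.starProjection_apply_mem W u)).trans
            (by gcongr; exact W.norm_starProjection_apply_le u)
        · exact Uᗮ.norm_starProjection_apply_le _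
    _ = _ := add_comm _ _

lemma inner_starProjection_self_right (U : Submodule ℝ F) (w z : F) :
    inner ℝ (U.starProjection w) (U.starProjection z) = inner ℝ (U.starProjection w) z := by
  rw [← Submodule.inner_starProjection_left_eq_right, Submodule.starProjection_eq_self_iff.2
    (Submodule.starProjection_apply_mem U w)]

lemma sq_norm_starProjection_orthogonal_le (U : Submodule ℝ F) {w : F} (hw : w ∈ W) :
    ‖Uᗮ.starProjection w‖ ^ 2 ≤ ‖W.starProjection (Uᗮ.starProjection w)‖ * ‖w‖ := by
  calc ‖Uᗮ.starProjection w‖ ^ 2 = inner ℝ (W.starProjection (Uᗮ.starProjection w)) w := by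
        rw [Submodule.inner_starProjection_left_eq_right, Submodule.starProjection_eq_self_iff.2 hw,
          ← inner_starProjection_self_right, real_inner_self_eq_norm_sq]
    _ ≤ _ := real_inner_le_norm _ _

lemma abs_inner_starProjection_starProjection_orthogonal_le (U W : Submodule ℝ F) (w z : F) :
    |inner ℝ (W.starProjection (Uᗮ.starProjection w)) z| ≤
      ‖Uᗮ.starProjection w‖ * (‖Uᗮ.starProjection z‖ + ‖Wᗮ.starProjection z‖) := by
  set e := Uᗮ.starProjection w with he
  have hz : W.starProjection z = z - Wᗮ.starProjection z :=
    eq_sub_of_add_eq (Submodule.starProjection_add_starProjection_orthogonal z)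
  rw [Submodule.inner_starProjection_left_eq_right, hz, inner_sub_right, he,
    ← inner_starProjection_self_right, ← he, mul_add]
  exact (abs_sub _ _).trans (add_le_add (abs_real_inner_le_norm _ _) (abs_real_inner_le_norm _ _))

variable [MeasurableSpace F] {μ : Measure F}

/- If `w ∈ W` made a large angle with `U`, then `G`, being thin both across `U` and across `W`,
would lie in a thin slab of `W` orthogonal to the projection to `W` of the component of `w`
orthogonal to `U`. -/
lemma angleLE_of_slabConst_lt_measure {d : ℕ} (hW : Module.finrank ℝ W = d) {G : Set F}
    {C η r t : ℝ} (hC : 0 ≤ C) (hη : 0 < η) (hη1 : η ≤ 1) (hr : 0 < r) (ht : 0 ≤ t)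
    (hup : ∀ x ∈ G, ∀ ρ : ℝ, 0 < ρ → μ (ball x ρ) ≤ ENNReal.ofReal (C * ρ ^ d))
    (hdiam : ∀ x ∈ G, ∀ y ∈ G, ‖x - y‖ ≤ 2 * r)
    (hGU : ∀ x ∈ G, ∀ y ∈ G, ‖Uᗮ.starProjection (x - y)‖ ≤ 2 * t)
    (hGW : ∀ x ∈ G, ∀ y ∈ G, ‖Wᗮ.starProjection (x - y)‖ ≤ 2 * t)
    (hG : ENNReal.ofReal (slabConst d C * η * r ^ d) < μ G) :
    AngleLE U W (4 * t / (η * r)) := by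
  have hηr : 0 < η * r := mul_pos hη hr
  refine angleLE_of_forall_mem (by positivity) fun w hw => ?_
  set e := Uᗮ.starProjection w
  set w' := W.starProjection e
  have hw' : ‖w'‖ * (η * r) ≤ 4 * t * ‖e‖ := by
    rcases lt_or_ge (η * r) t with htr | htr
    · calc ‖w'‖ * (η * r) ≤ ‖e‖ * t := by gcongr; exact W.norm_starProjection_apply_le e
        _ ≤ 4 * t * ‖e‖ := by nlinarith [mul_nonneg ht (norm_nonneg e)]
    rcases eq_or_ne w' 0 with h0 | h0
    · rw [h0, norm_zero, zero_mul]
      positivity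
    have hn0 : 0 < ‖w'‖ := norm_pos_iff.2 h0
    by_contra! hlt
    refine hG.not_ge (measure_slab_le hW hC hη hη1 hr
      (W.smul_mem ‖w'‖⁻¹ (W.starProjection_apply_mem e)) (norm_smul_inv_norm h0) hup hdiam
      (fun x hx y hy => (hGW x hx y hy).trans (by linarith)) fun x hx y hy => ?_)
    rw [real_inner_smul_left, abs_mul, abs_of_pos (inv_pos.2 hn0), inv_mul_le_iff₀ hn0]
    have hin : |inner ℝ w' (x - y)| ≤
        ‖e‖ * (‖Uᗮ.starProjection (x - y)‖ + ‖Wᗮ.starProjection (x - y)‖) :=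
      abs_inner_starProjection_starProjection_orthogonal_le U W w (x - y)
    have hthin : ‖e‖ * (‖Uᗮ.starProjection (x - y)‖ + ‖Wᗮ.starProjection (x - y)‖) ≤
        ‖e‖ * (2 * t + 2 * t) := by
      gcongr
      exacts [hGU x hx y hy, hGW x hx y hy]
    linarith [hin.trans hthin, mul_pos hn0 hηr]
  rcases (norm_nonneg e).eq_or_lt with h0 | h0
  · rw [← h0]
    positivity
  rw [div_mul_eq_mul_div, le_div_iff₀ hηr]
  refine le_of_mul_le_mul_left ?_ h0
  calc ‖e‖ * (‖e‖ * (η * r)) = ‖e‖ ^ 2 * (η * r) := by ring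
    _ ≤ ‖w'‖ * ‖w‖ * (η * r) := by gcongr; exact sq_norm_starProjection_orthogonal_le U hw
    _ = ‖w'‖ * (η * r) * ‖w‖ := by ring
    _ ≤ 4 * t * ‖e‖ * ‖w‖ := by gcongr
    _ = ‖e‖ * (4 * t * ‖w‖) := by ring

end Angle

section Chebyshev

variable {X : Type*} [MeasurableSpace X] {μ : Measure X} {f g : X → ℝ} {S : Set X} {s m a K : ℝ}

lemma measure_le_of_lintegral_rpow_le (hf : Measurable f) (hs : 1 ≤ s) (hm : 0 ≤ m) (ha : 0 < a)
    (hK : 1 ≤ K) (hint : ∫⁻ x in S, ENNReal.ofReal (f x ^ s) ∂μ ≤ ENNReal.ofReal (m * a ^ s)) :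
    μ {x ∈ S | K * a ≤ f x} ≤ ENNReal.ofReal (m / K) := by
  have hK0 : 0 < K := one_pos.trans_le hK
  have hpow : 0 < (K * a) ^ s := by positivity
  have hsub : {x ∈ S | K * a ≤ f x} ⊆
      {x | ENNReal.ofReal ((K * a) ^ s) ≤ ENNReal.ofReal (f x ^ s)} ∩ S := fun x hx =>
    ⟨ENNReal.ofReal_le_ofReal (Real.rpow_le_rpow (by positivity) hx.2 (by linarith)), hx.1⟩
  calc μ {x ∈ S | K * a ≤ f x}
      ≤ μ.restrict S {x | ENNReal.ofReal ((K * a) ^ s) ≤ ENNReal.ofReal (f x ^ s)} :=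
        (measure_mono hsub).trans (Measure.le_restrict_apply _ _)
    _ ≤ ENNReal.ofReal (m * a ^ s) / ENNReal.ofReal ((K * a) ^ s) :=
        (meas_ge_le_lintegral_div (by fun_prop) (by simpa using hpow) ENNReal.ofReal_ne_top).trans
          (by gcongr)
    _ = ENNReal.ofReal (m / K ^ s) := by
        rw [← ENNReal.ofReal_div_of_pos hpow, Real.mul_rpow hK0.le ha.le,
          mul_div_mul_right _ _ (by positivity)]
    _ ≤ ENNReal.ofReal (m / K) := by
        gcongr
        exact Real.self_le_rpow_of_one_le hK hs

lemma lt_measure_of_lintegral_rpow_le (hf : Measurable f) (hg : Measurable g) (hs : 1 ≤ s)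
    (hm : 0 ≤ m) (ha : 0 < a) (hK : 1 ≤ K)
    (hfint : ∫⁻ x in S, ENNReal.ofReal (f x ^ s) ∂μ ≤ ENNReal.ofReal (m * a ^ s))
    (hgint : ∫⁻ x in S, ENNReal.ofReal (g x ^ s) ∂μ ≤ ENNReal.ofReal (m * a ^ s))
    (hS : ENNReal.ofReal (3 * (m / K)) < μ S) :
    ENNReal.ofReal (m / K) < μ {x ∈ S | f x < K * a ∧ g x < K * a} := by
  by_contra! hle
  have hmK : 0 ≤ m / K := by positivity
  have hsub : S ⊆ {x ∈ S | f x < K * a ∧ g x < K * a} ∪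
      ({x ∈ S | K * a ≤ f x} ∪ {x ∈ S | K * a ≤ g x}) := by
    intro x hx
    by_cases hfx : f x < K * a <;> by_cases hgx : g x < K * a <;> simp_all
  refine hS.not_ge ?_
  calc μ S ≤ μ {x ∈ S | f x < K * a ∧ g x < K * a} +
        (μ {x ∈ S | K * a ≤ f x} + μ {x ∈ S | K * a ≤ g x}) :=
        (measure_mono hsub).trans ((measure_union_le _ _).trans
          (add_le_add_right (measure_union_le _ _) _))
    _ ≤ ENNReal.ofReal (m / K) + (ENNReal.ofReal (m / K) + ENNReal.ofReal (m / K)) :=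
        add_le_add hle (add_le_add (measure_le_of_lintegral_rpow_le hf hs hm ha hK hfint)
          (measure_le_of_lintegral_rpow_le hg hs hm ha hK hgint))
    _ = ENNReal.ofReal (3 * (m / K)) := by
        rw [← ENNReal.ofReal_add hmK hmK, ← ENNReal.ofReal_add hmK (by positivity)]
        congr 1
        ring

end Chebyshev

section AffineSubspace

variable {F : Type*} [NormedAddCommGroup F] [InnerProductSpace ℝ F] [FiniteDimensional ℝ F]

lemma starProjection_orthogonal_direction_sub (V : AffineSubspace ℝ F) [Nonempty V] (x y : F) :
    V.directionᗮ.starProjection (x - y) =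
      (x - EuclideanGeometry.orthogonalProjection V x) -
        (y - EuclideanGeometry.orthogonalProjection V y) := by
  have h := congrArg Subtype.val ((EuclideanGeometry.orthogonalProjection V).linearMap_vsub x y)
  rw [EuclideanGeometry.orthogonalProjection_linear] at h
  have h' : V.direction.starProjection (x - y) =
      EuclideanGeometry.orthogonalProjection V x - EuclideanGeometry.orthogonalProjection V y := h
  rw [Submodule.starProjection_orthogonal_val, h']
  abel

lemma norm_starProjection_orthogonal_direction_sub_le (V : AffineSubspace ℝ F) [Nonempty V]
    (x y : F) :
    ‖V.directionᗮ.starProjection (x - y)‖ ≤ infDist x (V : Set F) + infDist y (V : Set F) := by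
  rw [starProjection_orthogonal_direction_sub,
    ← EuclideanGeometry.dist_orthogonalProjection_eq_infDist,
    ← EuclideanGeometry.dist_orthogonalProjection_eq_infDist, dist_eq_norm, dist_eq_norm]
  exact norm_sub_le _ _

lemma abs_norm_sub_norm_starProjection_mul_norm_le (W : Submodule ℝ F) (u : F) :
    |‖u‖ - ‖W.starProjection u‖| * ‖u‖ ≤ ‖Wᗮ.starProjection u‖ ^ 2 := by
  have hle := W.norm_starProjection_apply_le u
  have hpyth := Submodule.norm_sq_eq_add_norm_sq_starProjection u W
  rw [abs_of_nonneg (sub_nonneg.2 hle)]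
  nlinarith [norm_nonneg (W.starProjection u)]

/-- The constant of `angleLE_of_lintegral_infDist_le`: two `d`-planes which are both `a`-close, on
average, to the same part of an upper `d`-regular measure with constant `C` are within angle
`angleConst d C * a` of each other. -/
def angleConst (d : ℕ) (C : ℝ) : ℝ := 64 * C ^ 2 * slabConst d C

lemma angleLE_of_lintegral_infDist_le [MeasurableSpace F] [BorelSpace F] {μ : Measure F}
    {V W : AffineSubspace ℝ F} [Nonempty V] [Nonempty W] {d : ℕ}
    (hW : Module.finrank ℝ W.direction = d) {S : Set F} {x₀ : F} {C r a s : ℝ} (hC : 1 ≤ C)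
    (hr : 0 < r) (ha : 0 < a) (hs : 1 ≤ s)
    (hup : ∀ x ∈ S, ∀ ρ : ℝ, 0 < ρ → μ (ball x ρ) ≤ ENNReal.ofReal (C * ρ ^ d))
    (hSr : S ⊆ ball x₀ r) (hlow : ENNReal.ofReal (C⁻¹ * r ^ d) ≤ μ S)
    (hV_int : ∫⁻ x in S, ENNReal.ofReal (infDist x V ^ s) ∂μ ≤
      ENNReal.ofReal (r ^ d * (a * r) ^ s))
    (hW_int : ∫⁻ x in S, ENNReal.ofReal (infDist x W ^ s) ∂μ ≤
      ENNReal.ofReal (r ^ d * (a * r) ^ s)) :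
    AngleLE V.direction W.direction (angleConst d C * a) := by
  have hC0 : 0 < C := one_pos.trans_le hC
  have hD := one_le_slabConst d hC
  have : 0 < slabConst d C := one_pos.trans_le hD
  set t := 4 * C * (a * r) with ht
  set η := 1 / (4 * C * slabConst d C) with hη
  have hη1 : η ≤ 1 := by
    rw [hη, div_le_one (by positivity)]
    nlinarith
  have hG := lt_measure_of_lintegral_rpow_le (measurable_infDist (s := (V : Set F)))
    (measurable_infDist (s := (W : Set F))) hs (by positivity) (mul_pos ha hr)
    (by linarith : 1 ≤ 4 * C) hV_int hW_int (lt_of_lt_of_le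
      ((ENNReal.ofReal_lt_ofReal_iff (by positivity)).2 (by
        have : C⁻¹ * r ^ d = 4 * (r ^ d / (4 * C)) := by field_simp
        have : 0 < r ^ d / (4 * C) := by positivity
        linarith)) hlow)
  refine (angleLE_of_slabConst_lt_measure hW hC0.le (by positivity) hη1 hr (by positivity)
    (fun x hx => hup x hx.1) (fun x hx y hy => ?_) (fun x hx y hy => ?_) (fun x hx y hy => ?_)
    (t := t) (hG.trans_le' (ENNReal.ofReal_le_ofReal (le_of_eq ?_)))).mono (le_of_eq ?_)
  · linarith [norm_sub_le_norm_sub_add_norm_sub x x₀ y, mem_ball_iff_norm.1 (hSr hx.1),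
      mem_ball_iff_norm'.1 (hSr hy.1)]
  · linarith [norm_starProjection_orthogonal_direction_sub_le V x y, hx.2.1, hy.2.1]
  · linarith [norm_starProjection_orthogonal_direction_sub_le W x y, hx.2.2, hy.2.2]
  · rw [hη]
    field_simp
  · rw [hη, ht, angleConst]
    field_simp
    norm_num

end AffineSubspace

section Metric

variable {X : Type*} [MetricSpace X] {E Q Q' : Set X} {x y : X}

lemma generations_mono {i j : ℤ} (hi : i ∈ generations E) (hij : i ≤ j) : j ∈ generations E :=
  fun hb => (zpow_le_zpow_right₀ one_le_two (by lia)).trans (hi hb)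

lemma ofReal_zpow_le_ediam {j : ℤ} (hj : j ∈ generations E) :
    ENNReal.ofReal ((2 : ℝ) ^ (-j)) ≤ ediam E := by
  by_cases hb : Bornology.IsBounded E
  · exact ENNReal.ofReal_le_of_le_toReal (hj hb)
  · simp [ediam_of_unbounded hb]

lemma isBounded_of_two_mul_ediam_le {r : ℝ} (h : 2 * ediam E ≤ ENNReal.ofReal r) :
    Bornology.IsBounded E := by
  rw [isBounded_iff_ediam_ne_top]
  intro htop
  rw [htop, ENNReal.mul_top two_ne_zero] at h
  exact ENNReal.ofReal_ne_top (top_le_iff.1 h)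

/-- The generation `i` is the first admissible one among those at most `k` steps before `j`: either
it is exactly `k` steps before `j`, or it is the first generation of a bounded set. -/
structure IsBaseGeneration (E : Set X) (j : ℤ) (k : ℕ) (i : ℤ) : Prop where
  mem : i ∈ generations E
  sub_le : j - k ≤ i
  le : i ≤ j
  eq_or_notMem : i = j - k ∨ i - 1 ∉ generations E

lemma exists_isBaseGeneration {j : ℤ} (hj : j ∈ generations E) (k : ℕ) :
    ∃ i, IsBaseGeneration E j k i := by
  induction k with
  | zero => exact ⟨j, hj, by simp, le_rfl, .inl (by simp)⟩
  | succ k ih =>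
    obtain ⟨i, hi⟩ := ih
    have := hi.sub_le
    have := hi.le
    by_cases h : i - 1 ∈ generations E
    · have := hi.eq_or_notMem.resolve_right (not_not.2 h)
      exact ⟨i - 1, h, by lia, by lia, .inl (by lia)⟩
    · exact ⟨i, hi.mem, by lia, hi.le, .inr h⟩

lemma IsBaseGeneration.le_of_mem {i i' j : ℤ} {k : ℕ} (hi : IsBaseGeneration E j k i)
    (hi' : i' ∈ generations E) (hji' : j - k ≤ i') : i ≤ i' := by
  rcases hi.eq_or_notMem with rfl | h
  · exact hji'
  · by_contra! hlt
    exact h (generations_mono hi' (by lia))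

lemma subset_dilate (hQ : Q ⊆ E) : Q ⊆ dilate E 2 Q := fun x hx =>
  ⟨hQ hx, by linarith [infDist_zero_of_mem hx, diam_nonneg (s := Q)]⟩

lemma lt_dist_of_notMem_dilate (hx : x ∈ E) (hy : y ∈ Q) (h : x ∉ dilate E 2 Q) :
    diam Q < dist x y := by
  by_contra! hle
  exact h ⟨hx, by linarith [infDist_le_dist_of_mem (x := x) hy]⟩

lemma dist_le_of_mem_dilate_of_mem (hQ : Bornology.IsBounded Q) (hx : x ∈ dilate E 2 Q)
    (hy : y ∈ Q) : dist x y ≤ 2 * diam Q := by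
  refine le_of_forall_pos_lt_add fun ε hε => ?_
  obtain ⟨z, hz, hxz⟩ := (infDist_lt_iff ⟨y, hy⟩).1 (hx.2.trans_lt (lt_add_of_pos_right _ hε))
  linarith [dist_le_diam_of_mem hQ hz hy, dist_triangle x z y]

lemma dist_le_of_mem_dilate (hQ : Bornology.IsBounded Q) (hne : Q.Nonempty)
    (hx : x ∈ dilate E 2 Q) (hy : y ∈ dilate E 2 Q) : dist x y ≤ 3 * diam Q := by
  refine le_of_forall_pos_lt_add fun ε hε => ?_
  obtain ⟨z, hz, hxz⟩ := (infDist_lt_iff hne).1 (hx.2.trans_lt (lt_add_of_pos_right _ hε))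
  linarith [dist_le_of_mem_dilate_of_mem hQ hy hz, dist_triangle x z y, dist_comm y z]

lemma isBounded_dilate (hQ : Bornology.IsBounded Q) (hne : Q.Nonempty) :
    Bornology.IsBounded (dilate E 2 Q) :=
  isBounded_iff.2 ⟨_, fun _ hx _ hy => dist_le_of_mem_dilate hQ hne hx hy⟩

lemma diam_dilate_le (hQ : Bornology.IsBounded Q) (hne : Q.Nonempty) :
    diam (dilate E 2 Q) ≤ 3 * diam Q :=
  diam_le_of_forall_dist_le (mul_nonneg zero_le_three diam_nonneg)
    fun _ hx _ hy => dist_le_of_mem_dilate hQ hne hx hy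

lemma dilate_mono (hne : Q.Nonempty) (h : Q ⊆ Q') (hQ' : Bornology.IsBounded Q') :
    dilate E 2 Q ⊆ dilate E 2 Q' := fun x hx =>
  ⟨hx.1, (infDist_le_infDist_of_subset h hne).trans (by linarith [hx.2, diam_mono h hQ'])⟩

lemma measurableSet_dilate [MeasurableSpace X] [OpensMeasurableSpace X] (hE : MeasurableSet E) :
    MeasurableSet (dilate E 2 Q) :=
  hE.inter (isClosed_le (continuous_infDist_pt Q) continuous_const).measurableSet

end Metric

section Cubes

variable {X : Type*} [MetricSpace X] [MeasurableSpace X] {c₀ : ℝ} {E Q : Set X} {j : ℤ}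

/-- The properties of a single cube of generation `j` of a dyadic system on `E` with constant
`c₀`. -/
structure IsCube (c₀ : ℝ) (E : Set X) (j : ℤ) (Q : Set X) : Prop where
  const_pos : 0 < c₀
  const_le_one : c₀ ≤ 1
  mem_generations : j ∈ generations E
  measurableSet : MeasurableSet Q
  subset : Q ⊆ E
  ediam_le : ediam Q ≤ ENNReal.ofReal (c₀⁻¹ * (2 : ℝ) ^ (-j))
  center : ∃ x ∈ E, ball x (c₀ * (2 : ℝ) ^ (-j)) ∩ E ⊆ Q

namespace IsCube

lemma exists_ball_inter_subset (hQ : IsCube c₀ E j Q) :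
    ∃ x ∈ Q, ball x (c₀ * (2 : ℝ) ^ (-j)) ∩ E ⊆ Q := by
  have hc := hQ.const_pos
  obtain ⟨x, hx, h⟩ := hQ.center
  exact ⟨x, h ⟨mem_ball_self (by positivity), hx⟩, h⟩

lemma nonempty (hQ : IsCube c₀ E j Q) : Q.Nonempty :=
  let ⟨x, hx, _⟩ := hQ.exists_ball_inter_subset
  ⟨x, hx⟩

lemma isBounded (hQ : IsCube c₀ E j Q) : Bornology.IsBounded Q :=
  isBounded_iff_ediam_ne_top.2 (ne_top_of_le_ne_top ENNReal.ofReal_ne_top hQ.ediam_le)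

lemma diam_le (hQ : IsCube c₀ E j Q) : diam Q ≤ c₀⁻¹ * (2 : ℝ) ^ (-j) :=
  have := hQ.const_pos
  ENNReal.toReal_le_of_le_ofReal (by positivity) hQ.ediam_le

lemma diam_dilate_le (hQ : IsCube c₀ E j Q) :
    diam (dilate E 2 Q) ≤ 3 * c₀⁻¹ * (2 : ℝ) ^ (-j) := by
  linarith [GeometricLemma.diam_dilate_le (E := E) hQ.isBounded hQ.nonempty, hQ.diam_le]

lemma dilate_subset_ball (hQ : IsCube c₀ E j Q) {x : X} (hx : x ∈ dilate E 2 Q) :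
    dilate E 2 Q ⊆ ball x (4 * c₀⁻¹ * (2 : ℝ) ^ (-j)) := by
  intro y hy
  have hc := hQ.const_pos
  have hpos : 0 < c₀⁻¹ * (2 : ℝ) ^ (-j) := by positivity
  rw [mem_ball]
  linarith [dist_le_of_mem_dilate hQ.isBounded hQ.nonempty hy hx, hQ.diam_le]

end IsCube

namespace DyadicSystem

variable (Δ : DyadicSystem c₀ E)

/-- The cubes of generation `j`, of which there are none if `j` is not admissible. -/
def level (j : ℤ) : Set (Set X) := {Q | j ∈ generations E ∧ Q ∈ Δ.gen j}

lemma isCube (hc : 0 < c₀) (hc1 : c₀ ≤ 1) (hQ : Q ∈ Δ.level j) : IsCube c₀ E j Q :=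
  ⟨hc, hc1, hQ.1, Δ.measurable j hQ.1 Q hQ.2, Δ.subset j hQ.1 Q hQ.2, Δ.diam_le j hQ.1 Q hQ.2,
    Δ.center j hQ.1 Q hQ.2⟩

lemma measurableSet_of_mem_level (hQ : Q ∈ Δ.level j) : MeasurableSet Q :=
  Δ.measurable j hQ.1 Q hQ.2

lemma subset_of_mem_level (hQ : Q ∈ Δ.level j) : Q ⊆ E := Δ.subset j hQ.1 Q hQ.2

lemma exists_mem_level (hj : j ∈ generations E) {x : X} (hx : x ∈ E) :
    ∃ Q ∈ Δ.level j, x ∈ Q := by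
  rw [Δ.cover j hj] at hx
  obtain ⟨Q, hQ, hxQ⟩ := Set.mem_iUnion₂.1 hx
  exact ⟨Q, ⟨hj, hQ⟩, hxQ⟩

lemma pairwiseDisjoint_level (j : ℤ) : (Δ.level j).PairwiseDisjoint id :=
  fun Q hQ Q' hQ' h => Δ.pairwise_disjoint j hQ.1 Q hQ.2 Q' hQ'.2 h

lemma eq_of_mem_level {Q' : Set X} (hQ : Q ∈ Δ.level j) (hQ' : Q' ∈ Δ.level j) {x : X}
    (hx : x ∈ Q) (hx' : x ∈ Q') : Q = Q' :=
  (Δ.pairwiseDisjoint_level j).elim_set hQ hQ' x hx hx'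

lemma subset_of_mem_of_mem {i : ℤ} (hij : i ≤ j) {Q' : Set X} (hQ : Q ∈ Δ.level i)
    (hQ' : Q' ∈ Δ.level j) {x : X} (hx : x ∈ Q) (hx' : x ∈ Q') : Q' ⊆ Q :=
  (Δ.nested i hQ.1 j hQ'.1 hij Q hQ.2 Q' hQ'.2).resolve_right
    fun h => Set.disjoint_left.1 h hx hx'

lemma countable_level [SecondCountableTopology X] (hc : 0 < c₀) (j : ℤ) :
    (Δ.level j).Countable := by
  refine Set.PairwiseDisjoint.countable_of_nonempty_interior (α := E)
    (s := fun Q => Subtype.val ⁻¹' Q) (fun Q hQ Q' hQ' h =>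
      (Δ.pairwiseDisjoint_level j hQ hQ' h).preimage _) fun Q hQ => ?_
  obtain ⟨x, hxE, hx⟩ := Δ.center j hQ.1 Q hQ.2
  exact ⟨⟨x, hxE⟩, mem_interior_iff_mem_nhds.2 (Filter.mem_of_superset
    (ball_mem_nhds _ (by positivity : 0 < c₀ * (2 : ℝ) ^ (-j))) fun y hy => hx ⟨hy, y.2⟩)⟩

/-- The system obtained from `Δ` by merging the cubes of the first generation of a bounded set `E`
into the single cube `E`. -/
def mergeTop (hc : 0 < c₀) (hc2 : c₀ ≤ 1 / 2) (hE : MeasurableSet E) (hne : E.Nonempty) :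
    DyadicSystem c₀ E where
  gen j := {Q | (j - 1 ∈ generations E ∧ Q ∈ Δ.gen j) ∨ (j - 1 ∉ generations E ∧ Q = E)}
  measurable j hj Q hQ := by
    rcases hQ with ⟨-, hQ⟩ | ⟨-, rfl⟩
    exacts [Δ.measurable j hj Q hQ, hE]
  subset j hj Q hQ := by
    rcases hQ with ⟨-, hQ⟩ | ⟨-, rfl⟩
    exacts [Δ.subset j hj Q hQ, subset_rfl]
  pairwise_disjoint j hj Q hQ Q' hQ' h := by
    rcases hQ with ⟨hj', hQ⟩ | ⟨hj', rfl⟩ <;> rcases hQ' with ⟨hj'', hQ'⟩ | ⟨hj'', rfl⟩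
    exacts [Δ.pairwise_disjoint j hj Q hQ Q' hQ' h, absurd hj' hj'', absurd hj'' hj', absurd rfl h]
  cover j hj := by
    by_cases h : j - 1 ∈ generations E
    · simpa [h] using Δ.cover j hj
    · simp [h]
  nested i hi j hj hij Q hQ Q' hQ' := by
    rcases hQ with ⟨hi', hQ⟩ | ⟨-, rfl⟩ <;> rcases hQ' with ⟨-, hQ'⟩ | ⟨hj', rfl⟩
    exacts [Δ.nested i hi j hj hij Q hQ Q' hQ', absurd (generations_mono hi' (by lia)) hj',
      .inl (Δ.subset j hj Q' hQ'), .inl subset_rfl]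
  ancestor j hj Q' hQ' i hi hij := by
    have hQ'' : Q' ∈ Δ.gen j :=
      (hQ'.resolve_right fun h => h.1 (generations_mono hi (by lia))).2
    by_cases h : i - 1 ∈ generations E
    · simpa [h] using Δ.ancestor j hj Q' hQ'' i hi hij
    · exact ⟨E, ⟨.inr ⟨h, rfl⟩, Δ.subset j hj Q' hQ''⟩,
        fun Q hQ => (hQ.1.resolve_left fun h' => h h'.1).2⟩
  diam_le j hj Q hQ := by
    rcases hQ with ⟨-, hQ⟩ | ⟨hj', rfl⟩
    · exact Δ.diam_le j hj Q hQ
    · simp only [generations, Set.mem_ofPred_eq, Classical.not_imp, not_le] at hj'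
      rw [← ENNReal.ofReal_toReal hj'.1.ediam_ne_top]
      refine ENNReal.ofReal_le_ofReal (hj'.2.le.trans ?_)
      rw [show -(j - 1) = 1 + -j by ring, zpow_add₀ two_ne_zero, zpow_one]
      have : 2 ≤ c₀⁻¹ := by
        rw [le_inv_comm₀ two_pos hc]
        linarith
      gcongr
  center j hj Q hQ := by
    rcases hQ with ⟨-, hQ⟩ | ⟨-, rfl⟩
    · exact Δ.center j hj Q hQ
    · exact ⟨hne.some, hne.some_mem, Set.inter_subset_right⟩

/-- The first generation of a bounded set consists of the set alone. -/
def HasTop : Prop := ∀ j ∈ generations E, j - 1 ∉ generations E → Δ.gen j = {E}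

lemma hasTop_mergeTop (hc : 0 < c₀) (hc2 : c₀ ≤ 1 / 2) (hE : MeasurableSet E)
    (hne : E.Nonempty) : (Δ.mergeTop hc hc2 hE hne).HasTop := by
  intro j _ hj
  ext Q
  simp [mergeTop, hj]

end DyadicSystem

end Cubes

section Regular

variable {X : Type*} [MetricSpace X] [MeasurableSpace X] [BorelSpace X] {d : ℕ} {C c₀ : ℝ}
  {E Q : Set X} {j : ℤ}

namespace IsRegular

lemma nonempty {s : ℝ} (hE : IsRegular s C E) : E.Nonempty :=
  (ediam_pos_iff.1 hE.diam_pos).nonempty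

lemma dim_ne_zero (hE : IsRegular (d : ℝ) C E) : d ≠ 0 := by exact_mod_cast hE.s_pos.ne'

lemma const_pos {s : ℝ} (hE : IsRegular s C E) : 0 < C := one_pos.trans_le hE.one_le

/- A ball of radius at least `2 * diam E` around a point of `E` meets `E` in the same set as the one
of radius `3 / 2 * diam E`. -/
lemma surfaceMeasure_ball_le (hE : IsRegular (d : ℝ) C E) {x : X} (hx : x ∈ E) {r : ℝ}
    (hr : 0 < r) : surfaceMeasure d E (ball x r) ≤ ENNReal.ofReal (C * r ^ d) := by
  have hC := hE.const_pos
  rw [surfaceMeasure, Measure.restrict_apply measurableSet_ball]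
  rcases lt_or_ge (ENNReal.ofReal r) (2 * ediam E) with h | h
  · simpa using hE.upper x hx r hr h
  have hb := isBounded_of_two_mul_ediam_le h
  have hdiam : ediam E = ENNReal.ofReal (diam E) := (ENNReal.ofReal_toReal hb.ediam_ne_top).symm
  have hdiam_pos : 0 < diam E := ENNReal.ofReal_pos.1 (hdiam ▸ hE.diam_pos)
  rw [hdiam, ← ENNReal.ofReal_ofNat 2, ← ENNReal.ofReal_mul zero_le_two,
    ENNReal.ofReal_le_ofReal_iff hr.le] at h
  have hsmall : ENNReal.ofReal (3 / 2 * diam E) < 2 * ediam E := by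
    rw [hdiam, ← ENNReal.ofReal_ofNat 2, ← ENNReal.ofReal_mul zero_le_two,
      ENNReal.ofReal_lt_ofReal_iff (by positivity)]
    linarith
  calc μH[(d : ℝ)] (ball x r ∩ E) ≤ μH[(d : ℝ)] (ball x (3 / 2 * diam E) ∩ E) :=
        measure_mono fun y hy => ⟨mem_ball.2 (by linarith [dist_le_diam_of_mem hb hy.2 hx]), hy.2⟩
    _ ≤ ENNReal.ofReal (C * (3 / 2 * diam E) ^ (d : ℝ)) := hE.upper x hx _ (by positivity) hsmall
    _ ≤ ENNReal.ofReal (C * r ^ d) := by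
        rw [Real.rpow_natCast]
        gcongr
        linarith

lemma le_surfaceMeasure_ball (hE : IsRegular (d : ℝ) C E) {x : X} (hx : x ∈ E)
    (hj : j ∈ generations E) {r : ℝ} (hr : 0 < r) (hrj : r ≤ (2 : ℝ) ^ (-j)) :
    ENNReal.ofReal (C⁻¹ * r ^ d) ≤ surfaceMeasure d E (ball x r) := by
  have hlt : ENNReal.ofReal r < 2 * ediam E := by
    have hle := (ENNReal.ofReal_le_ofReal hrj).trans (ofReal_zpow_le_ediam hj)
    rcases eq_or_ne (ediam E) ⊤ with h | h
    · simp [h]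
    · rw [two_mul]
      exact hle.trans_lt (ENNReal.lt_add_right h hE.diam_pos.ne')
  rw [surfaceMeasure, Measure.restrict_apply measurableSet_ball]
  simpa using hE.lower x hx r hr hlt

lemma sigmaFinite_surfaceMeasure (hE : IsRegular (d : ℝ) C E) :
    SigmaFinite (surfaceMeasure d E) := by
  obtain ⟨x, hx⟩ := hE.nonempty
  exact ⟨⟨⟨fun n => ball x (n + 1), fun _ => trivial, fun n =>
    (hE.surfaceMeasure_ball_le hx (by positivity)).trans_lt ENNReal.ofReal_lt_top,
    iUnion_ball_nat_succ x⟩⟩⟩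

end IsRegular

namespace IsCube

lemma le_measure (hE : IsRegular (d : ℝ) C E) (hQ : IsCube c₀ E j Q) :
    ENNReal.ofReal (C⁻¹ * (c₀ * (2 : ℝ) ^ (-j)) ^ d) ≤ surfaceMeasure d E Q := by
  have hc := hQ.const_pos
  obtain ⟨x, hx, h⟩ := hQ.exists_ball_inter_subset
  refine (hE.le_surfaceMeasure_ball (hQ.subset hx) hQ.mem_generations (by positivity)
    (mul_le_of_le_one_left (by positivity) hQ.const_le_one)).trans ?_
  rw [surfaceMeasure, Measure.restrict_apply measurableSet_ball,
    Measure.restrict_apply hQ.measurableSet]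
  exact measure_mono fun y hy => ⟨h hy, hy.2⟩

/- A set of small diameter lies in a small ball, whose measure is too small for a cube. -/
lemma le_diam (hE : IsRegular (d : ℝ) C E) (hQ : IsCube c₀ E j Q) :
    C⁻¹ ^ 2 * c₀ * (2 : ℝ) ^ (-j) ≤ diam Q := by
  have hc := hQ.const_pos
  have hC := hE.const_pos
  set ℓ := c₀ * (2 : ℝ) ^ (-j) with hℓ
  refine le_of_forall_gt_imp_ge_of_dense fun r hr => ?_
  have hr0 : 0 < r := diam_nonneg.trans_lt hr
  obtain ⟨x, hx⟩ := hQ.nonempty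
  have hle : C⁻¹ * ℓ ^ d ≤ C * r ^ d :=
    (ENNReal.ofReal_le_ofReal_iff (by positivity)).1 ((hQ.le_measure hE).trans
      ((measure_mono fun y hy => mem_ball.2
        ((dist_le_diam_of_mem hQ.isBounded hy hx).trans_lt hr)).trans
          (hE.surfaceMeasure_ball_le (hQ.subset hx) hr0)))
  rw [mul_assoc, ← hℓ]
  refine le_of_pow_le_pow_left₀ hE.dim_ne_zero hr0.le ?_
  calc (C⁻¹ ^ 2 * ℓ) ^ d = (C⁻¹ ^ 2) ^ d * ℓ ^ d := mul_pow _ _ _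
    _ ≤ C⁻¹ ^ 2 * ℓ ^ d := by
        gcongr
        exact pow_le_of_le_one (by positivity)
          (pow_le_one₀ (by positivity) (inv_le_one_of_one_le₀ hE.one_le)) hE.dim_ne_zero
    _ = C⁻¹ * (C⁻¹ * ℓ ^ d) := by ring
    _ ≤ C⁻¹ * (C * r ^ d) := by gcongr
    _ = r ^ d := by field_simp

lemma le_diam_dilate (hE : IsRegular (d : ℝ) C E) (hQ : IsCube c₀ E j Q) :
    C⁻¹ ^ 2 * c₀ * (2 : ℝ) ^ (-j) ≤ diam (dilate E 2 Q) :=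
  (hQ.le_diam hE).trans
    (diam_mono (subset_dilate hQ.subset) (isBounded_dilate hQ.isBounded hQ.nonempty))

lemma diam_dilate_pos (hE : IsRegular (d : ℝ) C E) (hQ : IsCube c₀ E j Q) :
    0 < diam (dilate E 2 Q) :=
  have hc := hQ.const_pos
  have hC := hE.const_pos
  lt_of_lt_of_le (by positivity) (hQ.le_diam_dilate hE)

lemma measure_dilate_le (hE : IsRegular (d : ℝ) C E) (hQ : IsCube c₀ E j Q) :
    surfaceMeasure d E (dilate E 2 Q) ≤ ENNReal.ofReal (C * (4 * c₀⁻¹ * (2 : ℝ) ^ (-j)) ^ d) := by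
  have hc := hQ.const_pos
  obtain ⟨x, hx⟩ := hQ.nonempty
  have hx' := subset_dilate hQ.subset hx
  exact (measure_mono (hQ.dilate_subset_ball hx')).trans
    (hE.surfaceMeasure_ball_le hx'.1 (by positivity))

lemma measure_dilate_ne_top (hE : IsRegular (d : ℝ) C E) (hQ : IsCube c₀ E j Q) :
    surfaceMeasure d E (dilate E 2 Q) ≠ ⊤ :=
  ne_top_of_le_ne_top ENNReal.ofReal_ne_top (hQ.measure_dilate_le hE)

lemma measure_pos (hE : IsRegular (d : ℝ) C E) (hQ : IsCube c₀ E j Q) :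
    0 < surfaceMeasure d E Q :=
  have hc := hQ.const_pos
  have hC := hE.const_pos
  (ENNReal.ofReal_pos.2 (by positivity)).trans_le (hQ.le_measure hE)

lemma measure_dilate_pos (hE : IsRegular (d : ℝ) C E) (hQ : IsCube c₀ E j Q) :
    0 < surfaceMeasure d E (dilate E 2 Q) :=
  (hQ.measure_pos hE).trans_le (measure_mono (subset_dilate hQ.subset))

end IsCube

end Regular

section Inequalities

lemma rpow_le_mul_two_rpow {s x : ℝ} (hs : 0 < s) (hx : 0 ≤ x) :
    x ^ s ≤ (s / Real.log 2) ^ s * 2 ^ x := by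
  have := Real.log_pos one_lt_two
  have hexp : Real.log 2 * x / s ≤ Real.exp (Real.log 2 * x / s) := by
    linarith [Real.add_one_le_exp (Real.log 2 * x / s)]
  calc x ^ s = (s / Real.log 2 * (Real.log 2 * x / s)) ^ s := by congr 1; field_simp
    _ ≤ (s / Real.log 2 * Real.exp (Real.log 2 * x / s)) ^ s := by gcongr
    _ = (s / Real.log 2) ^ s * 2 ^ x := by
        rw [Real.mul_rpow (by positivity) (Real.exp_pos _).le, ← Real.exp_mul,
          div_mul_cancel₀ _ hs.ne', Real.rpow_def_of_pos two_pos]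

/-- The constant in `add_sum_rpow_le`. -/
def powerSumConst (s : ℝ) : ℝ := 4 * (s / Real.log 2) ^ s

lemma powerSumConst_pos {s : ℝ} (hs : 0 < s) : 0 < powerSumConst s := by
  have := Real.log_pos one_lt_two
  unfold powerSumConst
  positivity

lemma add_sum_rpow_le {s : ℝ} (hs : 1 ≤ s) (N : ℕ) {a : ℝ} {b : ℕ → ℝ} (ha : 0 ≤ a)
    (hb : ∀ i, 0 ≤ b i) :
    (a + ∑ i ∈ Finset.range (N + 1), b i) ^ s ≤
      powerSumConst s * 2 ^ N * (a ^ s + ∑ i ∈ Finset.range (N + 1), b i ^ s) := by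
  have hs0 : 0 < s := one_pos.trans_le hs
  have hjensen := Real.rpow_sum_le_const_mul_sum_rpow_of_nonneg (Finset.range (N + 2)) hs
    (f := fun i => Nat.casesOn i a b) fun i _ => by cases i <;> simp [ha, hb]
  simp only [Finset.card_range, Finset.sum_range_succ' _ (N + 1)] at hjensen
  rw [add_comm a, add_comm (a ^ s)]
  refine hjensen.trans (mul_le_mul_of_nonneg_right ?_
    (add_nonneg (Finset.sum_nonneg fun i _ => Real.rpow_nonneg (hb i) s) (Real.rpow_nonneg ha s)))
  calc ((N + 2 : ℕ) : ℝ) ^ (s - 1) ≤ ((N + 2 : ℕ) : ℝ) ^ s :=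
        Real.rpow_le_rpow_of_exponent_le (by norm_cast; lia) (by linarith)
    _ ≤ (s / Real.log 2) ^ s * 2 ^ ((N + 2 : ℕ) : ℝ) := rpow_le_mul_two_rpow hs0 (by positivity)
    _ = powerSumConst s * 2 ^ N := by
        rw [Real.rpow_natCast, powerSumConst]
        ring

lemma add_add_rpow_le {p a b c : ℝ} (hp : 1 ≤ p) (ha : 0 ≤ a) (hb : 0 ≤ b) (hc : 0 ≤ c) :
    (a + b + c) ^ p ≤ 3 ^ p * (a ^ p + b ^ p + c ^ p) := by
  have h := Real.rpow_sum_le_const_mul_sum_rpow_of_nonneg Finset.univ hp (f := ![a, b, c])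
    (by simp [Fin.forall_fin_succ, ha, hb, hc])
  simp only [Finset.card_univ, Fintype.card_fin, Fin.sum_univ_three, Matrix.cons_val] at h
  refine h.trans ?_
  gcongr ?_ * _
  exact Real.rpow_le_rpow_of_exponent_le (by norm_num) (by linarith)

lemma tsum_ite_le_inv_two_pow (i : ℕ) :
    ∑' N : ℕ, (if i ≤ N then (2⁻¹ : ℝ≥0∞) ^ N else 0) = 2 * 2⁻¹ ^ i := by
  rw [← Summable.sum_add_tsum_nat_add' (k := i) ENNReal.summable, Finset.sum_eq_zero, zero_add]
  · simp only [Nat.le_add_left, if_true, pow_add]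
    rw [ENNReal.tsum_mul_right, ENNReal.tsum_geometric_two]
  · exact fun N hN => if_neg (by simpa using hN)

lemma tsum_inv_two_pow_mul_sum_range (f : ℕ → ℝ≥0∞) :
    ∑' N : ℕ, (2⁻¹ : ℝ≥0∞) ^ N * ∑ i ∈ Finset.range (N + 1), f i = 2 * ∑' i : ℕ, 2⁻¹ ^ i * f i := by
  have hsum (N : ℕ) : (2⁻¹ : ℝ≥0∞) ^ N * ∑ i ∈ Finset.range (N + 1), f i =
      ∑' i : ℕ, (if i ≤ N then (2⁻¹ : ℝ≥0∞) ^ N else 0) * f i := by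
    rw [tsum_eq_sum (s := Finset.range (N + 1)), Finset.mul_sum]
    · exact Finset.sum_congr rfl fun i hi => by
        rw [if_pos (Finset.mem_range_succ_iff.1 hi)]
    · intro i hi
      rw [if_neg (fun h => hi (Finset.mem_range_succ_iff.2 h)), zero_mul]
  simp_rw [hsum]
  rw [ENNReal.tsum_comm, ← ENNReal.tsum_mul_left]
  exact tsum_congr fun i => by rw [ENNReal.tsum_mul_right, tsum_ite_le_inv_two_pow, mul_assoc]

/- Jensen's inequality for the measure with mass `w i` at `i`. -/
lemma tsum_mul_rpow_le {ι : Type*} (w f : ι → ℝ≥0∞) {r : ℝ} (hr : 1 ≤ r) :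
    (∑' i, w i * f i) ^ r ≤ (∑' i, w i) ^ (r - 1) * ∑' i, w i * f i ^ r := by
  let _ : MeasurableSpace ι := ⊤
  let ν : Measure ι := Measure.sum fun i => w i • Measure.dirac i
  have hν (g : ι → ℝ≥0∞) : ∫⁻ i, g i ∂ν = ∑' i, w i * g i := by
    simp [ν, lintegral_sum_measure]
  have hν_univ : ν Set.univ = ∑' i, w i := by
    rw [← lintegral_one, hν]
    simp
  have hr0 : 0 < r := one_pos.trans_le hr
  have h := ENNReal.rpow_le_rpow (eLpNorm'_le_eLpNorm'_mul_rpow_measure_univ (μ := ν) one_pos hr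
    (f := f) (Measurable.of_discrete).aestronglyMeasurable) hr0.le
  simp only [eLpNorm', enorm_eq_self, ENNReal.rpow_one, one_div, inv_one, hν] at h
  rwa [ENNReal.mul_rpow_of_nonneg _ _ hr0.le, ← ENNReal.rpow_mul, ← ENNReal.rpow_mul,
    inv_mul_cancel₀ hr0.ne', ENNReal.rpow_one, hν_univ, sub_mul, one_mul,
    inv_mul_cancel₀ hr0.ne', mul_comm] at h

variable {X : Type*} [MeasurableSpace X] {μ : Measure X}

lemma ofReal_integral_le_lintegral {f : X → ℝ} (hf : ∀ x, 0 ≤ f x) :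
    ENNReal.ofReal (∫ x, f x ∂μ) ≤ ∫⁻ x, ENNReal.ofReal (f x) ∂μ := by
  calc ENNReal.ofReal (∫ x, f x ∂μ) ≤ ‖∫ x, f x ∂μ‖ₑ := Real.ofReal_le_enorm _
    _ ≤ ∫⁻ x, ‖f x‖ₑ ∂μ := enorm_integral_le_lintegral_enorm f
    _ = ∫⁻ x, ENNReal.ofReal (f x) ∂μ := by simp_rw [fun x => Real.enorm_of_nonneg (hf x)]

lemma setLIntegral_prod_add [SFinite μ] (S T : Set X) {f g : X → ℝ≥0∞} (hf : Measurable f)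
    (hg : Measurable g) :
    ∫⁻ z in S ×ˢ T, (f z.1 + g z.2) ∂μ.prod μ =
      μ T * ∫⁻ x in S, f x ∂μ + μ S * ∫⁻ y in T, g y ∂μ := by
  rw [← Measure.prod_restrict, lintegral_add_left (by fun_prop),
    lintegral_prod _ (by fun_prop), lintegral_prod _ (by fun_prop)]
  simp [lintegral_mul_const, hf, mul_comm]

variable {F : Type*} [NormedAddCommGroup F] [InnerProductSpace ℝ F] [FiniteDimensional ℝ F]

/- The error `|‖u‖ - ‖π u‖|` is quadratic in `‖u - π u‖`: this turns exponent `p` for distances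
into exponent `2 * p` for flatness. -/
lemma abs_norm_sub_norm_starProjection_rpow_le {p κ A L : ℝ} (hp : 1 ≤ p) (hκ : 0 ≤ κ)
    {U : Submodule ℝ F} {V : AffineSubspace ℝ F} [Nonempty V] (hUV : AngleLE U V.direction A)
    (hA : 0 ≤ A) (hL : 0 < L) {x y : F} (hLκ : L ≤ κ * ‖x - y‖) (hκL : ‖x - y‖ ≤ κ * L) :
    |‖x - y‖ - ‖U.starProjection (x - y)‖| ^ p ≤
      (9 * κ) ^ p * ((L ^ p)⁻¹ * (infDist x V ^ (2 * p) + infDist y V ^ (2 * p)) +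
        L ^ p * A ^ (2 * p)) := by
  set f := |‖x - y‖ - ‖U.starProjection (x - y)‖|
  set a := infDist x (V : Set F)
  set b := infDist y (V : Set F)
  set D := ‖x - y‖
  have ha : 0 ≤ a := infDist_nonneg
  have hb : 0 ≤ b := infDist_nonneg
  have hD : 0 < D := (pos_iff_pos_of_mul_pos (hL.trans_le hLκ)).1
    (hκ.lt_of_ne fun h => by simp [← h, hL.not_ge] at hLκ)
  have hsq : f * D ≤ 3 * (a ^ 2 + b ^ 2 + (A * D) ^ 2) := by
    have hperp : ‖Uᗮ.starProjection (x - y)‖ ≤ a + b + A * D :=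
      (hUV (x - y)).trans (by gcongr; exact norm_starProjection_orthogonal_direction_sub_le V x y)
    calc f * D ≤ ‖Uᗮ.starProjection (x - y)‖ ^ 2 :=
          abs_norm_sub_norm_starProjection_mul_norm_le U (x - y)
      _ ≤ (a + b + A * D) ^ 2 := by gcongr
      _ ≤ 3 * (a ^ 2 + b ^ 2 + (A * D) ^ 2) := by
          nlinarith [sq_nonneg (a - b), sq_nonneg (a - A * D), sq_nonneg (b - A * D)]
  have hf : f ≤ 3 * κ * (a ^ 2 / L + b ^ 2 / L + A ^ 2 * L) := by
    have hdiv : (a ^ 2 + b ^ 2) / D ≤ κ * ((a ^ 2 + b ^ 2) / L) := by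
      rw [div_le_iff₀ hD, mul_right_comm, mul_div_assoc', le_div_iff₀ hL, mul_comm]
      gcongr
    calc f ≤ 3 * ((a ^ 2 + b ^ 2) / D + A ^ 2 * D) := by
          rw [← mul_le_mul_iff_left₀ hD]
          exact hsq.trans_eq (by field_simp)
      _ ≤ 3 * (κ * ((a ^ 2 + b ^ 2) / L) + A ^ 2 * (κ * L)) := by gcongr
      _ = 3 * κ * (a ^ 2 / L + b ^ 2 / L + A ^ 2 * L) := by ring
  have hsq_rpow {t : ℝ} (ht : 0 ≤ t) : (t ^ 2) ^ p = t ^ (2 * p) := by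
    rw [Real.rpow_mul ht, Real.rpow_two]
  calc f ^ p ≤ (3 * κ * (a ^ 2 / L + b ^ 2 / L + A ^ 2 * L)) ^ p := by gcongr
    _ ≤ (3 * κ) ^ p * (3 ^ p * ((a ^ 2 / L) ^ p + (b ^ 2 / L) ^ p + (A ^ 2 * L) ^ p)) := by
        rw [Real.mul_rpow (by positivity) (by positivity)]
        gcongr
        exact add_add_rpow_le hp (by positivity) (by positivity) (by positivity)
    _ = (9 * κ) ^ p * ((L ^ p)⁻¹ * (a ^ (2 * p) + b ^ (2 * p)) + L ^ p * A ^ (2 * p)) := by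
        rw [show 9 * κ = 3 * κ * 3 by ring, Real.mul_rpow (by positivity) zero_le_three,
          Real.div_rpow (by positivity) hL.le, Real.div_rpow (by positivity) hL.le,
          Real.mul_rpow (by positivity) hL.le, hsq_rpow ha, hsq_rpow hb, hsq_rpow hA]
        ring

end Inequalities

section Beta

section Metric

variable {X : Type*} [MetricSpace X] [MeasurableSpace X] {μ : Measure X} {s b : ℝ} {V S : Set X}

lemma betaSingle_nonneg : 0 ≤ betaSingle μ s V S :=
  Real.rpow_nonneg (mul_nonneg (one_div_nonneg.2 measureReal_nonneg) (integral_nonneg fun _ =>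
    Real.rpow_nonneg (div_nonneg infDist_nonneg diam_nonneg) _)) _

lemma integrableOn_infDist_div_diam_rpow [BorelSpace X] (hs : 0 ≤ s) (hS : MeasurableSet S)
    (hb : Bornology.IsBounded S) (hfin : μ S ≠ ⊤) :
    IntegrableOn (fun x => (infDist x V / diam S) ^ s) S μ := by
  rcases S.eq_empty_or_nonempty with rfl | ⟨x₀, hx₀⟩
  · exact integrableOn_empty
  have hmeas : Measurable fun x => (infDist x V / diam S) ^ s :=
    (measurable_infDist.div_const _).pow_const _
  refine Measure.integrableOn_of_bounded (M := ((infDist x₀ V + diam S) / diam S) ^ s) hfin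
    hmeas.aestronglyMeasurable ?_
  filter_upwards [ae_restrict_mem hS] with x hx
  have hnonneg : 0 ≤ infDist x V / diam S := div_nonneg infDist_nonneg diam_nonneg
  rw [Real.norm_of_nonneg (Real.rpow_nonneg hnonneg _)]
  have hx_le : infDist x V ≤ infDist x₀ V + diam S :=
    infDist_le_infDist_add_dist.trans (by gcongr; exact dist_le_diam_of_mem hb hx hx₀)
  gcongr

lemma lintegral_infDist_rpow_le_of_betaSingle_le [BorelSpace X] (hs : 0 < s)
    (hS : MeasurableSet S) (hb : Bornology.IsBounded S) (hfin : μ S ≠ ⊤) (hpos : μ S ≠ 0)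
    (hdiam : 0 < diam S) (hV : betaSingle μ s V S ≤ b) :
    ∫⁻ x in S, ENNReal.ofReal (infDist x V ^ s) ∂μ ≤
      ENNReal.ofReal (μ.real S * (b * diam S) ^ s) := by
  have hm : 0 < μ.real S := ENNReal.toReal_pos hpos hfin
  have hratio (x : X) : 0 ≤ infDist x V / diam S := div_nonneg infDist_nonneg hdiam.le
  set I := ∫ x in S, (infDist x V / diam S) ^ s ∂μ with hI
  have hI0 : 0 ≤ I := integral_nonneg fun x => Real.rpow_nonneg (hratio x) _
  have hI_le : I ≤ μ.real S * b ^ s := by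
    have h := Real.rpow_le_rpow betaSingle_nonneg hV hs.le
    rwa [betaSingle, ← hI, ← Real.rpow_mul (by positivity), one_div_mul_cancel hs.ne',
      Real.rpow_one, one_div, inv_mul_le_iff₀ hm] at h
  have hscale (x : X) : ENNReal.ofReal (infDist x V ^ s) =
      ENNReal.ofReal (diam S ^ s) * ENNReal.ofReal ((infDist x V / diam S) ^ s) := by
    rw [← ENNReal.ofReal_mul (by positivity), ← Real.mul_rpow hdiam.le (hratio x),
      mul_div_cancel₀ _ hdiam.ne']
  simp_rw [hscale]
  rw [lintegral_const_mul _ (by fun_prop), ← ofReal_integral_eq_lintegral_ofReal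
    (integrableOn_infDist_div_diam_rpow hs.le hS hb hfin)
    (.of_forall fun x => Real.rpow_nonneg (hratio x) _), ← ENNReal.ofReal_mul (by positivity)]
  refine ENNReal.ofReal_le_ofReal ?_
  rw [Real.mul_rpow (betaSingle_nonneg.trans hV) hdiam.le, mul_left_comm]
  rw [mul_comm]
  exact (mul_le_mul_of_nonneg_right hI_le (by positivity)).trans_eq (by ring)

end Metric

variable {F : Type*} [NormedAddCommGroup F] [InnerProductSpace ℝ F] [FiniteDimensional ℝ F]
  [MeasurableSpace F] [BorelSpace F] {d : ℕ} {C c₀ s : ℝ} {E : Set F}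

/-- The constant in the bound for the integral of `infDist x V ^ s` over the dilate of a cube, in
terms of the flatness of the dilate and the generation of the cube. -/
def momentConst (d : ℕ) (C c₀ s : ℝ) : ℝ := C * (4 * c₀⁻¹) ^ d * (3 * c₀⁻¹) ^ s

lemma momentConst_pos (hC : 0 < C) (hc : 0 < c₀) : 0 < momentConst d C c₀ s := by
  rw [momentConst]
  positivity

lemma IsCube.lintegral_infDist_le {X : Type*} [MetricSpace X] [MeasurableSpace X] [BorelSpace X]
    {E Q V : Set X} {b : ℝ} {j : ℤ} (hQ : IsCube c₀ E j Q) (hE : IsRegular (d : ℝ) C E)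
    (hs : 0 < s) (hV : betaSingle (surfaceMeasure d E) s V (dilate E 2 Q) ≤ b) :
    ∫⁻ x in dilate E 2 Q, ENNReal.ofReal (infDist x V ^ s) ∂(surfaceMeasure d E) ≤
      ENNReal.ofReal (momentConst d C c₀ s * ((2 : ℝ) ^ (-j)) ^ d * (b * (2 : ℝ) ^ (-j)) ^ s) := by
  have hC := hE.const_pos
  have hc := hQ.const_pos
  have hb : 0 ≤ b := betaSingle_nonneg.trans hV
  have hμ : (surfaceMeasure (d : ℝ) E).real (dilate E 2 Q) ≤ C * (4 * c₀⁻¹ * (2 : ℝ) ^ (-j)) ^ d :=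
    ENNReal.toReal_le_of_le_ofReal (by positivity) (hQ.measure_dilate_le hE)
  refine (lintegral_infDist_rpow_le_of_betaSingle_le hs
    (measurableSet_dilate hE.isClosed.measurableSet) (isBounded_dilate hQ.isBounded hQ.nonempty)
    (hQ.measure_dilate_ne_top hE) (hQ.measure_dilate_pos hE).ne' (hQ.diam_dilate_pos hE)
    hV).trans (ENNReal.ofReal_le_ofReal ?_)
  calc _ ≤ C * (4 * c₀⁻¹ * (2 : ℝ) ^ (-j)) ^ d * (b * (3 * c₀⁻¹ * (2 : ℝ) ^ (-j))) ^ s := by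
        gcongr
        exact hQ.diam_dilate_le
    _ = _ := by
        rw [momentConst, mul_left_comm b, Real.mul_rpow (by positivity) (by positivity), mul_pow]
        ring

/-- The factor by which the flatness of a cube may deteriorate on the dilate of a descendant at most
`k` generations below. -/
def descentConst (d : ℕ) (C c₀ s : ℝ) (k : ℕ) : ℝ :=
  1 + momentConst d C c₀ s * (2 ^ k * c₀⁻¹) ^ d * (2 ^ k * c₀⁻¹) ^ s

lemma one_le_descentConst (hC : 0 < C) (hc : 0 < c₀) (k : ℕ) : 1 ≤ descentConst d C c₀ s k := by
  have hm : 0 < momentConst d C c₀ s := momentConst_pos hC hc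
  exact le_add_of_nonneg_right (by positivity)

lemma IsCube.lintegral_infDist_le_of_dilate_subset {X : Type*} [MetricSpace X] [MeasurableSpace X]
    [BorelSpace X] {E Q T V : Set X} {b a : ℝ} {i j : ℤ} {k : ℕ} (hT : IsCube c₀ E i T)
    (hE : IsRegular (d : ℝ) C E) (hs : 1 ≤ s) (hij : j - k ≤ i) (hQT : dilate E 2 Q ⊆ dilate E 2 T)
    (hV : betaSingle (surfaceMeasure d E) s V (dilate E 2 T) ≤ b) (hba : b ≤ a) :
    ∫⁻ x in dilate E 2 Q, ENNReal.ofReal (infDist x V ^ s) ∂(surfaceMeasure d E) ≤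
      ENNReal.ofReal ((c₀ * (2 : ℝ) ^ (-j)) ^ d *
        (descentConst d C c₀ s k * a * (c₀ * (2 : ℝ) ^ (-j))) ^ s) := by
  have hc := hT.const_pos
  have hb : 0 ≤ b := betaSingle_nonneg.trans hV
  have ha : 0 ≤ a := hb.trans hba
  have hone := one_le_descentConst (d := d) (s := s) hE.const_pos hc k
  set m := momentConst d C c₀ s
  have hm0 : 0 < m := momentConst_pos hE.const_pos hc
  set r := c₀ * (2 : ℝ) ^ (-j) with hr
  set Λ : ℝ := 2 ^ k * c₀⁻¹ with hΛ
  have hscale : (2 : ℝ) ^ (-i) ≤ Λ * r := by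
    calc (2 : ℝ) ^ (-i) ≤ 2 ^ ((k : ℤ) + -j) := zpow_le_zpow_right₀ one_le_two (by lia)
      _ = Λ * r := by
        rw [zpow_add₀ two_ne_zero, zpow_natCast, hΛ, hr]
        field_simp
  refine (lintegral_mono_set hQT).trans
    ((hT.lintegral_infDist_le hE (by linarith) hV).trans (ENNReal.ofReal_le_ofReal ?_))
  calc m * ((2 : ℝ) ^ (-i)) ^ d * (b * (2 : ℝ) ^ (-i)) ^ s
      ≤ m * (Λ * r) ^ d * (a * (Λ * r)) ^ s := by gcongr
    _ = r ^ d * ((m * Λ ^ d * Λ ^ s) * (a * r) ^ s) := by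
      rw [mul_left_comm a, Real.mul_rpow (by positivity) (by positivity), mul_pow]
      ring
    _ ≤ r ^ d * (descentConst d C c₀ s k ^ s * (a * r) ^ s) := by
      gcongr
      exact (lt_one_add _).le.trans (Real.self_le_rpow_of_one_le hone hs)
    _ = r ^ d * (descentConst d C c₀ s k * a * r) ^ s := by
      rw [← Real.mul_rpow (by positivity) (by positivity), mul_assoc _ a]

/-- Planes that are flat in the dilates of two cubes at most `k` generations above a common
descendant make an angle of at most `cubeAngleConst d C c₀ s k` times the sum of the two flatness
bounds. -/
def cubeAngleConst (d : ℕ) (C c₀ s : ℝ) (k : ℕ) : ℝ := angleConst d C * descentConst d C c₀ s k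

lemma cubeAngleConst_nonneg (hC : 1 ≤ C) (hc : 0 < c₀) (k : ℕ) :
    0 ≤ cubeAngleConst d C c₀ s k := by
  have hdescent := one_le_descentConst (d := d) (s := s) (one_pos.trans_le hC) hc k
  have hslab := one_le_slabConst d hC
  rw [cubeAngleConst, angleConst]
  positivity

lemma angleLE_of_isCube (hE : IsRegular (d : ℝ) C E) (hs : 1 ≤ s) {k : ℕ} {j i₁ i₂ : ℤ}
    {Q T₁ T₂ : Set F} (hQ : IsCube c₀ E j Q) (hT₁ : IsCube c₀ E i₁ T₁) (hT₂ : IsCube c₀ E i₂ T₂)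
    (hi₁ : j - k ≤ i₁) (hi₂ : j - k ≤ i₂) (hQT₁ : dilate E 2 Q ⊆ dilate E 2 T₁)
    (hQT₂ : dilate E 2 Q ⊆ dilate E 2 T₂) {V₁ V₂ : AffineSubspace ℝ F} [Nonempty V₁] [Nonempty V₂]
    (hV₂ : Module.finrank ℝ V₂.direction = d) {b₁ b₂ : ℝ} (hb₁ : 0 < b₁) (hb₂ : 0 < b₂)
    (hVb₁ : betaSingle (surfaceMeasure d E) s V₁ (dilate E 2 T₁) ≤ b₁)
    (hVb₂ : betaSingle (surfaceMeasure d E) s V₂ (dilate E 2 T₂) ≤ b₂) :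
    AngleLE V₁.direction V₂.direction (cubeAngleConst d C c₀ s k * (b₁ + b₂)) := by
  have hc := hQ.const_pos
  have hone := one_le_descentConst (d := d) (s := s) hE.const_pos hc k
  obtain ⟨x, hxQ, hx⟩ := hQ.exists_ball_inter_subset
  set r := c₀ * (2 : ℝ) ^ (-j)
  have hr : 0 < r := by positivity
  have hlow : ENNReal.ofReal (C⁻¹ * r ^ d) ≤ surfaceMeasure d E (ball x r ∩ E) := by
    refine (hE.le_surfaceMeasure_ball (hQ.subset hxQ) hQ.mem_generations hr
      (mul_le_of_le_one_left (by positivity) hQ.const_le_one)).trans_eq ?_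
    rw [surfaceMeasure, Measure.restrict_apply measurableSet_ball,
      Measure.restrict_apply (measurableSet_ball.inter hE.isClosed.measurableSet),
      Set.inter_assoc, Set.inter_self]
  have hball (f : F → ℝ≥0∞) := lintegral_mono_set (μ := surfaceMeasure d E) (f := f)
    (hx.trans (subset_dilate hQ.subset))
  exact (angleLE_of_lintegral_infDist_le hV₂ hE.one_le hr (by positivity) hs
    (fun y hy ρ hρ => hE.surfaceMeasure_ball_le hy.2 hρ) Set.inter_subset_left hlow
    ((hball _).trans (hT₁.lintegral_infDist_le_of_dilate_subset hE hs hi₁ hQT₁ hVb₁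
      (le_add_of_nonneg_right hb₂.le)))
    ((hball _).trans (hT₂.lintegral_infDist_le_of_dilate_subset hE hs hi₂ hQT₂ hVb₂
      (le_add_of_nonneg_left hb₁.le)))).mono (mul_assoc _ _ _).ge

/-- A choice, for every set, of a `d`-plane together with a positive bound for its flatness in the
dilate of the set. The bounds are near-infima of `betaSingle`, which need not be attained. -/
structure PlaneSelection (d : ℕ) (E : Set F) (s : ℝ) where
  plane : Set F → AffineSubspace ℝ F
  nonempty_plane : ∀ T, Nonempty (plane T)
  finrank_direction : ∀ T, Module.finrank ℝ (plane T).direction = d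
  bound : Set F → ℝ
  bound_pos : ∀ T, 0 < bound T
  betaSingle_le : ∀ T, betaSingle (surfaceMeasure d E) s (plane T) (dilate E 2 T) ≤ bound T

attribute [instance] PlaneSelection.nonempty_plane

end Beta

section Chains

variable {X : Type*} [MetricSpace X] [MeasurableSpace X] {d : ℕ} {C c₀ : ℝ} {E : Set X}
  (Δ : DyadicSystem c₀ E)

/-- A number of generations such that the dilate of a cube that many generations above `Q` and
meeting `dilate E 2 Q` contains `dilate E 2 Q`. -/
def shift (C c₀ : ℝ) : ℕ := ⌈3 * C ^ 2 * c₀⁻¹ ^ 2⌉₊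

lemma three_mul_inv_le_two_pow_shift (hC : 0 < C) (hc : 0 < c₀) :
    3 * c₀⁻¹ ≤ C⁻¹ ^ 2 * c₀ * 2 ^ shift C c₀ := by
  have h : 3 * C ^ 2 * c₀⁻¹ ^ 2 ≤ 2 ^ shift C c₀ :=
    (Nat.le_ceil _).trans (by exact_mod_cast Nat.lt_two_pow_self.le)
  calc 3 * c₀⁻¹ = C⁻¹ ^ 2 * c₀ * (3 * C ^ 2 * c₀⁻¹ ^ 2) := by field_simp
    _ ≤ C⁻¹ ^ 2 * c₀ * 2 ^ shift C c₀ := by gcongr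

namespace DyadicSystem

lemma exists_notMem_dilate (hc : 0 < c₀) (hc1 : c₀ ≤ 1) {i : ℤ} (hi : i ∈ generations E)
    {x y : X} (hx : x ∈ E) (hxy : x ≠ y) :
    ∃ N : ℕ, ∃ T ∈ Δ.level (i + N), x ∈ T ∧ y ∉ dilate E 2 T := by
  have hdist : 0 < dist x y := dist_pos.2 hxy
  obtain ⟨N, hN⟩ := exists_pow_lt_of_lt_one
    (show 0 < dist x y / (2 * c₀⁻¹ * (2 : ℝ) ^ (-i)) by positivity) two_inv_lt_one
  obtain ⟨T, hT, hxT⟩ := Δ.exists_mem_level (generations_mono hi (by lia : i ≤ i + N)) hx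
  refine ⟨N, T, hT, hxT, fun hyT => ?_⟩
  have hcube := Δ.isCube hc hc1 hT
  have hle := dist_le_of_mem_dilate_of_mem hcube.isBounded hyT hxT
  have hdiam := hcube.diam_le
  rw [show -(i + N) = -(N : ℤ) + -i by ring, zpow_add₀ two_ne_zero, zpow_neg, zpow_natCast,
    ← inv_pow] at hdiam
  rw [lt_div_iff₀ (by positivity)] at hN
  linarith [dist_comm x y]

variable [BorelSpace X]

/- If the generation `i` is less than `shift C c₀` steps above `Q`, then `T` is all of `E`. -/
lemma dilate_subset_dilate_of_isBaseGeneration (hΔ : Δ.HasTop) (hE : IsRegular (d : ℝ) C E)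
    {i j : ℤ} (hi : IsBaseGeneration E j (shift C c₀) i) {Q T : Set X} (hQ : IsCube c₀ E j Q)
    (hT : T ∈ Δ.level i) (hne : (T ∩ dilate E 2 Q).Nonempty) :
    dilate E 2 Q ⊆ dilate E 2 T := by
  have hc := hQ.const_pos
  rcases hi.eq_or_notMem with h | h
  · intro y hy
    obtain ⟨z, hzT, hzQ⟩ := hne
    refine ⟨hy.1, (infDist_le_dist_of_mem hzT).trans ?_⟩
    have hscale : (2 : ℝ) ^ (-i) = 2 ^ shift C c₀ * 2 ^ (-j) := by
      rw [h, show -(j - shift C c₀) = (shift C c₀ : ℤ) + -j by ring, zpow_add₀ two_ne_zero,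
        zpow_natCast]
    calc dist y z ≤ 3 * diam Q := dist_le_of_mem_dilate hQ.isBounded hQ.nonempty hy hzQ
      _ ≤ 3 * c₀⁻¹ * (2 : ℝ) ^ (-j) := by linarith [hQ.diam_le]
      _ ≤ C⁻¹ ^ 2 * c₀ * 2 ^ shift C c₀ * (2 : ℝ) ^ (-j) := by
        gcongr ?_ * _
        exact three_mul_inv_le_two_pow_shift hE.const_pos hc
      _ = C⁻¹ ^ 2 * c₀ * (2 : ℝ) ^ (-i) := by rw [hscale, mul_assoc]
      _ ≤ (2 - 1) * diam T := by linarith [(Δ.isCube hc hQ.const_le_one hT).le_diam hE]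
  · have hTE : T = E := by simpa [hΔ i hi.mem h] using hT.2
    rw [hTE]
    exact fun y hy => subset_dilate subset_rfl hy.1

/- Descend to the last cube around `x` whose dilate contains `y`. -/
lemma exists_mem_dilate_of_ne (hE : IsRegular (d : ℝ) C E) (hc : 0 < c₀) (hc1 : c₀ ≤ 1) {i : ℤ}
    (hi : i ∈ generations E) {x y : X} (hx : x ∈ E) (hy : y ∈ E) (hxy : x ≠ y)
    (htop : ∀ T ∈ Δ.level i, x ∈ T → y ∈ dilate E 2 T) :
    ∃ N : ℕ, ∃ T ∈ Δ.level (i + N), x ∈ T ∧ y ∈ dilate E 2 T ∧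
      C⁻¹ ^ 2 * c₀ / 2 * (2 : ℝ) ^ (-(i + N)) < dist x y := by
  obtain ⟨N, hN, T', hT', hxT', hyT'⟩ := Nat.exists_not_and_succ_of_not_zero_of_exists
    (p := fun N : ℕ => ∃ T ∈ Δ.level (i + N), x ∈ T ∧ y ∉ dilate E 2 T)
    (by simpa using htop) (Δ.exists_notMem_dilate hc hc1 hi hx hxy)
  push Not at hN
  obtain ⟨T, hT, hxT⟩ := Δ.exists_mem_level (generations_mono hi (by lia : i ≤ i + N)) hx
  refine ⟨N, T, hT, hxT, hN T hT hxT, ?_⟩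
  calc C⁻¹ ^ 2 * c₀ / 2 * (2 : ℝ) ^ (-(i + N))
      = C⁻¹ ^ 2 * c₀ * (2 : ℝ) ^ (-(i + (N + 1 : ℕ))) := by
        rw [show -(i + (N + 1 : ℕ)) = -(i + N) - 1 by push_cast; ring, zpow_sub_one₀ two_ne_zero]
        ring
    _ ≤ diam T' := (Δ.isCube hc hc1 hT').le_diam hE
    _ < dist x y := dist_comm x y ▸ lt_dist_of_notMem_dilate hy hxT' hyT'

end DyadicSystem

variable {F : Type*} [NormedAddCommGroup F] [InnerProductSpace ℝ F] [FiniteDimensional ℝ F]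
  [MeasurableSpace F] [BorelSpace F] {s : ℝ}

/- Telescope the angles between the planes of consecutive cubes. -/
lemma PlaneSelection.angleLE_of_chain {E : Set F} (P : PlaneSelection d E s)
    {Δ : DyadicSystem c₀ E} (hΔ : Δ.HasTop) (hE : IsRegular (d : ℝ) C E) (hs : 1 ≤ s) {i j : ℤ}
    (hi : IsBaseGeneration E j (shift C c₀) i) {Q T' : Set F} (hQ : IsCube c₀ E j Q)
    (hT' : T' ∈ Δ.level i) (hne : (T' ∩ dilate E 2 Q).Nonempty) {x : F} (hx : x ∈ dilate E 2 Q)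
    {T : ℕ → Set F} (hT : ∀ l : ℕ, T l ∈ Δ.level (i + l)) (hxT : ∀ l, x ∈ T l) (N : ℕ) :
    AngleLE (P.plane T').direction (P.plane (T N)).direction
      (2 * cubeAngleConst d C c₀ s (shift C c₀ + 1) *
        (P.bound T' + ∑ l ∈ Finset.range (N + 1), P.bound (T l))) := by
  set K := cubeAngleConst d C c₀ s (shift C c₀ + 1)
  have hcube {i : ℤ} {T : Set F} (hT : T ∈ Δ.level i) := Δ.isCube hQ.const_pos hQ.const_le_one hT
  have hbase := hi.sub_le
  have htelescope : AngleLE (P.plane T').direction (P.plane (T N)).direction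
      (K * (P.bound T' + ∑ l ∈ Finset.range (N + 1), P.bound (T l) +
        ∑ l ∈ Finset.range N, P.bound (T l))) := by
    induction N with
    | zero =>
      have hT₀ : T 0 ∈ Δ.level i := by simpa using hT 0
      have hsub {S : Set F} := Δ.dilate_subset_dilate_of_isBaseGeneration hΔ hE hi hQ (T := S)
      simpa using angleLE_of_isCube (k := shift C c₀ + 1) hE hs hQ (hcube hT') (hcube hT₀)
        (by lia) (by lia) (hsub hT' hne) (hsub hT₀ ⟨x, hxT 0, hx⟩) (P.finrank_direction _)
        (P.bound_pos _) (P.bound_pos _) (P.betaSingle_le _) (P.betaSingle_le _)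
    | succ N ih =>
      have hsub : T (N + 1) ⊆ T N :=
        Δ.subset_of_mem_of_mem (by lia) (hT N) (hT (N + 1)) (hxT N) (hxT (N + 1))
      have hcube' := hcube (hT (N + 1))
      have hstep := angleLE_of_isCube (k := shift C c₀ + 1) hE hs hcube' (hcube (hT N)) hcube'
        (by lia) (by lia) (dilate_mono hcube'.nonempty hsub (hcube (hT N)).isBounded) subset_rfl
        (P.finrank_direction _) (P.bound_pos _) (P.bound_pos _) (P.betaSingle_le _)
        (P.betaSingle_le _)
      refine (ih.trans hstep).mono (le_of_eq ?_)
      rw [Finset.sum_range_succ _ (N + 1), Finset.sum_range_succ _ N]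
      ring
  have hK : 0 ≤ K := cubeAngleConst_nonneg hE.one_le hQ.const_pos _
  refine htelescope.mono ?_
  rw [Finset.sum_range_succ, mul_comm 2 K, mul_assoc]
  gcongr
  linarith [P.bound_pos T', P.bound_pos (T N)]

end Chains

section Touching

lemma setLIntegral_le_tsum {Z ι : Type*} [MeasurableSpace Z] {μ : Measure Z} [Countable ι]
    {S : Set Z} {A : ι → Set Z} (hA : ∀ i, MeasurableSet (A i)) {f : Z → ℝ≥0∞}
    {g : ι → Z → ℝ≥0∞} (hg : ∀ i, Measurable (g i))
    (h : ∀ z ∈ S, f z ≠ 0 → ∃ i, z ∈ A i ∧ f z ≤ g i z) :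
    ∫⁻ z in S, f z ∂μ ≤ ∑' i, ∫⁻ z in A i, g i z ∂μ := by
  have hmeas (i : ι) : Measurable ((A i).indicator (g i)) := (hg i).indicator (hA i)
  have hle : ∀ z ∈ S, f z ≤ ∑' i, (A i).indicator (g i) z := by
    intro z hz
    rcases eq_or_ne (f z) 0 with h0 | h0
    · simp [h0]
    · obtain ⟨i, hzi, hi⟩ := h z hz h0
      calc f z ≤ (A i).indicator (g i) z := by rwa [Set.indicator_of_mem hzi]
        _ ≤ ∑' i, (A i).indicator (g i) z := ENNReal.le_tsum i
  calc ∫⁻ z in S, f z ∂μ ≤ ∫⁻ z in S, ∑' i, (A i).indicator (g i) z ∂μ :=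
        setLIntegral_mono (.tsum hmeas) hle
    _ ≤ ∫⁻ z, ∑' i, (A i).indicator (g i) z ∂μ := setLIntegral_le_lintegral _ _
    _ = ∑' i, ∫⁻ z in A i, g i z ∂μ := by
        rw [lintegral_tsum fun i => (hmeas i).aemeasurable]
        simp_rw [lintegral_indicator (hA _)]

variable {X : Type*} [MetricSpace X] [MeasurableSpace X] {d : ℕ} {C c₀ : ℝ} {E Q T : Set X}
  {i j l : ℤ}

namespace DyadicSystem

variable (Δ : DyadicSystem c₀ E) (μ : Measure X) (B : Set X → ℝ≥0∞)

/-- The cubes of generation `i` that meet `dilate E 2 Q`. -/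
def touching (Q : Set X) (i : ℤ) : Set (Set X) := {T ∈ Δ.level i | (T ∩ dilate E 2 Q).Nonempty}

/-- The total mass of the weight `B` on the cubes of generation `i` touching `dilate E 2 Q`. -/
def levelMass (Q : Set X) (i : ℤ) : ℝ≥0∞ := ∑' T : Δ.touching Q i, B T * μ T

/-- The masses of the generations from `i` on, with geometrically decaying coefficients. This is
the square function that controls the oscillation of distances in `dilate E 2 Q`. -/
def weightedSum (Q : Set X) (i : ℤ) : ℝ≥0∞ :=
  ∑' N : ℕ, (2⁻¹ : ℝ≥0∞) ^ N * Δ.levelMass μ B Q (i + N)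

/-- The function equal to `B T` on each cube `T` of generation `i` touching `dilate E 2 Q`. -/
def levelWeight (Q : Set X) (i : ℤ) (x : X) : ℝ≥0∞ :=
  ∑' T : Δ.touching Q i, (T : Set X).indicator (fun _ => B T) x

variable {Δ B}

lemma le_levelWeight (hT : T ∈ Δ.touching Q i) {x : X} (hx : x ∈ T) :
    B T ≤ Δ.levelWeight B Q i x := by
  calc B T = T.indicator (fun _ => B T) x := by rw [Set.indicator_of_mem hx]
    _ ≤ Δ.levelWeight B Q i x :=
        ENNReal.le_tsum (f := fun T : Δ.touching Q i => (T : Set X).indicator (fun _ => B T) x)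
          ⟨T, hT⟩

lemma isCube_of_mem_touching (hQ : IsCube c₀ E j Q) (hT : T ∈ Δ.touching Q i) : IsCube c₀ E i T :=
  Δ.isCube hQ.const_pos hQ.const_le_one hT.1

lemma subset_ball_of_mem_touching (hQ : IsCube c₀ E j Q) (hij : i ≤ j) (hil : i ≤ l)
    (hT : T ∈ Δ.touching Q l) {x : X} (hx : x ∈ dilate E 2 Q) :
    T ⊆ ball x (6 * c₀⁻¹ * (2 : ℝ) ^ (-i)) := by
  intro y hy
  obtain ⟨z, hzT, hzQ⟩ := hT.2
  have hc := hQ.const_pos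
  have hcube := isCube_of_mem_touching hQ hT
  have hyz : dist y z ≤ c₀⁻¹ * (2 : ℝ) ^ (-i) :=
    (dist_le_diam_of_mem hcube.isBounded hy hzT).trans (hcube.diam_le.trans (by gcongr; simp))
  have hzx : dist z x < 4 * c₀⁻¹ * (2 : ℝ) ^ (-i) :=
    (mem_ball.1 (hQ.dilate_subset_ball hx hzQ)).trans_le (by gcongr; simp)
  have hpos : 0 < c₀⁻¹ * (2 : ℝ) ^ (-i) := by positivity
  rw [mem_ball]
  linarith [dist_triangle y z x]

variable [SecondCountableTopology X]

lemma countable_touching (hc : 0 < c₀) : Countable (Δ.touching Q i) :=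
  ((Δ.countable_level hc i).mono fun _ hT => hT.1).to_subtype

lemma measurable_levelWeight (hc : 0 < c₀) : Measurable (Δ.levelWeight B Q i) :=
  have := Δ.countable_touching (Q := Q) (i := i) hc
  .tsum fun T => measurable_const.indicator (Δ.measurableSet_of_mem_level T.2.1)

lemma lintegral_levelWeight (hc : 0 < c₀) :
    ∫⁻ x, Δ.levelWeight B Q i x ∂μ = Δ.levelMass μ B Q i := by
  have := Δ.countable_touching (Q := Q) (i := i) hc
  have hmeas (T : Δ.touching Q i) := Δ.measurableSet_of_mem_level T.2.1
  unfold levelWeight levelMass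
  rw [lintegral_tsum fun T => (measurable_const.indicator (hmeas T)).aemeasurable]
  simp_rw [lintegral_indicator_const (hmeas _)]

lemma tsum_setLIntegral_le (hc : 0 < c₀) {𝒯 : Set (Set X)} (h𝒯 : 𝒯 ⊆ Δ.level i) {S : Set X}
    (hS : ∀ T ∈ 𝒯, T ⊆ S) (f : X → ℝ≥0∞) :
    ∑' T : 𝒯, ∫⁻ x in T, f x ∂μ ≤ ∫⁻ x in S, f x ∂μ := by
  have := ((Δ.countable_level hc i).mono h𝒯).to_subtype
  rw [← lintegral_iUnion (fun T : 𝒯 => Δ.measurableSet_of_mem_level (h𝒯 T.2))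
    fun T T' hne => Δ.pairwiseDisjoint_level i (h𝒯 T.2) (h𝒯 T'.2) (Subtype.coe_ne_coe.2 hne)]
  exact lintegral_mono_set (Set.iUnion_subset fun T => hS T T.2)

lemma tsum_measure_le (hc : 0 < c₀) {𝒯 : Set (Set X)} (h𝒯 : 𝒯 ⊆ Δ.level i) {S : Set X}
    (hS : ∀ T ∈ 𝒯, T ⊆ S) : ∑' T : 𝒯, μ T ≤ μ S := by
  simpa using tsum_setLIntegral_le μ hc h𝒯 hS 1

variable [BorelSpace X]

lemma tsum_measure_touching_le (hE : IsRegular (d : ℝ) C E) (hQ : IsCube c₀ E j Q) (hij : i ≤ j)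
    (hil : i ≤ l) : ∑' T : Δ.touching Q l, surfaceMeasure d E T ≤
      ENNReal.ofReal (C * (6 * c₀⁻¹ * (2 : ℝ) ^ (-i)) ^ d) := by
  have hc := hQ.const_pos
  obtain ⟨x, hx⟩ := hQ.nonempty
  have hx' := subset_dilate hQ.subset hx
  exact (tsum_measure_le _ hc (fun T hT => hT.1)
    fun T hT => subset_ball_of_mem_touching hQ hij hil hT hx').trans
      (hE.surfaceMeasure_ball_le hx'.1 (by positivity))

end DyadicSystem

lemma IsCube.ofReal_pow_le [BorelSpace X] (hE : IsRegular (d : ℝ) C E) (hQ : IsCube c₀ E j Q) :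
    ENNReal.ofReal (((2 : ℝ) ^ (-j)) ^ d) ≤
      ENNReal.ofReal (C * c₀⁻¹ ^ d) * surfaceMeasure d E Q := by
  have hc := hQ.const_pos
  have hC := hE.const_pos
  calc ENNReal.ofReal (((2 : ℝ) ^ (-j)) ^ d)
      = ENNReal.ofReal (C * c₀⁻¹ ^ d) * ENNReal.ofReal (C⁻¹ * (c₀ * (2 : ℝ) ^ (-j)) ^ d) := by
        rw [← ENNReal.ofReal_mul (by positivity), mul_pow, inv_pow]
        congr 1
        field_simp
    _ ≤ ENNReal.ofReal (C * c₀⁻¹ ^ d) * surfaceMeasure d E Q := by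
        gcongr
        exact hQ.le_measure hE

lemma IsCube.tsum_measure_touching_le [SecondCountableTopology X] [BorelSpace X]
    {Δ : DyadicSystem c₀ E} (hE : IsRegular (d : ℝ) C E) (hQ : IsCube c₀ E j Q) (hij : i ≤ j)
    (hil : i ≤ l) {T' : Set X} (hT' : IsCube c₀ E i T') :
    ∑' T : Δ.touching Q l, surfaceMeasure d E T ≤
      ENNReal.ofReal (C * (6 * c₀⁻¹) ^ d * (C * c₀⁻¹ ^ d)) * surfaceMeasure d E T' := by
  have hc := hQ.const_pos
  have hC := hE.const_pos
  calc ∑' T : Δ.touching Q l, surfaceMeasure d E T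
      ≤ ENNReal.ofReal (C * (6 * c₀⁻¹) ^ d) * ENNReal.ofReal (((2 : ℝ) ^ (-i)) ^ d) := by
        rw [← ENNReal.ofReal_mul (by positivity), mul_assoc, ← mul_pow]
        exact DyadicSystem.tsum_measure_touching_le hE hQ hij hil
    _ ≤ ENNReal.ofReal (C * (6 * c₀⁻¹) ^ d) *
          (ENNReal.ofReal (C * c₀⁻¹ ^ d) * surfaceMeasure d E T') := by
        gcongr
        exact hT'.ofReal_pow_le hE
    _ = _ := by rw [ENNReal.ofReal_mul (p := C * (6 * c₀⁻¹) ^ d) (by positivity), mul_assoc]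

end Touching

section Chain

variable {X : Type*} [MetricSpace X] [MeasurableSpace X] {d : ℕ} {C c₀ : ℝ} {E Q T' : Set X}
  {i j : ℤ} {Δ : DyadicSystem c₀ E} {B : Set X → ℝ≥0∞}

variable (Δ B) in
/-- The weight of the first `N + 1` cubes of the chain `T₀ ⊇ T₁ ⊇ …` of cubes containing a point,
where `T₀` has generation `i`, added to that of a reference cube `T'` of generation `i`. -/
def DyadicSystem.chainWeight (Q T' : Set X) (i : ℤ) (N : ℕ) (x : X) : ℝ≥0∞ :=
  B T' + ∑ l ∈ Finset.range (N + 1), Δ.levelWeight B Q (i + l) x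

/-- The constant in `IsCube.tsum_chainWeight_le`. -/
def chainConst (d : ℕ) (C c₀ : ℝ) : ℝ := 2 * (C * (6 * c₀⁻¹) ^ d * (C * c₀⁻¹ ^ d)) + 2

variable [SecondCountableTopology X]

lemma DyadicSystem.measurable_chainWeight (hc : 0 < c₀) {N : ℕ} :
    Measurable (Δ.chainWeight B Q T' i N) :=
  measurable_const.add (Finset.measurable_sum _ fun _ _ => measurable_levelWeight hc)

namespace IsCube

variable [BorelSpace X]

lemma tsum_setLIntegral_chainWeight_le (hE : IsRegular (d : ℝ) C E) (hQ : IsCube c₀ E j Q)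
    (hij : i ≤ j) (hT' : T' ∈ Δ.touching Q i) (N : ℕ) :
    ∑' T : Δ.touching Q (i + N), ∫⁻ x in T, Δ.chainWeight B Q T' i N x ∂(surfaceMeasure d E) ≤
      ENNReal.ofReal (C * (6 * c₀⁻¹) ^ d * (C * c₀⁻¹ ^ d)) *
          Δ.levelMass (surfaceMeasure d E) B Q i +
        ∑ l ∈ Finset.range (N + 1), Δ.levelMass (surfaceMeasure d E) B Q (i + l) := by
  have hc := hQ.const_pos
  set μ := surfaceMeasure (d : ℝ) E
  set κ := ENNReal.ofReal (C * (6 * c₀⁻¹) ^ d * (C * c₀⁻¹ ^ d))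
  have htop : ∑' T : Δ.touching Q (i + N), ∫⁻ _ in T, B T' ∂μ ≤ κ * Δ.levelMass μ B Q i := by
    simp_rw [setLIntegral_const]
    rw [ENNReal.tsum_mul_left]
    calc B T' * ∑' T : Δ.touching Q (i + N), μ T ≤ B T' * (κ * μ T') := by
          gcongr
          exact hQ.tsum_measure_touching_le hE hij (by lia)
            (DyadicSystem.isCube_of_mem_touching hQ hT')
      _ = κ * (B T' * μ T') := mul_left_comm _ _ _
      _ ≤ κ * Δ.levelMass μ B Q i := by
          gcongr
          exact ENNReal.le_tsum (f := fun T : Δ.touching Q i => B T * μ T) ⟨T', hT'⟩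
  have hlevel : ∑' T : Δ.touching Q (i + N), ∫⁻ x in T, ∑ l ∈ Finset.range (N + 1),
      Δ.levelWeight B Q (i + l) x ∂μ ≤ ∑ l ∈ Finset.range (N + 1), Δ.levelMass μ B Q (i + l) := by
    refine (DyadicSystem.tsum_setLIntegral_le μ hc (fun T hT => hT.1)
      (fun T _ => Set.subset_univ T) _).trans_eq ?_
    rw [setLIntegral_univ,
      lintegral_finsetSum _ fun _ _ => DyadicSystem.measurable_levelWeight hc]
    simp_rw [DyadicSystem.lintegral_levelWeight μ hc]
  simp_rw [DyadicSystem.chainWeight, lintegral_add_left measurable_const]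
  rw [ENNReal.tsum_add]
  exact add_le_add htop hlevel

lemma tsum_chainWeight_le (hE : IsRegular (d : ℝ) C E) (hQ : IsCube c₀ E j Q) (hij : i ≤ j)
    (hT' : T' ∈ Δ.touching Q i) :
    ∑' N : ℕ, 2⁻¹ ^ N * ∑' T : Δ.touching Q (i + N),
        ∫⁻ x in T, Δ.chainWeight B Q T' i N x ∂(surfaceMeasure d E) ≤
      ENNReal.ofReal (chainConst d C c₀) * Δ.weightedSum (surfaceMeasure d E) B Q i := by
  have hc := hQ.const_pos
  have hC := hE.const_pos
  set W := Δ.weightedSum (surfaceMeasure (d : ℝ) E) B Q i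
  set Y := Δ.levelMass (surfaceMeasure (d : ℝ) E) B Q
  set κ := C * (6 * c₀⁻¹) ^ d * (C * c₀⁻¹ ^ d) with hκ
  have hfirst : Y i ≤ W := by
    calc Y i = 2⁻¹ ^ 0 * Y (i + (0 : ℕ)) := by simp
      _ ≤ W := ENNReal.le_tsum (f := fun N : ℕ => (2⁻¹ : ℝ≥0∞) ^ N * Y (i + N)) 0
  calc _ ≤ ∑' N : ℕ, (2⁻¹ : ℝ≥0∞) ^ N *
        (ENNReal.ofReal κ * Y i + ∑ l ∈ Finset.range (N + 1), Y (i + l)) := by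
        gcongr with N
        exact hQ.tsum_setLIntegral_chainWeight_le hE hij hT' N
    _ = 2 * (ENNReal.ofReal κ * Y i) + 2 * W := by
        simp_rw [mul_add]
        rw [ENNReal.tsum_add, tsum_inv_two_pow_mul_sum_range fun l => Y (i + l),
          ENNReal.tsum_mul_right, ENNReal.tsum_geometric_two]
        rfl
    _ ≤ 2 * (ENNReal.ofReal κ * W) + 2 * W := by gcongr
    _ = ENNReal.ofReal (chainConst d C c₀) * W := by
        rw [chainConst, ← hκ, ENNReal.ofReal_add (by positivity) zero_le_two,
          ENNReal.ofReal_mul zero_le_two, ENNReal.ofReal_ofNat]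
        ring

end IsCube

end Chain

section Scale

variable {C c₀ : ℝ}

/-- The constant comparing the distance of two points with the scale of the last cube around one of
them whose dilate contains the other. -/
def scaleConst (C c₀ : ℝ) : ℝ := 2 * C ^ 2 * c₀⁻¹

lemma scaleConst_nonneg (hc : 0 < c₀) : 0 ≤ scaleConst C c₀ := by
  rw [scaleConst]
  positivity

variable {X : Type*} [MetricSpace X] [MeasurableSpace X] [BorelSpace X] {d : ℕ} {E Q : Set X}
  {i j : ℤ} {Δ : DyadicSystem c₀ E}

lemma IsCube.exists_scale_of_ne (hE : IsRegular (d : ℝ) C E) (hΔ : Δ.HasTop)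
    (hi : IsBaseGeneration E j (shift C c₀) i) (hQ : IsCube c₀ E j Q) {x y : X}
    (hx : x ∈ dilate E 2 Q) (hy : y ∈ dilate E 2 Q) (hxy : x ≠ y) :
    ∃ N : ℕ, ∃ T ∈ Δ.touching Q (i + N), x ∈ T ∧ y ∈ dilate E 2 T ∧
      (2 : ℝ) ^ (-(i + N)) ≤ scaleConst C c₀ * dist x y ∧
      dist x y ≤ scaleConst C c₀ * 2 ^ (-(i + N)) := by
  have hc := hQ.const_pos
  have hC := hE.const_pos
  obtain ⟨N, T, hT, hxT, hyT, hlow⟩ := Δ.exists_mem_dilate_of_ne hE hc hQ.const_le_one hi.mem hx.1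
    hy.1 hxy fun T hT hxT =>
      Δ.dilate_subset_dilate_of_isBaseGeneration hΔ hE hi hQ hT ⟨x, hxT, hx⟩ hy
  have hcube := Δ.isCube hc hQ.const_le_one hT
  refine ⟨N, T, ⟨hT, x, hxT, hx⟩, hxT, hyT, ?_, ?_⟩
  · calc (2 : ℝ) ^ (-(i + N)) = scaleConst C c₀ * (C⁻¹ ^ 2 * c₀ / 2 * 2 ^ (-(i + N))) := by
          rw [scaleConst]
          field_simp
      _ ≤ scaleConst C c₀ * dist x y := by
          gcongr
          exact scaleConst_nonneg hc
  · calc dist x y = dist y x := dist_comm x y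
      _ ≤ 2 * diam T := dist_le_of_mem_dilate_of_mem hcube.isBounded hyT hxT
      _ ≤ 2 * 1 ^ 2 * c₀⁻¹ * 2 ^ (-(i + N)) := by linarith [hcube.diam_le]
      _ ≤ scaleConst C c₀ * 2 ^ (-(i + N)) := by
          rw [scaleConst]
          gcongr
          exact hE.one_le

end Scale

section Oscillation

lemma zpow_neg_add_natCast (i : ℤ) (N : ℕ) : (2 : ℝ) ^ (-(i + N)) = 2 ^ (-i) * 2⁻¹ ^ N := by
  rw [neg_add, zpow_add₀ two_ne_zero, zpow_neg _ (N : ℤ), zpow_natCast, inv_pow]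

lemma two_zpow_neg_le {i j : ℤ} {k : ℕ} (hij : j - k ≤ i) :
    (2 : ℝ) ^ (-i) ≤ 2 ^ k * 2 ^ (-j) := by
  rw [← zpow_natCast, ← zpow_add₀ two_ne_zero]
  exact zpow_le_zpow_right₀ one_le_two (by lia)

lemma two_pow_mul_zpow_rpow_mul_pow_le {d : ℕ} (hd : d ≠ 0) {p : ℝ} (hp : 1 ≤ p) (i : ℤ) (N : ℕ) :
    2 ^ N * (((2 : ℝ) ^ (-(i + N))) ^ p * ((2 : ℝ) ^ (-(i + N))) ^ d) ≤
      ((2 : ℝ) ^ (-i)) ^ p * ((2 : ℝ) ^ (-i)) ^ d * 2⁻¹ ^ N := by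
  have hle_one : (2⁻¹ : ℝ) ^ N ≤ 1 := pow_le_one₀ (by positivity) two_inv_lt_one.le
  have hrpow : ((2⁻¹ : ℝ) ^ N) ^ p ≤ 2⁻¹ ^ N :=
    Real.rpow_le_self_of_le_one (by positivity) hle_one hp
  have hpow : ((2⁻¹ : ℝ) ^ N) ^ d ≤ 2⁻¹ ^ N := pow_le_of_le_one (by positivity) hle_one hd
  set L := (2 : ℝ) ^ (-i)
  rw [zpow_neg_add_natCast, Real.mul_rpow (by positivity) (by positivity), mul_pow]
  calc 2 ^ N * (L ^ p * ((2⁻¹ : ℝ) ^ N) ^ p * (L ^ d * ((2⁻¹ : ℝ) ^ N) ^ d))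
      ≤ 2 ^ N * (L ^ p * 2⁻¹ ^ N * (L ^ d * 2⁻¹ ^ N)) := by gcongr
    _ = L ^ p * L ^ d * 2⁻¹ ^ N * (2 ^ N * 2⁻¹ ^ N) := by ring
    _ = L ^ p * L ^ d * 2⁻¹ ^ N := by rw [← mul_pow]; norm_num

variable {F : Type*} [NormedAddCommGroup F] [InnerProductSpace ℝ F] [MeasurableSpace F]
  [BorelSpace F] {d : ℕ} {C c₀ p s : ℝ} {E Q T T' : Set F} {i j m : ℤ}
  {Δ : DyadicSystem c₀ E}

namespace PlaneSelection

/-- The power of the flatness bound that enters the square function. -/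
def weight (P : PlaneSelection d E s) (T : Set F) : ℝ≥0∞ := ENNReal.ofReal (P.bound T ^ s)

lemma ofReal_sum_bound_rpow_le (P : PlaneSelection d E s) (hs : 1 ≤ s) {A : ℝ} (hA : 0 ≤ A)
    {T : ℕ → Set F} (hT : ∀ l : ℕ, T l ∈ Δ.level (i + l)) {x : F} (hx : x ∈ dilate E 2 Q)
    (hxT : ∀ l, x ∈ T l) (N : ℕ) :
    ENNReal.ofReal ((A * (P.bound T' + ∑ l ∈ Finset.range (N + 1), P.bound (T l))) ^ s) ≤
      ENNReal.ofReal (A ^ s * powerSumConst s * 2 ^ N) * Δ.chainWeight P.weight Q T' i N x := by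
  have hb (S : Set F) : 0 ≤ P.bound S := (P.bound_pos S).le
  have hbs (S : Set F) : 0 ≤ P.bound S ^ s := Real.rpow_nonneg (hb S) s
  have hpow := powerSumConst_pos (one_pos.trans_le hs)
  calc _ ≤ ENNReal.ofReal (A ^ s * powerSumConst s * 2 ^ N *
          (P.bound T' ^ s + ∑ l ∈ Finset.range (N + 1), P.bound (T l) ^ s)) := by
        refine ENNReal.ofReal_le_ofReal ?_
        rw [Real.mul_rpow hA (add_nonneg (hb _) (Finset.sum_nonneg fun _ _ => hb _)), mul_assoc,
          mul_assoc, ← mul_assoc (powerSumConst s)]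
        gcongr
        exact add_sum_rpow_le hs N (hb _) fun _ => hb _
    _ = ENNReal.ofReal (A ^ s * powerSumConst s * 2 ^ N) *
          (P.weight T' + ∑ l ∈ Finset.range (N + 1), P.weight (T l)) := by
        rw [ENNReal.ofReal_mul (by positivity), ENNReal.ofReal_add (hbs _)
          (Finset.sum_nonneg fun _ _ => hbs _), ENNReal.ofReal_sum_of_nonneg fun _ _ => hbs _]
        rfl
    _ ≤ _ := by
        unfold DyadicSystem.chainWeight
        gcongr with l
        exact DyadicSystem.le_levelWeight ⟨hT l, x, hxT l, hx⟩ (hxT l)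

lemma lintegral_infDist_le (P : PlaneSelection d E s) (hE : IsRegular (d : ℝ) C E) (hs : 0 < s)
    (hT : IsCube c₀ E m T) {W : F → ℝ≥0∞} (hW : ∀ x ∈ T, P.weight T ≤ W x) :
    ∫⁻ x in dilate E 2 T, ENNReal.ofReal (infDist x (P.plane T) ^ s) ∂(surfaceMeasure d E) ≤
      ENNReal.ofReal (momentConst d C c₀ s * (C * c₀⁻¹ ^ d) * ((2 : ℝ) ^ (-m)) ^ s) *
        ∫⁻ x in T, W x ∂(surfaceMeasure d E) := by
  have hc := hT.const_pos
  have hC := hE.const_pos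
  have hmoment : 0 < momentConst d C c₀ s := momentConst_pos hC hc
  set ℓ : ℝ := 2 ^ (-m)
  calc _ ≤ ENNReal.ofReal (momentConst d C c₀ s * ℓ ^ d * (P.bound T * ℓ) ^ s) :=
        hT.lintegral_infDist_le hE hs (P.betaSingle_le T)
    _ = ENNReal.ofReal (momentConst d C c₀ s * ℓ ^ s) * P.weight T * ENNReal.ofReal (ℓ ^ d) := by
        have := P.bound_pos T
        rw [weight, ← ENNReal.ofReal_mul (by positivity), ← ENNReal.ofReal_mul (by positivity),
          Real.mul_rpow (by positivity) (by positivity)]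
        ring_nf
    _ ≤ ENNReal.ofReal (momentConst d C c₀ s * ℓ ^ s) * P.weight T *
          (ENNReal.ofReal (C * c₀⁻¹ ^ d) * surfaceMeasure d E T) := by
        gcongr
        exact hT.ofReal_pow_le hE
    _ = ENNReal.ofReal (momentConst d C c₀ s * (C * c₀⁻¹ ^ d) * ℓ ^ s) *
          ∫⁻ _ in T, P.weight T ∂(surfaceMeasure d E) := by
        rw [setLIntegral_const, mul_right_comm _ _ (ℓ ^ s),
          ENNReal.ofReal_mul (p := momentConst d C c₀ s * ℓ ^ s) (by positivity)]
        ring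
    _ ≤ _ := mul_le_mul_right (setLIntegral_mono' hT.measurableSet hW) _

lemma setLIntegral_prod_le (P : PlaneSelection d E s) (hE : IsRegular (d : ℝ) C E) (hs : 0 < s)
    (hT : IsCube c₀ E m T) {W : F → ℝ≥0∞} (hWm : Measurable W) (hW : ∀ x ∈ T, P.weight T ≤ W x)
    (a c : ℝ≥0∞) :
    ∫⁻ z in T ×ˢ dilate E 2 T, (a * (ENNReal.ofReal (infDist z.1 (P.plane T) ^ s) +
        ENNReal.ofReal (infDist z.2 (P.plane T) ^ s)) + c * W z.1)
          ∂(surfaceMeasure d E).prod (surfaceMeasure d E) ≤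
      ENNReal.ofReal (C * (4 * c₀⁻¹ * (2 : ℝ) ^ (-m)) ^ d) *
        (2 * a * ENNReal.ofReal (momentConst d C c₀ s * (C * c₀⁻¹ ^ d) * ((2 : ℝ) ^ (-m)) ^ s) +
          c) *
          ∫⁻ x in T, W x ∂(surfaceMeasure d E) := by
  have := hE.sigmaFinite_surfaceMeasure
  set μ := surfaceMeasure (d : ℝ) E
  set f : F → ℝ≥0∞ := fun x => ENNReal.ofReal (infDist x (P.plane T) ^ s)
  have hf : Measurable f := (measurable_infDist.pow_const s).ennreal_ofReal
  have hmoment := P.lintegral_infDist_le hE hs hT hW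
  set I := ∫⁻ x in T, W x ∂μ
  set K := ENNReal.ofReal (momentConst d C c₀ s * (C * c₀⁻¹ ^ d) * ((2 : ℝ) ^ (-m)) ^ s)
  have hTsub : T ⊆ dilate E 2 T := subset_dilate hT.subset
  have hmass := hT.measure_dilate_le hE
  calc _ = ∫⁻ z in T ×ˢ dilate E 2 T, ((a * f z.1 + c * W z.1) + a * f z.2) ∂μ.prod μ := by
        simp only [f, mul_add, add_right_comm]
    _ = μ (dilate E 2 T) * (a * ∫⁻ x in T, f x ∂μ + c * I) +
          μ T * (a * ∫⁻ x in dilate E 2 T, f x ∂μ) := by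
        rw [setLIntegral_prod_add (f := fun x => a * f x + c * W x) (g := fun x => a * f x) _ _
          (by fun_prop) (by fun_prop), lintegral_add_left (by fun_prop),
          lintegral_const_mul _ hf, lintegral_const_mul _ hWm, lintegral_const_mul _ hf]
    _ ≤ ENNReal.ofReal (C * (4 * c₀⁻¹ * (2 : ℝ) ^ (-m)) ^ d) * (a * (K * I) + c * I) +
          ENNReal.ofReal (C * (4 * c₀⁻¹ * (2 : ℝ) ^ (-m)) ^ d) * (a * (K * I)) := by
        gcongr
        · exact (lintegral_mono_set hTsub).trans hmoment
        · exact (measure_mono hTsub).trans hmass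
    _ = _ := by ring

end PlaneSelection

/-- The constant by which the weight of a chain of cubes controls the angles along it. -/
def chainAngleConst (d : ℕ) (C c₀ s : ℝ) : ℝ :=
  (2 * cubeAngleConst d C c₀ s (shift C c₀ + 1)) ^ s * powerSumConst s

lemma chainAngleConst_nonneg (hC : 1 ≤ C) (hc : 0 < c₀) (hs : 0 < s) :
    0 ≤ chainAngleConst d C c₀ s := by
  have := cubeAngleConst_nonneg (d := d) (s := s) hC hc (shift C c₀ + 1)
  have := powerSumConst_pos hs
  rw [chainAngleConst]
  positivity

/-- The majorant of the oscillation `|‖x - y‖ - ‖π (x - y)‖| ^ p` at a pair `z = (x, y)` whose scale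
is that of the cube `T` of generation `i + N`, where `π` is the orthogonal projection onto the
direction of the plane of `T'`. -/
def PlaneSelection.majorant (P : PlaneSelection d E (2 * p)) (Δ : DyadicSystem c₀ E) (C : ℝ)
    (Q T' : Set F) (i : ℤ) (N : ℕ) (T : Set F) (z : F × F) : ℝ≥0∞ :=
  ENNReal.ofReal ((9 * scaleConst C c₀) ^ p * (((2 : ℝ) ^ (-(i + N))) ^ p)⁻¹) *
      (ENNReal.ofReal (infDist z.1 (P.plane T) ^ (2 * p)) +
        ENNReal.ofReal (infDist z.2 (P.plane T) ^ (2 * p))) +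
    ENNReal.ofReal ((9 * scaleConst C c₀) ^ p * ((2 : ℝ) ^ (-(i + N))) ^ p *
        (chainAngleConst d C c₀ (2 * p) * 2 ^ N)) *
      Δ.chainWeight P.weight Q T' i N z.1

variable [FiniteDimensional ℝ F]

/- At the scale of the cube given by `exists_scale_of_ne`, the oscillation splits into the distances
of the two points from the plane of that cube and the angle between that plane and the top one. -/
lemma PlaneSelection.exists_oscillation_le (P : PlaneSelection d E (2 * p)) (hΔ : Δ.HasTop)
    (hE : IsRegular (d : ℝ) C E) (hp : 1 ≤ p) (hi : IsBaseGeneration E j (shift C c₀) i)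
    (hQ : IsCube c₀ E j Q) (hT' : T' ∈ Δ.touching Q i) {x y : F}
    (hx : x ∈ dilate E 2 Q) (hy : y ∈ dilate E 2 Q) (hxy : x ≠ y) :
    ∃ N : ℕ, ∃ T ∈ Δ.touching Q (i + N), x ∈ T ∧ y ∈ dilate E 2 T ∧
      ENNReal.ofReal (|‖x - y‖ - ‖(P.plane T').direction.starProjection (x - y)‖| ^ p) ≤
        P.majorant Δ C Q T' i N T (x, y) := by
  have hs : 1 ≤ 2 * p := by linarith
  have hκ := scaleConst_nonneg (C := C) hQ.const_pos
  obtain ⟨N, T, hT, hxT, hyT, hlow, hup⟩ := hQ.exists_scale_of_ne hE hΔ hi hx hy hxy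
  rw [dist_eq_norm] at hlow hup
  choose S hS hxS using
    fun l : ℕ => Δ.exists_mem_level (generations_mono hi.mem (by lia : i ≤ i + l)) hx.1
  obtain rfl : S N = T := Δ.eq_of_mem_level (hS N) hT.1 (hxS N) hxT
  refine ⟨N, S N, hT, hxT, hyT, ?_⟩
  have hangle := P.angleLE_of_chain hΔ hE hs hi hQ hT'.1 hT'.2 hx hS hxS N
  set K := 2 * cubeAngleConst d C c₀ (2 * p) (shift C c₀ + 1)
  have hK : 0 ≤ K := mul_nonneg zero_le_two (cubeAngleConst_nonneg hE.one_le hQ.const_pos _)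
  have hsum := P.ofReal_sum_bound_rpow_le (T' := T') hs hK hS hx hxS N
  have hA : 0 ≤ K * (P.bound T' + ∑ l ∈ Finset.range (N + 1), P.bound (S l)) :=
    mul_nonneg hK (add_nonneg (P.bound_pos _).le (Finset.sum_nonneg fun _ _ => (P.bound_pos _).le))
  set ℓ : ℝ := 2 ^ (-(i + N))
  have hℓ : 0 < ℓ := by positivity
  have hdist (z : F) : 0 ≤ infDist z (P.plane (S N)) ^ (2 * p) :=
    Real.rpow_nonneg infDist_nonneg _
  refine (ENNReal.ofReal_le_ofReal
    (abs_norm_sub_norm_starProjection_rpow_le hp hκ hangle hA hℓ hlow hup)).trans ?_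
  rw [PlaneSelection.majorant, mul_add, ← mul_assoc, ← mul_assoc, ENNReal.ofReal_add
    (mul_nonneg (by positivity) (add_nonneg (hdist x) (hdist y))) (by positivity),
    ENNReal.ofReal_mul (by positivity), ENNReal.ofReal_add (hdist x) (hdist y)]
  gcongr
  set M := (9 * scaleConst C c₀) ^ p * ℓ ^ p
  have hM : 0 ≤ M := by positivity
  rw [ENNReal.ofReal_mul hM, ENNReal.ofReal_mul hM, mul_assoc (ENNReal.ofReal M)]
  exact mul_le_mul_right hsum _

/-- The constant in the bound for the oscillation over a single cube. -/
def cubeOscillationConst (d : ℕ) (C c₀ p : ℝ) : ℝ :=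
  C * (4 * c₀⁻¹) ^ d * (9 * scaleConst C c₀) ^ p *
    (2 * (momentConst d C c₀ (2 * p) * (C * c₀⁻¹ ^ d)) + chainAngleConst d C c₀ (2 * p))

lemma cubeOscillationConst_nonneg (hC : 1 ≤ C) (hc : 0 < c₀) (hp : 0 < p) :
    0 ≤ cubeOscillationConst d C c₀ p := by
  have := momentConst_pos (d := d) (s := 2 * p) (one_pos.trans_le hC) hc
  have := scaleConst_nonneg (C := C) hc
  have := chainAngleConst_nonneg (d := d) hC hc (mul_pos two_pos hp)
  rw [cubeOscillationConst]
  positivity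

lemma cubeOscillationConst_spec (hd : d ≠ 0) (hC : 1 ≤ C) (hc : 0 < c₀) (hp : 1 ≤ p) (i : ℤ)
    (N : ℕ) :
    C * (4 * c₀⁻¹ * (2 : ℝ) ^ (-(i + N))) ^ d *
        (2 * ((9 * scaleConst C c₀) ^ p * (((2 : ℝ) ^ (-(i + N))) ^ p)⁻¹) *
            (momentConst d C c₀ (2 * p) * (C * c₀⁻¹ ^ d) * ((2 : ℝ) ^ (-(i + N))) ^ (2 * p)) +
          (9 * scaleConst C c₀) ^ p * ((2 : ℝ) ^ (-(i + N))) ^ p *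
            (chainAngleConst d C c₀ (2 * p) * 2 ^ N)) ≤
      cubeOscillationConst d C c₀ p * (((2 : ℝ) ^ (-i)) ^ p * ((2 : ℝ) ^ (-i)) ^ d) * 2⁻¹ ^ N := by
  have hconst := cubeOscillationConst_nonneg (d := d) hC hc (one_pos.trans_le hp)
  have hscale := two_pow_mul_zpow_rpow_mul_pow_le hd hp i N
  have hm := momentConst_pos (d := d) (s := 2 * p) (one_pos.trans_le hC) hc
  have hκ := scaleConst_nonneg (C := C) hc
  set ℓ : ℝ := 2 ^ (-(i + N))
  have hℓ : 0 < ℓ ^ p := by positivity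
  set m := momentConst d C c₀ (2 * p) * (C * c₀⁻¹ ^ d)
  set A := chainAngleConst d C c₀ (2 * p)
  set M := (9 * scaleConst C c₀) ^ p
  calc _ = C * (4 * c₀⁻¹) ^ d * M * (2 * m + A * 2 ^ N) * (ℓ ^ p * ℓ ^ d) := by
        rw [two_mul p, Real.rpow_add (by positivity), mul_pow]
        field_simp
    _ ≤ C * (4 * c₀⁻¹) ^ d * M * (2 * m * 2 ^ N + A * 2 ^ N) * (ℓ ^ p * ℓ ^ d) := by
        gcongr ?_ * (?_ + _) * _
        exact le_mul_of_one_le_right (by positivity) (one_le_pow₀ one_le_two)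
    _ = cubeOscillationConst d C c₀ p * (2 ^ N * (ℓ ^ p * ℓ ^ d)) := by
        rw [cubeOscillationConst]
        ring
    _ ≤ cubeOscillationConst d C c₀ p *
          (((2 : ℝ) ^ (-i)) ^ p * ((2 : ℝ) ^ (-i)) ^ d * 2⁻¹ ^ N) := by gcongr
    _ = _ := by ring

lemma PlaneSelection.measurable_majorant (P : PlaneSelection d E (2 * p)) (hc : 0 < c₀) (N : ℕ)
    (T : Set F) : Measurable (P.majorant Δ C Q T' i N T) := by
  have hchain : Measurable (Δ.chainWeight P.weight Q T' i N) :=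
    DyadicSystem.measurable_chainWeight hc
  have : Measurable fun x => ENNReal.ofReal (infDist x (P.plane T : Set F) ^ (2 * p)) :=
    (measurable_infDist.pow_const _).ennreal_ofReal
  unfold PlaneSelection.majorant
  fun_prop

lemma PlaneSelection.setLIntegral_majorant_le (P : PlaneSelection d E (2 * p))
    (hE : IsRegular (d : ℝ) C E) (hd : d ≠ 0) (hp : 1 ≤ p) (hQ : IsCube c₀ E j Q) {N : ℕ}
    {T : Set F} (hT : T ∈ Δ.touching Q (i + N)) :
    ∫⁻ z in T ×ˢ dilate E 2 T, P.majorant Δ C Q T' i N T z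
        ∂(surfaceMeasure d E).prod (surfaceMeasure d E) ≤
      ENNReal.ofReal (cubeOscillationConst d C c₀ p *
          (((2 : ℝ) ^ (-i)) ^ p * ((2 : ℝ) ^ (-i)) ^ d)) *
        (2⁻¹ ^ N * ∫⁻ x in T, Δ.chainWeight P.weight Q T' i N x ∂(surfaceMeasure d E)) := by
  have hc := hQ.const_pos
  have hp' : 0 < p := one_pos.trans_le hp
  have := cubeOscillationConst_nonneg (d := d) hE.one_le hc hp'
  have hweight : ∀ x ∈ T, P.weight T ≤ Δ.chainWeight P.weight Q T' i N x := fun x hx =>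
    (DyadicSystem.le_levelWeight hT hx).trans <|
      (Finset.single_le_sum (f := fun l : ℕ => Δ.levelWeight P.weight Q (i + l) x)
        (fun _ _ => zero_le) (Finset.self_mem_range_succ N)).trans le_add_self
  refine (P.setLIntegral_prod_le hE (by positivity)
    (DyadicSystem.isCube_of_mem_touching hQ hT) (DyadicSystem.measurable_chainWeight hc)
    hweight _ _).trans ?_
  refine le_of_le_of_eq (mul_le_mul' ?_ le_rfl) (mul_assoc _ _ _)
  have hκ := scaleConst_nonneg (C := C) hc
  have hA := chainAngleConst_nonneg (d := d) (s := 2 * p) hE.one_le hc (by positivity)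
  have hm := momentConst_pos (d := d) (s := 2 * p) hE.const_pos hc
  have hC := hE.const_pos
  have hhalf : (2⁻¹ : ℝ≥0∞) ^ N = ENNReal.ofReal (2⁻¹ ^ N) := by
    rw [ENNReal.ofReal_pow (by positivity), ENNReal.ofReal_inv_of_pos two_pos, ENNReal.ofReal_ofNat]
  rw [hhalf, ← ENNReal.ofReal_ofNat 2, ← ENNReal.ofReal_mul (by positivity),
    ← ENNReal.ofReal_mul (by positivity), ← ENNReal.ofReal_add (by positivity) (by positivity),
    ← ENNReal.ofReal_mul (by positivity), ← ENNReal.ofReal_mul (by positivity)]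
  exact ENNReal.ofReal_le_ofReal (cubeOscillationConst_spec hd hE.one_le hc hp i N)

lemma PlaneSelection.setLIntegral_oscillation_le (P : PlaneSelection d E (2 * p)) (hΔ : Δ.HasTop)
    (hE : IsRegular (d : ℝ) C E) (hd : d ≠ 0) (hp : 1 ≤ p)
    (hi : IsBaseGeneration E j (shift C c₀) i) (hQ : IsCube c₀ E j Q)
    (hT' : T' ∈ Δ.touching Q i) :
    ∫⁻ z in dilate E 2 Q ×ˢ dilate E 2 Q,
        ENNReal.ofReal (|‖z.1 - z.2‖ - ‖(P.plane T').direction.starProjection (z.1 - z.2)‖| ^ p)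
          ∂(surfaceMeasure d E).prod (surfaceMeasure d E) ≤
      ENNReal.ofReal (cubeOscillationConst d C c₀ p *
          (((2 : ℝ) ^ (-i)) ^ p * ((2 : ℝ) ^ (-i)) ^ d) * chainConst d C c₀) *
        Δ.weightedSum (surfaceMeasure d E) P.weight Q i := by
  have hc := hQ.const_pos
  have hp' : 0 < p := one_pos.trans_le hp
  have hK := cubeOscillationConst_nonneg (d := d) hE.one_le hc hp'
  have hcount (N : ℕ) : Countable (Δ.touching Q (i + N)) := DyadicSystem.countable_touching hc
  set μ := surfaceMeasure (d : ℝ) E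
  set K := cubeOscillationConst d C c₀ p * (((2 : ℝ) ^ (-i)) ^ p * ((2 : ℝ) ^ (-i)) ^ d)
  calc _ ≤ ∑' e : Σ N : ℕ, Δ.touching Q (i + N),
          ∫⁻ z in (e.2 : Set F) ×ˢ dilate E 2 e.2, P.majorant Δ C Q T' i e.1 e.2 z ∂μ.prod μ := by
        refine setLIntegral_le_tsum (fun e => (Δ.measurableSet_of_mem_level e.2.2.1).prod
          (measurableSet_dilate hE.isClosed.measurableSet))
          (fun e => P.measurable_majorant hc e.1 e.2) fun z hz hne => ?_
        have hxy : z.1 ≠ z.2 := fun h => hne (by simp [h, hp'.ne'])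
        obtain ⟨N, T, hT, hxT, hyT, hle⟩ :=
          P.exists_oscillation_le hΔ hE hp hi hQ hT' hz.1 hz.2 hxy
        exact ⟨⟨N, T, hT⟩, ⟨hxT, hyT⟩, hle⟩
    _ ≤ ∑' e : Σ N : ℕ, Δ.touching Q (i + N), ENNReal.ofReal K *
          (2⁻¹ ^ e.1 * ∫⁻ x in e.2, Δ.chainWeight P.weight Q T' i e.1 x ∂μ) :=
        ENNReal.tsum_le_tsum fun e => P.setLIntegral_majorant_le hE hd hp hQ e.2.2
    _ = ENNReal.ofReal K * ∑' N : ℕ, 2⁻¹ ^ N * ∑' T : Δ.touching Q (i + N),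
          ∫⁻ x in T, Δ.chainWeight P.weight Q T' i N x ∂μ := by
        rw [ENNReal.tsum_mul_left, ENNReal.tsum_sigma fun (N : ℕ) (T : Δ.touching Q (i + N)) =>
          2⁻¹ ^ N * ∫⁻ x in T, Δ.chainWeight P.weight Q T' i N x ∂μ]
        simp_rw [ENNReal.tsum_mul_left]
    _ ≤ ENNReal.ofReal K * (ENNReal.ofReal (chainConst d C c₀) * Δ.weightedSum μ P.weight Q i) := by
        gcongr
        exact hQ.tsum_chainWeight_le hE hi.le hT'
    _ = _ := by rw [← mul_assoc, ← ENNReal.ofReal_mul (by positivity)]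

end Oscillation

section WeightedSum

variable {X : Type*} [MetricSpace X] [MeasurableSpace X] {d : ℕ} {C c₀ : ℝ} {E Q : Set X}
  {i j : ℤ} {Δ : DyadicSystem c₀ E} {μ : Measure X} {B B' : Set X → ℝ≥0∞}

namespace DyadicSystem

lemma weightedSum_eq_tsum_sigma : Δ.weightedSum μ B Q i =
    ∑' e : Σ N : ℕ, Δ.touching Q (i + N), 2⁻¹ ^ e.1 * μ e.2 * B e.2 := by
  rw [ENNReal.tsum_sigma fun (N : ℕ) (T : Δ.touching Q (i + N)) => 2⁻¹ ^ N * μ T * B T]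
  simp_rw [weightedSum, levelMass, ← ENNReal.tsum_mul_left, mul_assoc, mul_comm (B _)]

lemma weightedSum_mono (h : ∀ T, B T ≤ B' T) : Δ.weightedSum μ B Q i ≤ Δ.weightedSum μ B' Q i := by
  unfold weightedSum levelMass
  gcongr
  exact h _

lemma weightedSum_add : Δ.weightedSum μ (fun T => B T + B' T) Q i =
    Δ.weightedSum μ B Q i + Δ.weightedSum μ B' Q i := by
  simp_rw [weightedSum_eq_tsum_sigma, mul_add, ENNReal.tsum_add]

lemma weightedSum_mul_left (a : ℝ≥0∞) :
    Δ.weightedSum μ (fun T => a * B T) Q i = a * Δ.weightedSum μ B Q i := by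
  simp_rw [weightedSum_eq_tsum_sigma, mul_left_comm _ a, ENNReal.tsum_mul_left]

lemma weightedSum_rpow_le {r : ℝ} (hr : 1 ≤ r) : Δ.weightedSum μ B Q i ^ r ≤
    Δ.weightedSum μ 1 Q i ^ (r - 1) * Δ.weightedSum μ (fun T => B T ^ r) Q i := by
  simp_rw [weightedSum_eq_tsum_sigma, Pi.one_apply, mul_one]
  exact tsum_mul_rpow_le _ _ hr

lemma weightedSum_add_natCast_le (t : ℕ) :
    Δ.weightedSum μ B Q (i + t) ≤ 2 ^ t * Δ.weightedSum μ B Q i := by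
  have hpow : (2 : ℝ≥0∞) ^ t * 2⁻¹ ^ t = 1 := by
    rw [← mul_pow, ENNReal.mul_inv_cancel two_ne_zero ENNReal.ofNat_ne_top, one_pow]
  unfold weightedSum
  calc _ = ∑' N : ℕ, 2 ^ t * (2⁻¹ ^ (N + t) * Δ.levelMass μ B Q (i + (N + t : ℕ))) := by
        refine tsum_congr fun N => ?_
        rw [add_assoc i, add_comm (t : ℤ), ← Nat.cast_add, pow_add, mul_comm (2⁻¹ ^ N) (2⁻¹ ^ t),
          mul_assoc, ← mul_assoc, hpow, one_mul]
    _ ≤ ∑' N : ℕ, 2 ^ t * (2⁻¹ ^ N * Δ.levelMass μ B Q (i + N)) :=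
        ENNReal.tsum_comp_le_tsum_of_injective (add_left_injective t)
          fun N : ℕ => 2 ^ t * (2⁻¹ ^ N * Δ.levelMass μ B Q (i + N))
    _ = _ := ENNReal.tsum_mul_left

lemma weightedSum_le_of_isBaseGeneration {k : ℕ} (hi : IsBaseGeneration E j k i) :
    Δ.weightedSum μ B Q i ≤ 2 ^ k * Δ.weightedSum μ B Q (j - k) := by
  have hsub := hi.sub_le
  have hle := hi.le
  obtain ⟨t, rfl⟩ : ∃ t : ℕ, i = j - k + t := ⟨(i - (j - k)).toNat, by lia⟩
  refine (weightedSum_add_natCast_le t).trans ?_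
  gcongr
  · exact one_le_two
  · lia

/- Bounds with an error `δ` in the weight extend to `δ = 0` because the total mass is finite. -/
lemma le_mul_weightedSum_rpow_of_forall_pos {a b : ℝ≥0∞} {s : ℝ} (ha : a ≠ ⊤) (hs : 1 ≤ s)
    (hfin : Δ.weightedSum μ 1 Q i ≠ ⊤)
    (h : ∀ δ : ℝ, 0 < δ → b ≤ a * Δ.weightedSum μ (fun T => (B T + ENNReal.ofReal δ) ^ s) Q i) :
    b ≤ a * (2 ^ (s - 1) * Δ.weightedSum μ (fun T => B T ^ s) Q i) := by
  have hs' : 0 < s := one_pos.trans_le hs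
  have htwo : (2 : ℝ≥0∞) ^ (s - 1) ≠ ⊤ :=
    ENNReal.rpow_ne_top_of_nonneg (sub_nonneg.2 hs) ENNReal.ofNat_ne_top
  have hle (δ : ℝ) (hδ : 0 < δ) : b ≤ a * (2 ^ (s - 1) *
      (Δ.weightedSum μ (fun T => B T ^ s) Q i + ENNReal.ofReal δ ^ s * Δ.weightedSum μ 1 Q i)) := by
    refine (h δ hδ).trans (mul_le_mul_right ?_ a)
    rw [← weightedSum_mul_left (ENNReal.ofReal δ ^ s), ← weightedSum_add,
      ← weightedSum_mul_left (2 ^ (s - 1))]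
    refine weightedSum_mono fun T => ?_
    simpa using ENNReal.rpow_add_le_mul_rpow_add_rpow (B T) (ENNReal.ofReal δ) hs
  have hlim : Filter.Tendsto (fun δ : ℝ => ENNReal.ofReal δ ^ s) (nhdsWithin 0 (Set.Ioi 0))
      (nhds 0) := by
    have hcont : Continuous fun δ : ℝ => ENNReal.ofReal δ ^ s :=
      (ENNReal.continuous_rpow_const).comp ENNReal.continuous_ofReal
    simpa [hs'] using (hcont.tendsto 0).mono_left nhdsWithin_le_nhds
  have hlim' := ENNReal.Tendsto.const_mul (a := a) (ENNReal.Tendsto.const_mul (a := 2 ^ (s - 1))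
    ((ENNReal.Tendsto.mul_const hlim (.inr hfin)).const_add
      (Δ.weightedSum μ (fun T => B T ^ s) Q i)) (.inr htwo)) (.inr ha)
  rw [zero_mul, add_zero] at hlim'
  exact ge_of_tendsto hlim' (eventually_mem_nhdsWithin.mono hle)

end DyadicSystem

lemma IsCube.weightedSum_one_le [BorelSpace X] [SecondCountableTopology X]
    (hE : IsRegular (d : ℝ) C E) (hQ : IsCube c₀ E j Q) (hij : i ≤ j) :
    Δ.weightedSum (surfaceMeasure d E) 1 Q i ≤
      ENNReal.ofReal (2 * (C * (6 * c₀⁻¹ * (2 : ℝ) ^ (-i)) ^ d)) := by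
  calc Δ.weightedSum (surfaceMeasure d E) 1 Q i
      ≤ ∑' N : ℕ, (2⁻¹ : ℝ≥0∞) ^ N * ENNReal.ofReal (C * (6 * c₀⁻¹ * (2 : ℝ) ^ (-i)) ^ d) := by
        unfold DyadicSystem.weightedSum DyadicSystem.levelMass
        simp_rw [Pi.one_apply, one_mul]
        gcongr
        exact DyadicSystem.tsum_measure_touching_le hE hQ hij (by lia)
    _ = _ := by
        rw [ENNReal.tsum_mul_right, ENNReal.tsum_geometric, ENNReal.one_sub_inv_two, inv_inv,
          ENNReal.ofReal_mul zero_le_two, ENNReal.ofReal_ofNat]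

end WeightedSum

section IotaSingle

variable {X : Type*} [MetricSpace X] {p : ℝ} {π : X → X} {S : Set X}

lemma abs_dist_sub_div_diam_rpow_nonneg (x y : X) :
    0 ≤ (|dist x y - dist (π x) (π y)| / diam S) ^ p :=
  Real.rpow_nonneg (div_nonneg (abs_nonneg _) diam_nonneg) _

variable [MeasurableSpace X] {μ : Measure X}

lemma iotaSingle_nonneg : 0 ≤ iotaSingle μ p π S :=
  Real.rpow_nonneg (mul_nonneg (by positivity) (integral_nonneg fun _ => integral_nonneg fun _ =>
    abs_dist_sub_div_diam_rpow_nonneg _ _)) _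

lemma ofReal_iotaSingle_rpow_le (hp : 0 < p) : ENNReal.ofReal (iotaSingle μ p π S ^ p) ≤
    ENNReal.ofReal (1 / μ.real S ^ 2 * (diam S ^ p)⁻¹) *
      ∫⁻ y in S, ∫⁻ x in S, ENNReal.ofReal (|dist x y - dist (π x) (π y)| ^ p) ∂μ ∂μ := by
  have hD : 0 ≤ diam S := diam_nonneg
  have hnonneg (y : X) : 0 ≤ ∫ x in S, (|dist x y - dist (π x) (π y)| / diam S) ^ p ∂μ :=
    integral_nonneg fun x => abs_dist_sub_div_diam_rpow_nonneg x y
  rw [iotaSingle, ← Real.rpow_mul (mul_nonneg (by positivity) (integral_nonneg hnonneg)),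
    one_div_mul_cancel hp.ne', Real.rpow_one, ENNReal.ofReal_mul (by positivity),
    ENNReal.ofReal_mul (by positivity), mul_assoc]
  gcongr
  rw [← lintegral_const_mul' _ _ ENNReal.ofReal_ne_top]
  refine (ofReal_integral_le_lintegral hnonneg).trans (lintegral_mono fun y => ?_)
  rw [← lintegral_const_mul' _ _ ENNReal.ofReal_ne_top]
  refine (ofReal_integral_le_lintegral fun x => abs_dist_sub_div_diam_rpow_nonneg x y).trans
    (lintegral_mono fun x => le_of_eq ?_)
  rw [← ENNReal.ofReal_mul (by positivity), Real.div_rpow (abs_nonneg _) hD, div_eq_inv_mul]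

end IotaSingle

section Iota

variable {n d : ℕ} {C c₀ p : ℝ} {E Q S : Set (EuclideanSpace ℝ (Fin n))} {j : ℤ}
  {Δ : DyadicSystem c₀ E}

lemma Planes.dist_proj_proj (V : Planes d n) (x y : EuclideanSpace ℝ (Fin n)) :
    dist (V.proj x) (V.proj y) = ‖V.1.direction.starProjection (x - y)‖ := by
  have : Nonempty V.1 := V.2.1
  have h := (EuclideanGeometry.orthogonalProjection V.1).linearMap_vsub x y
  rw [EuclideanGeometry.orthogonalProjection_linear] at h
  simpa [Planes.proj, dist_eq_norm] using congrArg norm h.symm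

lemma iota_nonneg : 0 ≤ iota d E p S := Real.iInf_nonneg fun _ => iotaSingle_nonneg

lemma beta_nonneg : 0 ≤ beta d E p S := Real.iInf_nonneg fun _ => betaSingle_nonneg

lemma ofReal_iota_rpow_le_setLIntegral [SFinite (surfaceMeasure d E)] (hp : 0 < p)
    (V : Planes d n) : ENNReal.ofReal (iota d E p S ^ p) ≤
      ENNReal.ofReal (1 / (surfaceMeasure d E).real S ^ 2 * (diam S ^ p)⁻¹) *
        ∫⁻ z in S ×ˢ S,
          ENNReal.ofReal (|‖z.1 - z.2‖ - ‖V.1.direction.starProjection (z.1 - z.2)‖| ^ p)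
            ∂(surfaceMeasure d E).prod (surfaceMeasure d E) := by
  have hle : iota d E p S ≤ iotaSingle (surfaceMeasure d E) p V.proj S :=
    ciInf_le ⟨0, by rintro _ ⟨W, rfl⟩; exact iotaSingle_nonneg⟩ V
  refine (ENNReal.ofReal_le_ofReal (Real.rpow_le_rpow iota_nonneg hle hp.le)).trans
    ((ofReal_iotaSingle_rpow_le hp).trans_eq ?_)
  rw [← Measure.prod_restrict, lintegral_prod_symm _ (by fun_prop)]
  simp_rw [V.dist_proj_proj, dist_eq_norm]

lemma exists_planeSelection [Nonempty (Planes d n)] (E : Set (EuclideanSpace ℝ (Fin n))) (s : ℝ)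
    {δ : ℝ} (hδ : 0 < δ) :
    ∃ P : PlaneSelection d E s, ∀ T, P.bound T = beta d E s (dilate E 2 T) + δ := by
  choose V hV using fun T : Set (EuclideanSpace ℝ (Fin n)) =>
    exists_lt_of_ciInf_lt (lt_add_of_pos_right (beta d E s (dilate E 2 T)) hδ)
  exact ⟨⟨fun T => (V T).1, fun T => (V T).2.1, fun T => (V T).2.2, _,
    fun T => add_pos_of_nonneg_of_pos beta_nonneg hδ, fun T => (hV T).le⟩, fun _ => rfl⟩

/-- The constant in the bound of `iota` on a cube by a square function of flatness bounds. -/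
def iotaConst (d : ℕ) (C c₀ p : ℝ) : ℝ :=
  ((C⁻¹ * c₀ ^ d) ^ 2)⁻¹ * ((C⁻¹ ^ 2 * c₀) ^ p)⁻¹ * cubeOscillationConst d C c₀ p *
    ((2 ^ shift C c₀) ^ p * (2 ^ shift C c₀) ^ d) * chainConst d C c₀ * 2 ^ shift C c₀

lemma chainConst_nonneg (hC : 0 ≤ C) (hc : 0 ≤ c₀) : 0 ≤ chainConst d C c₀ := by
  rw [chainConst]
  positivity

lemma iotaConst_nonneg (hC : 1 ≤ C) (hc : 0 < c₀) (hp : 0 < p) : 0 ≤ iotaConst d C c₀ p := by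
  have := cubeOscillationConst_nonneg (d := d) hC hc hp
  have := chainConst_nonneg (d := d) (one_pos.trans_le hC).le hc.le
  rw [iotaConst]
  positivity

lemma iotaConst_spec (hC : 1 ≤ C) (hc : 0 < c₀) (hp : 0 < p) {L ℓ m D : ℝ} (hL : 0 < L)
    (hℓ : 0 < ℓ) (hm : C⁻¹ * (c₀ * L) ^ d ≤ m) (hD : C⁻¹ ^ 2 * c₀ * L ≤ D)
    (hℓL : ℓ ≤ 2 ^ shift C c₀ * L) :
    1 / m ^ 2 * (D ^ p)⁻¹ *
        (cubeOscillationConst d C c₀ p * (ℓ ^ p * ℓ ^ d) * chainConst d C c₀) * 2 ^ shift C c₀ ≤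
      iotaConst d C c₀ p * (L ^ d)⁻¹ := by
  have hosc := cubeOscillationConst_nonneg (d := d) hC hc hp
  have hC' : 0 < C := one_pos.trans_le hC
  have hchain := chainConst_nonneg (d := d) hC'.le hc.le
  set κ := C⁻¹ ^ 2 * c₀ with hκ_def
  have hκ : 0 < κ := by positivity
  have hD' : 0 < D := (mul_pos hκ hL).trans_le hD
  calc _ ≤ 1 / (C⁻¹ * (c₀ * L) ^ d) ^ 2 * ((κ * L) ^ p)⁻¹ * (cubeOscillationConst d C c₀ p *
          ((2 ^ shift C c₀ * L) ^ p * (2 ^ shift C c₀ * L) ^ d) * chainConst d C c₀) *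
          2 ^ shift C c₀ := by gcongr
    _ = iotaConst d C c₀ p * (L ^ d)⁻¹ := by
        have hLp : L ^ p ≠ 0 := (Real.rpow_pos_of_pos hL p).ne'
        have hκp : κ ^ p ≠ 0 := (Real.rpow_pos_of_pos hκ p).ne'
        rw [iotaConst, ← hκ_def, Real.mul_rpow hκ.le hL.le, Real.mul_rpow (by positivity) hL.le,
          mul_pow c₀ L, mul_pow _ L]
        field_simp

lemma PlaneSelection.ofReal_iota_rpow_le (P : PlaneSelection d E (2 * p)) (hΔ : Δ.HasTop)
    (hE : IsRegular (d : ℝ) C E) (hp : 1 ≤ p) (hQ : IsCube c₀ E j Q) :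
    ENNReal.ofReal (iota d E p (dilate E 2 Q) ^ p) ≤
      ENNReal.ofReal (iotaConst d C c₀ p * (((2 : ℝ) ^ (-j)) ^ d)⁻¹) *
        Δ.weightedSum (surfaceMeasure d E) P.weight Q (j - shift C c₀) := by
  have hc := hQ.const_pos
  have hp' : 0 < p := one_pos.trans_le hp
  have := hE.sigmaFinite_surfaceMeasure
  obtain ⟨i, hi⟩ := exists_isBaseGeneration hQ.mem_generations (shift C c₀)
  obtain ⟨x, hx⟩ := hQ.nonempty
  obtain ⟨T', hT', hxT'⟩ := Δ.exists_mem_level hi.mem (hQ.subset hx)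
  have htouch : T' ∈ Δ.touching Q i := ⟨hT', x, hxT', subset_dilate hQ.subset hx⟩
  have hm := ENNReal.toReal_mono (hQ.measure_dilate_ne_top hE)
    ((hQ.le_measure hE).trans (measure_mono (subset_dilate hQ.subset)))
  have hC := hE.const_pos
  rw [ENNReal.toReal_ofReal (by positivity)] at hm
  refine (ofReal_iota_rpow_le_setLIntegral hp'
    ⟨P.plane T', P.nonempty_plane T', P.finrank_direction T'⟩).trans ?_
  have hosc := P.setLIntegral_oscillation_le hΔ hE hE.dim_ne_zero hp hi hQ htouch
  refine (mul_le_mul_right (hosc.trans (mul_le_mul_right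
    (DyadicSystem.weightedSum_le_of_isBaseGeneration hi) _)) _).trans ?_
  have htwo : (2 : ℝ≥0∞) ^ shift C c₀ = ENNReal.ofReal (2 ^ shift C c₀) := by
    rw [ENNReal.ofReal_pow zero_le_two, ENNReal.ofReal_ofNat]
  rw [htwo, ← mul_assoc, ← mul_assoc, ← ENNReal.ofReal_mul (by positivity),
    ← ENNReal.ofReal_mul' (by positivity)]
  exact mul_le_mul_left (ENNReal.ofReal_le_ofReal (iotaConst_spec hE.one_le hc hp' (by positivity)
    (by positivity) hm (hQ.le_diam_dilate hE) (two_zpow_neg_le hi.sub_le))) _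

lemma IsCube.ofReal_iota_rpow_le [Nonempty (Planes d n)] (hΔ : Δ.HasTop)
    (hE : IsRegular (d : ℝ) C E) (hp : 1 ≤ p) (hQ : IsCube c₀ E j Q) :
    ENNReal.ofReal (iota d E p (dilate E 2 Q) ^ p) ≤
      ENNReal.ofReal (iotaConst d C c₀ p * (((2 : ℝ) ^ (-j)) ^ d)⁻¹ * 2 ^ (2 * p - 1)) *
        Δ.weightedSum (surfaceMeasure d E)
          (fun T => ENNReal.ofReal (beta d E (2 * p) (dilate E 2 T)) ^ (2 * p)) Q
            (j - shift C c₀) := by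
  have htwo : (2 : ℝ≥0∞) ^ (2 * p - 1) = ENNReal.ofReal (2 ^ (2 * p - 1)) := by
    rw [← ENNReal.ofReal_rpow_of_pos two_pos, ENNReal.ofReal_ofNat]
  rw [ENNReal.ofReal_mul' (by positivity), ← htwo, mul_assoc]
  refine DyadicSystem.le_mul_weightedSum_rpow_of_forall_pos ENNReal.ofReal_ne_top (by linarith)
    (ne_top_of_le_ne_top ENNReal.ofReal_ne_top (hQ.weightedSum_one_le hE (by lia))) fun δ hδ => ?_
  obtain ⟨P, hP⟩ := exists_planeSelection (d := d) E (2 * p) hδ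
  refine (P.ofReal_iota_rpow_le hΔ hE hp hQ).trans_eq ?_
  congr 2 with T
  rw [PlaneSelection.weight, hP, ← ENNReal.ofReal_add beta_nonneg hδ.le,
    ENNReal.ofReal_rpow_of_nonneg (add_nonneg beta_nonneg hδ.le) (by linarith)]

end Iota

section IotaPow

variable {n d : ℕ} {C c₀ p q : ℝ} {E Q : Set (EuclideanSpace ℝ (Fin n))} {j : ℤ}
  {Δ : DyadicSystem c₀ E}

/-- The constant in the bound of the summands of the square function of `iota` by those of
`beta`. -/
def iotaPowConst (d : ℕ) (C c₀ p q : ℝ) : ℝ :=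
  (iotaConst d C c₀ p * 2 ^ (2 * p - 1)) ^ (q / p) *
    (2 * (C * (6 * c₀⁻¹ * 2 ^ shift C c₀) ^ d)) ^ (q / p - 1) * (C * (4 * c₀⁻¹) ^ d)

lemma iotaPowConst_eq (hC : 1 ≤ C) (hc : 0 < c₀) (hp : 0 < p) {L : ℝ} (hL : 0 < L) :
    (iotaConst d C c₀ p * (L ^ d)⁻¹ * 2 ^ (2 * p - 1)) ^ (q / p) *
        (2 * (C * (6 * c₀⁻¹ * (2 ^ shift C c₀ * L)) ^ d)) ^ (q / p - 1) *
        (C * (4 * c₀⁻¹ * L) ^ d) = iotaPowConst d C c₀ p q := by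
  have hconst := iotaConst_nonneg (d := d) hC hc hp
  have : 0 < C := one_pos.trans_le hC
  have hLd : 0 < L ^ d := pow_pos hL d
  set κ := 2 * (C * (6 * c₀⁻¹ * 2 ^ shift C c₀) ^ d) with hκ
  have hκ' : 2 * (C * (6 * c₀⁻¹ * (2 ^ shift C c₀ * L)) ^ d) = κ * L ^ d := by
    rw [hκ, ← mul_assoc (6 * c₀⁻¹), mul_pow _ L]
    ring
  have hpow : (L ^ d) ^ (q / p) ≠ 0 := (Real.rpow_pos_of_pos hLd _).ne'
  rw [iotaPowConst, ← hκ, hκ', mul_right_comm (iotaConst d C c₀ p),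
    Real.mul_rpow (by positivity) (by positivity), Real.mul_rpow (x := κ) (by positivity) hLd.le,
    Real.inv_rpow hLd.le, Real.rpow_sub_one hLd.ne', mul_pow _ L]
  field_simp

/- Jensen's inequality for the total mass of the square function, which is comparable to the measure
of the cube. -/
lemma IsCube.ofReal_iota_rpow_mul_measure_le [Nonempty (Planes d n)] (hΔ : Δ.HasTop)
    (hE : IsRegular (d : ℝ) C E) (hp : 1 ≤ p) (hpq : p ≤ q) (hQ : IsCube c₀ E j Q) :
    ENNReal.ofReal (iota d E p (dilate E 2 Q) ^ q) * surfaceMeasure d E Q ≤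
      ENNReal.ofReal (iotaPowConst d C c₀ p q) * Δ.weightedSum (surfaceMeasure d E)
        (fun T => ENNReal.ofReal (beta d E (2 * p) (dilate E 2 T) ^ (2 * q))) Q
          (j - shift C c₀) := by
  have hc := hQ.const_pos
  have hC := hE.const_pos
  have hp' : 0 < p := one_pos.trans_le hp
  have hr : 1 ≤ q / p := (one_le_div hp').2 hpq
  have hconst := iotaConst_nonneg (d := d) hE.one_le hc hp'
  have hiota : ENNReal.ofReal (iota d E p (dilate E 2 Q) ^ q) =
      ENNReal.ofReal (iota d E p (dilate E 2 Q) ^ p) ^ (q / p) := by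
    rw [ENNReal.ofReal_rpow_of_nonneg (Real.rpow_nonneg iota_nonneg _) (by linarith),
      ← Real.rpow_mul iota_nonneg, mul_div_cancel₀ _ hp'.ne']
  have hbeta (T : Set (EuclideanSpace ℝ (Fin n))) :
      ENNReal.ofReal (beta d E (2 * p) (dilate E 2 T) ^ (2 * q)) =
        (ENNReal.ofReal (beta d E (2 * p) (dilate E 2 T)) ^ (2 * p)) ^ (q / p) := by
    rw [← ENNReal.rpow_mul, mul_assoc, mul_div_cancel₀ _ hp'.ne',
      ENNReal.ofReal_rpow_of_nonneg beta_nonneg (by linarith)]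
  have hmass := hQ.weightedSum_one_le (Δ := Δ) hE (i := j - shift C c₀) (by lia)
  have hmeas := (measure_mono (subset_dilate hQ.subset)).trans (hQ.measure_dilate_le hE)
  have hiota_le := hQ.ofReal_iota_rpow_le hΔ hE hp
  rw [neg_sub, sub_eq_add_neg (shift C c₀ : ℤ), zpow_add₀ two_ne_zero, zpow_natCast] at hmass
  simp_rw [hiota, hbeta]
  set L : ℝ := 2 ^ (-j)
  have hL : 0 < L := by positivity
  set a := iotaConst d C c₀ p * (L ^ d)⁻¹ * 2 ^ (2 * p - 1) with ha
  set b := 2 * (C * (6 * c₀⁻¹ * (2 ^ shift C c₀ * L)) ^ d) with hb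
  have ha' : 0 ≤ a := by positivity
  have hb' : 0 ≤ b := by positivity
  rw [← iotaPowConst_eq hE.one_le hc hp' hL, ← ha, ← hb, ENNReal.ofReal_mul (by positivity),
    ENNReal.ofReal_mul (by positivity), ← ENNReal.ofReal_rpow_of_nonneg ha' (by linarith),
    ← ENNReal.ofReal_rpow_of_nonneg hb' (by linarith), mul_right_comm]
  refine mul_le_mul' ((ENNReal.rpow_le_rpow hiota_le (by linarith)).trans ?_) hmeas
  rw [ENNReal.mul_rpow_of_nonneg _ _ (by linarith), mul_assoc]
  refine mul_le_mul_right ((DyadicSystem.weightedSum_rpow_le hr).trans (mul_le_mul_left ?_ _)) _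
  exact ENNReal.rpow_le_rpow hmass (by linarith)

end IotaPow

section Packing

lemma tsum_tsum_le_of_encard_le {α β : Type*} {s : α → Set β} {t : Set β} {K : ℝ≥0∞}
    (hst : ∀ a, s a ⊆ t) (hK : ∀ b ∈ t, ({a | b ∈ s a}.encard : ℝ≥0∞) ≤ K) (g : β → ℝ≥0∞) :
    ∑' a, ∑' b : s a, g b ≤ K * ∑' b : t, g b := by
  have hswap (a : α) (b : β) :
      (s a).indicator g b = t.indicator g b * {a | b ∈ s a}.indicator 1 a := by
    by_cases hb : b ∈ s a
    · simp [hb, hst a hb]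
    · simp [hb]
  simp_rw [tsum_subtype _ g, hswap]
  rw [ENNReal.tsum_comm, ← ENNReal.tsum_mul_left]
  refine ENNReal.tsum_le_tsum fun b => ?_
  by_cases hb : b ∈ t
  · rw [ENNReal.tsum_mul_left, mul_comm, ← tsum_subtype]
    gcongr
    simpa using hK b hb
  · simp [hb]

lemma tsum_tsum_inv_two_pow_mul_le (a : ℕ → ℝ≥0∞) :
    ∑' t : ℕ, ∑' N : ℕ, 2⁻¹ ^ N * a (t + N) ≤ 2 * ∑' s : ℕ, a s := by
  calc ∑' t : ℕ, ∑' N : ℕ, 2⁻¹ ^ N * a (t + N) = ∑' N : ℕ, 2⁻¹ ^ N * ∑' t : ℕ, a (t + N) := by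
        rw [ENNReal.tsum_comm]
        simp_rw [ENNReal.tsum_mul_left]
    _ ≤ ∑' N : ℕ, (2⁻¹ : ℝ≥0∞) ^ N * ∑' s : ℕ, a s := by
        exact ENNReal.tsum_le_tsum fun N => mul_le_mul_right
          (ENNReal.tsum_comp_le_tsum_of_injective (add_left_injective N) a) _
    _ = 2 * ∑' s : ℕ, a s := by rw [ENNReal.tsum_mul_right, ENNReal.tsum_geometric_two]

variable {X : Type*} [MetricSpace X] [MeasurableSpace X] {d : ℕ} {C c₀ : ℝ} {E Q Q₀ : Set X}
  {i j : ℤ}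

lemma IsCube.dilate_subset_ball_of_subset (hQ : IsCube c₀ E j Q) (hQ₀ : IsCube c₀ E i Q₀)
    (hij : i ≤ j) (hsub : Q ⊆ Q₀) {x : X} (hx : x ∈ Q₀) :
    dilate E 2 Q ⊆ ball x (5 * c₀⁻¹ * (2 : ℝ) ^ (-i)) := by
  intro w hw
  obtain ⟨y, hy⟩ := hQ.nonempty
  have hc := hQ.const_pos
  have hwy : dist w y < 4 * c₀⁻¹ * (2 : ℝ) ^ (-i) :=
    (hQ.dilate_subset_ball (subset_dilate hQ.subset hy) hw).trans_le (by gcongr; simp)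
  have hyx := (dist_le_diam_of_mem hQ₀.isBounded (hsub hy) hx).trans hQ₀.diam_le
  rw [mem_ball]
  linarith [dist_triangle w y x]

lemma IsCube.lt_add_shift [BorelSpace X] (hE : IsRegular (d : ℝ) C E) (hi : IsCube c₀ E i Q)
    (hj : IsCube c₀ E j Q) : j < i + shift C c₀ := by
  by_contra! hle
  have hc := hi.const_pos
  have hC := hE.const_pos
  have hpos : 0 < c₀⁻¹ * (2 : ℝ) ^ (-j) := by positivity
  have : 3 * c₀⁻¹ * (2 : ℝ) ^ (-j) ≤ c₀⁻¹ * 2 ^ (-j) := by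
    calc 3 * c₀⁻¹ * (2 : ℝ) ^ (-j) ≤ C⁻¹ ^ 2 * c₀ * 2 ^ shift C c₀ * 2 ^ (-j) := by
          exact mul_le_mul_of_nonneg_right (three_mul_inv_le_two_pow_shift hC hc) (by positivity)
      _ = C⁻¹ ^ 2 * c₀ * 2 ^ (-(j - shift C c₀)) := by
          rw [neg_sub, sub_eq_add_neg, zpow_add₀ two_ne_zero, zpow_natCast, mul_assoc]
      _ ≤ C⁻¹ ^ 2 * c₀ * 2 ^ (-i) := by
          gcongr
          · exact one_le_two
          · lia
      _ ≤ diam Q := hi.le_diam hE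
      _ ≤ c₀⁻¹ * 2 ^ (-j) := hj.diam_le
  linarith

namespace DyadicSystem

variable {Δ : DyadicSystem c₀ E} {F : Set X} {M : ℝ≥0∞} {g : Set X → ℝ≥0∞}

variable (Δ) in
/-- The cubes of generation `i` that meet `F`. -/
def meeting (F : Set X) (i : ℤ) : Set (Set X) := {T ∈ Δ.level i | (T ∩ F).Nonempty}

lemma tsum_cubes_le_tsum_level (hc : 0 < c₀) (hc1 : c₀ ≤ 1) (hQ₀ : Q₀ ∈ Δ.level j) :
    ∑' Q : {Q // Q ∈ Δ.cubes ∧ Q ⊆ Q₀}, g Q ≤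
      ∑' t : ℕ, ∑' Q : {Q ∈ Δ.level (j + t) | Q ⊆ Q₀}, g Q := by
  refine le_trans (ENNReal.tsum_mono_subtype g ?_)
    (ENNReal.tsum_iUnion_le_tsum g fun t : ℕ => {Q ∈ Δ.level (j + t) | Q ⊆ Q₀})
  rintro Q ⟨⟨i, hQ⟩, hsub⟩
  replace hQ : Q ∈ Δ.level i := hQ
  rcases le_or_gt j i with hji | hij
  · obtain ⟨t, rfl⟩ := Int.le.dest hji
    exact Set.mem_iUnion.2 ⟨t, hQ, hsub⟩
  · obtain ⟨y, hy⟩ := (Δ.isCube hc hc1 hQ).nonempty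
    obtain rfl : Q = Q₀ := hsub.antisymm (Δ.subset_of_mem_of_mem hij.le hQ hQ₀ hy (hsub hy))
    exact Set.mem_iUnion.2 ⟨0, by simpa using hQ₀, hsub⟩

variable [BorelSpace X]

lemma encard_setOf_mem_level_le (hE : IsRegular (d : ℝ) C E) (hc : 0 < c₀) (hc1 : c₀ ≤ 1)
    (T : Set X) : {s : ℕ | T ∈ Δ.level (i + s)}.encard ≤ shift C c₀ := by
  classical
  rcases Set.eq_empty_or_nonempty {s : ℕ | T ∈ Δ.level (i + s)} with h | h
  · simp [h]
  have hmin := Nat.find_spec h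
  set s₀ := Nat.find h
  calc {s : ℕ | T ∈ Δ.level (i + s)}.encard ≤ (Finset.Ico s₀ (s₀ + shift C c₀) : Set ℕ).encard := by
        refine Set.encard_le_encard fun s hs => Finset.mem_coe.2 (Finset.mem_Ico.2
          ⟨Nat.find_min' h hs, ?_⟩)
        have := (Δ.isCube hc hc1 hmin).lt_add_shift hE (Δ.isCube hc hc1 hs)
        lia
    _ = shift C c₀ := by rw [Set.encard_coe_eq_coe_finsetCard]; simp

lemma tsum_level_le_tsum_cubes (hE : IsRegular (d : ℝ) C E) (hc : 0 < c₀) (hc1 : c₀ ≤ 1) :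
    ∑' s : ℕ, ∑' T : {T ∈ Δ.level (i + s) | T ⊆ Q₀}, g T ≤
      shift C c₀ * ∑' T : {T // T ∈ Δ.cubes ∧ T ⊆ Q₀}, g T := by
  refine tsum_tsum_le_of_encard_le (s := fun s : ℕ => {T ∈ Δ.level (i + s) | T ⊆ Q₀})
    (t := {T | T ∈ Δ.cubes ∧ T ⊆ Q₀}) (fun s T hT => ⟨⟨i + s, hT.1⟩, hT.2⟩) (fun T _ => ?_) g
  have hle : {s : ℕ | T ∈ {T ∈ Δ.level (i + s) | T ⊆ Q₀}}.encard ≤ shift C c₀ :=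
    (Set.encard_le_encard fun s hs => hs.1).trans
      (encard_setOf_mem_level_le (Δ := Δ) (i := i) hE hc hc1 T)
  simpa using ENat.toENNReal_mono hle

/- Every cube meeting `F` lies in a cube of the base generation meeting `F`, where the packing
hypothesis applies. -/
lemma tsum_meeting_le (hE : IsRegular (d : ℝ) C E) (hc : 0 < c₀) (hc1 : c₀ ≤ 1)
    (hi : IsBaseGeneration E j (shift C c₀) i)
    (hg : ∀ T₀ ∈ Δ.cubes, ∑' T : {T // T ∈ Δ.cubes ∧ T ⊆ T₀}, g T ≤ M * surfaceMeasure d E T₀) :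
    ∑' s : ℕ, ∑' T : Δ.meeting F (j - shift C c₀ + s), g T ≤
      shift C c₀ * (M * ∑' T₀ : Δ.meeting F i, surfaceMeasure d E T₀) := by
  have hcover (s : ℕ) : ∑' T : Δ.meeting F (j - shift C c₀ + s), g T ≤
      ∑' T₀ : Δ.meeting F i, ∑' T : {T ∈ Δ.level (j - shift C c₀ + s) | T ⊆ T₀}, g T := by
    refine le_trans (ENNReal.tsum_mono_subtype g ?_) (ENNReal.tsum_iUnion_le_tsum g
      fun T₀ : Δ.meeting F i => {T ∈ Δ.level (j - shift C c₀ + s) | T ⊆ T₀})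
    rintro T ⟨hT, w, hwT, hwF⟩
    obtain ⟨T₀, hT₀, hwT₀⟩ := Δ.exists_mem_level hi.mem (Δ.subset_of_mem_level hT hwT)
    exact Set.mem_iUnion.2 ⟨⟨T₀, hT₀, w, hwT₀, hwF⟩, hT,
      Δ.subset_of_mem_of_mem (hi.le_of_mem hT.1 (by lia)) hT₀ hT hwT₀ hwT⟩
  calc ∑' s : ℕ, ∑' T : Δ.meeting F (j - shift C c₀ + s), g T
      ≤ ∑' T₀ : Δ.meeting F i, ∑' s : ℕ,
          ∑' T : {T ∈ Δ.level (j - shift C c₀ + s) | T ⊆ T₀}, g T := by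
        rw [ENNReal.tsum_comm]
        exact ENNReal.tsum_le_tsum hcover
    _ ≤ ∑' T₀ : Δ.meeting F i, shift C c₀ * (M * surfaceMeasure d E T₀) := by
        refine ENNReal.tsum_le_tsum fun T₀ => (tsum_level_le_tsum_cubes hE hc hc1).trans ?_
        gcongr
        exact hg T₀ ⟨i, T₀.2.1⟩
    _ = _ := by simp_rw [ENNReal.tsum_mul_left]

variable [SecondCountableTopology X]

lemma encard_le_of_forall_subset_ball (hE : IsRegular (d : ℝ) C E) (hc : 0 < c₀) (hc1 : c₀ ≤ 1)
    {𝒬 : Set (Set X)} (h𝒬 : 𝒬 ⊆ Δ.level j) {z : X} (hz : z ∈ E) {R : ℝ} (hR : 0 < R)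
    (hball : ∀ Q ∈ 𝒬, Q ⊆ ball z (R * (2 : ℝ) ^ (-j))) :
    (𝒬.encard : ℝ≥0∞) ≤ ENNReal.ofReal (C * c₀⁻¹ ^ d * (C * R ^ d)) := by
  have hC := hE.const_pos
  set L : ℝ := 2 ^ (-j)
  have hL : ENNReal.ofReal (L ^ d) ≠ 0 := (ENNReal.ofReal_pos.2 (by positivity)).ne'
  refine (ENNReal.mul_le_mul_iff_right hL ENNReal.ofReal_ne_top).1 ?_
  calc ENNReal.ofReal (L ^ d) * 𝒬.encard = ∑' _ : 𝒬, ENNReal.ofReal (L ^ d) := by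
        rw [ENNReal.tsum_set_const, mul_comm]
    _ ≤ ∑' Q : 𝒬, ENNReal.ofReal (C * c₀⁻¹ ^ d) * surfaceMeasure d E Q :=
        ENNReal.tsum_le_tsum fun Q => (Δ.isCube hc hc1 (h𝒬 Q.2)).ofReal_pow_le hE
    _ ≤ ENNReal.ofReal (C * c₀⁻¹ ^ d) * ENNReal.ofReal (C * (R * L) ^ d) := by
        rw [ENNReal.tsum_mul_left]
        gcongr
        exact (tsum_measure_le _ hc h𝒬 hball).trans (hE.surfaceMeasure_ball_le hz (by positivity))
    _ = ENNReal.ofReal (L ^ d) * ENNReal.ofReal (C * c₀⁻¹ ^ d * (C * R ^ d)) := by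
        rw [← ENNReal.ofReal_mul (by positivity), ← ENNReal.ofReal_mul (by positivity), mul_pow]
        ring_nf

end DyadicSystem

/-- The bound for the number of cubes of a generation `j` whose dilates meet a given cube of a
generation at least `j - shift C c₀`. -/
def touchingConst (d : ℕ) (C c₀ : ℝ) : ℝ :=
  C * c₀⁻¹ ^ d * (C * ((4 + 2 ^ shift C c₀) * c₀⁻¹) ^ d)

namespace DyadicSystem

variable {Δ Δ' : DyadicSystem c₀ E} {F : Set X} {B g : Set X → ℝ≥0∞}
  [BorelSpace X] [SecondCountableTopology X]

lemma encard_setOf_mem_touching_le (hE : IsRegular (d : ℝ) C E) (hc : 0 < c₀) (hc1 : c₀ ≤ 1)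
    (hij : j - shift C c₀ ≤ i) {T : Set X} (hT : T ∈ Δ'.level i) :
    ({Q ∈ Δ.level j | T ∈ Δ'.touching Q i}.encard : ℝ≥0∞) ≤
      ENNReal.ofReal (touchingConst d C c₀) := by
  have hcube := Δ'.isCube hc hc1 hT
  obtain ⟨z, hz⟩ := hcube.nonempty
  refine encard_le_of_forall_subset_ball hE hc hc1 (fun Q hQ => hQ.1) (hcube.subset hz)
    (by positivity) ?_
  rintro Q ⟨hQ, -, w, hwT, hwQ⟩ y hy
  have hQcube := Δ.isCube hc hc1 hQ
  have hyw := mem_ball.1 (hQcube.dilate_subset_ball hwQ (subset_dilate hQcube.subset hy))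
  have hwz : dist w z ≤ c₀⁻¹ * (2 ^ shift C c₀ * 2 ^ (-j)) :=
    (dist_le_diam_of_mem hcube.isBounded hwT hz).trans
      (hcube.diam_le.trans (by gcongr; exact two_zpow_neg_le hij))
  rw [mem_ball]
  linarith [dist_triangle y w z]

lemma tsum_touching_le (hE : IsRegular (d : ℝ) C E) (hc : 0 < c₀) (hc1 : c₀ ≤ 1)
    (hij : j - shift C c₀ ≤ i) {𝒬 : Set (Set X)} (h𝒬 : 𝒬 ⊆ Δ.level j)
    (hF : ∀ Q ∈ 𝒬, dilate E 2 Q ⊆ F) :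
    ∑' Q : 𝒬, ∑' T : Δ'.touching Q i, g T ≤
      ENNReal.ofReal (touchingConst d C c₀) * ∑' T : Δ'.meeting F i, g T := by
  refine tsum_tsum_le_of_encard_le (s := fun Q : 𝒬 => Δ'.touching Q i) (t := Δ'.meeting F i)
    (fun Q T hT => ⟨hT.1, hT.2.mono (Set.inter_subset_inter_right T (hF Q Q.2))⟩)
    (fun T hT => ?_) g
  refine le_trans (ENat.toENNReal_mono ?_)
    (encard_setOf_mem_touching_le (Δ := Δ) hE hc hc1 hij hT.1)
  rw [← Subtype.val_injective.encard_image]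
  exact Set.encard_le_encard (Set.image_subset_iff.2 fun Q hQ => ⟨h𝒬 Q.2, hQ⟩)

lemma tsum_weightedSum_le (hE : IsRegular (d : ℝ) C E) (hc : 0 < c₀) (hc1 : c₀ ≤ 1)
    {𝒬 : Set (Set X)} (h𝒬 : 𝒬 ⊆ Δ.level j) (hF : ∀ Q ∈ 𝒬, dilate E 2 Q ⊆ F) {μ : Measure X} :
    ∑' Q : 𝒬, Δ'.weightedSum μ B Q (j - shift C c₀) ≤
      ENNReal.ofReal (touchingConst d C c₀) * ∑' N : ℕ, 2⁻¹ ^ N *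
        ∑' T : Δ'.meeting F (j - shift C c₀ + N), B T * μ T := by
  unfold weightedSum
  rw [ENNReal.tsum_comm, ← ENNReal.tsum_mul_left]
  refine ENNReal.tsum_le_tsum fun N => ?_
  rw [ENNReal.tsum_mul_left, mul_left_comm]
  have hij : j - shift C c₀ ≤ j - shift C c₀ + N := by lia
  exact mul_le_mul_right
    (tsum_touching_le (g := fun T => B T * μ T) hE hc hc1 hij h𝒬 hF) _

lemma tsum_measure_meeting_ball_le (hE : IsRegular (d : ℝ) C E) (hc : 0 < c₀) (hc1 : c₀ ≤ 1)
    {k : ℕ} (hij : j - k ≤ i) {x : X} (hx : x ∈ E) {R : ℝ} (hR : 0 < R) :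
    ∑' T : Δ.meeting (ball x (R * (2 : ℝ) ^ (-j))) i, surfaceMeasure d E T ≤
      ENNReal.ofReal (C * ((R + 2 ^ k * c₀⁻¹) * (2 : ℝ) ^ (-j)) ^ d) := by
  refine (tsum_measure_le _ hc (fun T hT => hT.1) ?_).trans
    (hE.surfaceMeasure_ball_le hx (by positivity))
  rintro T ⟨hT, w, hwT, hwF⟩ y hy
  have hcube := Δ.isCube hc hc1 hT
  have hyw : dist y w ≤ c₀⁻¹ * (2 ^ k * 2 ^ (-j)) :=
    (dist_le_diam_of_mem hcube.isBounded hy hwT).trans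
      (hcube.diam_le.trans (by gcongr; exact two_zpow_neg_le hij))
  rw [mem_ball] at hwF ⊢
  linarith [dist_triangle y w x]

end DyadicSystem

/-- The constant in the packing condition for the square functions of the cubes in a given cube. -/
def packingConst (d : ℕ) (C c₀ : ℝ) : ℝ :=
  touchingConst d C c₀ * (2 * (shift C c₀ *
    (C * (5 * c₀⁻¹ + 2 ^ shift C c₀ * c₀⁻¹) ^ d * (C * c₀⁻¹ ^ d))))

variable [BorelSpace X] [SecondCountableTopology X] {Δ Δ' : DyadicSystem c₀ E} {M : ℝ≥0∞}
  {B : Set X → ℝ≥0∞}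

lemma IsCube.tsum_measure_meeting_ball_le (hE : IsRegular (d : ℝ) C E) (hQ : IsCube c₀ E j Q)
    {k : ℕ} (hij : j - k ≤ i) {x : X} (hx : x ∈ Q) {R : ℝ} (hR : 0 < R) :
    ∑' T : Δ.meeting (ball x (R * (2 : ℝ) ^ (-j))) i, surfaceMeasure d E T ≤
      ENNReal.ofReal (C * (R + 2 ^ k * c₀⁻¹) ^ d * (C * c₀⁻¹ ^ d)) * surfaceMeasure d E Q := by
  have hc := hQ.const_pos
  have hC := hE.const_pos
  refine (DyadicSystem.tsum_measure_meeting_ball_le hE hc hQ.const_le_one hij (hQ.subset hx)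
    hR).trans ?_
  rw [mul_pow, ← mul_assoc, ENNReal.ofReal_mul (by positivity),
    ENNReal.ofReal_mul (p := C * (R + 2 ^ k * c₀⁻¹) ^ d) (by positivity), mul_assoc]
  gcongr
  exact hQ.ofReal_pow_le hE

lemma IsCube.tsum_tsum_weightedSum_le (hE : IsRegular (d : ℝ) C E) (hQ₀ : IsCube c₀ E j Q₀)
    (hB : ∀ T₀ ∈ Δ'.cubes, ∑' T : {T // T ∈ Δ'.cubes ∧ T ⊆ T₀},
      B T * surfaceMeasure d E T ≤ M * surfaceMeasure d E T₀) :
    ∑' t : ℕ, ∑' Q : {Q ∈ Δ.level (j + t) | Q ⊆ Q₀},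
        Δ'.weightedSum (surfaceMeasure d E) B Q (j + t - shift C c₀) ≤
      ENNReal.ofReal (packingConst d C c₀) * M * surfaceMeasure d E Q₀ := by
  have hc := hQ₀.const_pos
  have hc1 := hQ₀.const_le_one
  have hC := hE.const_pos
  obtain ⟨x, hx⟩ := hQ₀.nonempty
  obtain ⟨i, hi⟩ := exists_isBaseGeneration hQ₀.mem_generations (shift C c₀)
  set μ := surfaceMeasure (d : ℝ) E
  set F := ball x (5 * c₀⁻¹ * (2 : ℝ) ^ (-j))
  let Y : ℤ → ℝ≥0∞ := fun k => ∑' T : Δ'.meeting F k, B T * μ T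
  let a : ℕ → ℝ≥0∞ := fun s => Y (j - shift C c₀ + s)
  set κ := ENNReal.ofReal (touchingConst d C c₀)
  have hgen (t : ℕ) : ∑' Q : {Q ∈ Δ.level (j + t) | Q ⊆ Q₀},
      Δ'.weightedSum μ B Q (j + t - shift C c₀) ≤ κ * ∑' N : ℕ, 2⁻¹ ^ N * a (t + N) := by
    refine (DyadicSystem.tsum_weightedSum_le hE hc hc1 (F := F) (fun Q hQ => hQ.1) fun Q hQ =>
      (Δ.isCube hc hc1 hQ.1).dilate_subset_ball_of_subset hQ₀ (by lia) hQ.2 hx).trans_eq ?_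
    have hlevel (N : ℕ) : j + t - shift C c₀ + N = j - shift C c₀ + (t + N : ℕ) := by
      push_cast
      ring
    change κ * ∑' N : ℕ, 2⁻¹ ^ N * Y (j + t - shift C c₀ + N) = _
    simp only [a, hlevel]
  calc _ ≤ κ * ∑' t : ℕ, ∑' N : ℕ, 2⁻¹ ^ N * a (t + N) := by
        rw [← ENNReal.tsum_mul_left]
        exact ENNReal.tsum_le_tsum hgen
    _ ≤ κ * (2 * (shift C c₀ * (M * (ENNReal.ofReal
          (C * (5 * c₀⁻¹ + 2 ^ shift C c₀ * c₀⁻¹) ^ d * (C * c₀⁻¹ ^ d)) * μ Q₀)))) := by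
        gcongr
        refine (tsum_tsum_inv_two_pow_mul_le a).trans ?_
        gcongr
        refine (DyadicSystem.tsum_meeting_le (g := fun T => B T * μ T) hE hc hc1 hi hB).trans ?_
        gcongr
        exact hQ₀.tsum_measure_meeting_ball_le hE hi.sub_le hx (by positivity)
    _ = ENNReal.ofReal (packingConst d C c₀) * M * μ Q₀ := by
        have : 0 ≤ touchingConst d C c₀ := by rw [touchingConst]; positivity
        rw [packingConst, ENNReal.ofReal_mul this, ENNReal.ofReal_mul zero_le_two,
          ENNReal.ofReal_mul (p := (shift C c₀ : ℝ)) (by positivity), ENNReal.ofReal_natCast,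
          ENNReal.ofReal_ofNat]
        ring

end Packing

section Transfer

variable {n d : ℕ} {C c₀ p q : ℝ} {E : Set (EuclideanSpace ℝ (Fin n))} {M : ℝ≥0}

lemma nonempty_planes (h : d ≤ n) : Nonempty (Planes d n) := by
  obtain ⟨f, hf⟩ := exists_linearIndependent_of_le_finrank
    (R := ℝ) (M := EuclideanSpace ℝ (Fin n)) (n := d) (by simpa using h)
  refine ⟨(Submodule.span ℝ (Set.range f)).toAffineSubspace, ⟨⟨0, by simp⟩⟩, ?_⟩
  rw [Submodule.toAffineSubspace_direction]
  simpa using finrank_span_eq_card hf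

theorem gLem_iota_of_gLem_beta [Nonempty (Planes d n)] (hE : IsRegular (d : ℝ) C E) (hp : 1 ≤ p)
    (hpq : p ≤ q) (hc : 0 < c₀) (hc2 : c₀ ≤ 1 / 2)
    (hβ : GLem c₀ (d : ℝ) E (beta d E (2 * p)) (2 * q) M) :
    GLem c₀ (d : ℝ) E (iota d E p) q
      ((iotaPowConst d C c₀ p q).toNNReal * (packingConst d C c₀).toNNReal * M) := by
  rintro Δ Q₀ ⟨j, hQ₀⟩
  replace hQ₀ : Q₀ ∈ Δ.level j := hQ₀
  have hc1 : c₀ ≤ 1 := by linarith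
  have hΔ := Δ.hasTop_mergeTop hc hc2 hE.isClosed.measurableSet hE.nonempty
  set Δ' := Δ.mergeTop hc hc2 hE.isClosed.measurableSet hE.nonempty
  set μ := surfaceMeasure (d : ℝ) E
  set B := fun T => ENNReal.ofReal (beta d E (2 * p) (dilate E 2 T) ^ (2 * q))
  calc _ ≤ ∑' t : ℕ, ∑' Q : {Q ∈ Δ.level (j + t) | Q ⊆ Q₀},
          ENNReal.ofReal (iota d E p (dilate E 2 Q) ^ q) * μ Q :=
        DyadicSystem.tsum_cubes_le_tsum_level hc hc1 hQ₀
          (g := fun Q => ENNReal.ofReal (iota d E p (dilate E 2 Q) ^ q) * μ Q)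
    _ ≤ ∑' t : ℕ, ∑' Q : {Q ∈ Δ.level (j + t) | Q ⊆ Q₀}, ENNReal.ofReal (iotaPowConst d C c₀ p q) *
          Δ'.weightedSum μ B Q (j + t - shift C c₀) := by
        exact ENNReal.tsum_le_tsum fun t => ENNReal.tsum_le_tsum fun Q =>
          (Δ.isCube hc hc1 Q.2.1).ofReal_iota_rpow_mul_measure_le hΔ hE hp hpq
    _ ≤ ENNReal.ofReal (iotaPowConst d C c₀ p q) *
          (ENNReal.ofReal (packingConst d C c₀) * M * μ Q₀) := by
        simp_rw [ENNReal.tsum_mul_left]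
        gcongr
        exact (Δ.isCube hc hc1 hQ₀).tsum_tsum_weightedSum_le hE (hβ Δ')
    _ = _ := by
        rw [ENNReal.coe_mul, ENNReal.coe_mul, ENNReal.ofReal, ENNReal.ofReal]
        ring

end Transfer

end GeometricLemma

end

theorem mainTheorem3 (d : ℕ) (C p q c₀ : ℝ) (hd : 1 ≤ d) (hC : 1 ≤ C)
    (hp : 1 ≤ p) (hpq : p ≤ q) (hc₀ : 0 < c₀) (hc₀' : c₀ ≤ 1 / 2) :
    ∃ C' : ℝ≥0, ∀ (n : ℕ), d < n → ∀ E : Set (EuclideanSpace ℝ (Fin n)),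
      GeometricLemma.IsRegular (d : ℝ) C E → ∀ M : ℝ≥0,
        GeometricLemma.GLem c₀ (d : ℝ) E (GeometricLemma.beta d E (2 * p)) (2 * q) M →
        GeometricLemma.GLem c₀ (d : ℝ) E (GeometricLemma.iota d E p) q (C' * M) := by
  refine ⟨(GeometricLemma.iotaPowConst d C c₀ p q).toNNReal *
    (GeometricLemma.packingConst d C c₀).toNNReal, fun n hn E hE M hβ => ?_⟩
  have := GeometricLemma.nonempty_planes hn.le
  exact GeometricLemma.gLem_iota_of_gLem_beta hE hp hpq hc₀ hc₀' hβ
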